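/- \textbf{Setting.} Let $(\Omega,\mathcal A,\mathbb P)$ be a probability space, $S$ a topological space with Borel $\sigma$-field, $\pi$ a probability measure on $S$, $\lambda$ the Lebesgue measure on $\mathbb R$. Let $\gamma\in\mathbb R^d$, $\Sigma\in\mathbb R^{d\times d}$ positive semidefinite, and $\nu$ a Lévy measure on $\mathbb R^d$ ($\nu(\{0\})=0$, $\int(1\wedge\|x\|^2)\,\nu(dx)<\infty$). Let $\Lambda$ be an $\mathbb R^d$-valued (homogeneous, factorisable) Lévy basis on $S\times\mathbb R$ with generating quadruple $(\gamma,\Sigma,\nu,\pi)$: for each Borel set $B\subseteq S\times\mathbb R$ that is bounded in time, $\Lambda(B)$ is an infinitely divisible random vector; $\Lambda$ is independent on finitely many disjoint such sets and a.s. countably additive on disjoint sequences of such sets with union bounded in time; and $\mathbb E\,e^{i\langle u,\Lambda(B)\rangle}=e^{\Phi(u)(\pi\otimes\lambda)(B)}$ with $\Phi(u)=i\langle\gamma,u\rangle-\tfrac12\langle u,\Sigma u\rangle+\int(e^{i\langle u,x\rangle}-1-i\langle u,x\rangle 1_{\{\|x\|\le1\}})\,\nu(dx)$. Put $L_1=\Lambda(S\times(0,1])$,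 $\Sigma_L=\Sigma+\int xx'\,\nu(dx)$, $\mu=\gamma+\int_{\|x\|>1}x\,\nu(dx)$, $\gamma_0=\gamma-\int_{\|x\|\le1}x\,\nu(dx)$ (whenever these integrals exist). For measurable $f:S\times[0,\infty)\to M_{n\times d}(\mathbb R)$ consider \[(1)\ \int_S\int_0^\infty\Big\|f(A,s)\gamma+\int f(A,s)x\big(1_{[0,1]}(\|f(A,s)x\|)-1_{[0,1]}(\|x\|)\big)\nu(dx)\Big\|\,ds\,\pi(dA)<\infty,\] \[(2)\ \int_S\int_0^\infty\|f\Sigma f'\|\,ds\,\pi(dA)<\infty,\qquad(3)\ \int_S\int_0^\infty\int(1\wedge\|f(A,s)x\|^2)\,\nu(dx)\,ds\,\pi(dA)<\infty.\] A causal mixed moving average (MMA) process with kernel $f$ satisfying (1)--(3) is a process with $X_t=\int_S\int_{-\infty}^tf(A,t-s)\,\Lambda(dA,ds)$ a.s. for each $t\in\mathbb R$, the integral being the limit in probability in the sense of Rajput and Rosiński. An $\mathbb R^n$-valued process $X$ is $\theta$-weakly dependent with coefficients $\theta(r)$, $r\ge0$, if $\theta(r)\to0$ as $r\to\infty$ and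 there is a constant $c$ such that \[|\mathrm{Cov}(F(X_{i_1},\dots,X_{i_u}),G(X_{j_1},\dots,X_{j_v}))|\le c\,v\,\mathrm{Lip}(G)\,\|F\|_\infty\,\theta(r)\] for all $u,v\ge1$, $r\ge0$, $i_1\le\dots\le i_u\le i_u+r\le j_1\le\dots\le j_v$, all measurable $F:(\mathbb R^n)^u\to\mathbb R$ with $\|F\|_\infty\le1$ and all Lipschitz $G:(\mathbb R^n)^v\to\mathbb R$ with $\|G\|_\infty\le1$, where $\mathrm{Lip}(G)=\sup_{x\ne y}|G(x)-G(y)|/\sum_k\|x_k-y_k\|$. \textbf{Part I (causal MMA processes).} In each of (a)--(c) below a causal MMA process $X$ with kernel $f$ exists, in particular (1)--(3) hold, and every such $X$ is $\theta$-weakly dependent with the stated coefficients, $r\ge0$. (a) If $\mathbb E[L_1]=0$, $\int_{\|x\|>1}\|x\|^2\nu(dx)<\infty$ and $f\in L^2(S\times[0,\infty),\pi\otimes\lambda)$: \[\theta_X(r)=\Big(\int_S\int_{-\infty}^{-r}\mathrm{tr}\big(f(A,-s)\Sigma_Lf(A,-s)'\big)\,ds\,\pi(dA)\Big)^{1/2},\]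 and $L_1$ is square integrable with $\mathbb E[L_1L_1']=\Sigma_L$. (b) If $\int_{\|x\|>1}\|x\|^2\nu(dx)<\infty$, $f\in L^2(S\times[0,\infty),\pi\otimes\lambda)$ and (1) holds: \[\theta_X(r)=\Big(\int_S\int_{-\infty}^{-r}\mathrm{tr}\big(f(A,-s)\Sigma_Lf(A,-s)'\big)\,ds\,\pi(dA)+\Big\|\int_S\int_{-\infty}^{-r}f(A,-s)\mu\,ds\,\pi(dA)\Big\|^2\Big)^{1/2},\] and $L_1$ is square integrable with $\mathbb E[L_1]=\mu$ and covariance matrix $\Sigma_L$. (c) If $\Sigma=0$, $\int\|x\|\,\nu(dx)<\infty$ and $f\in L^1(S\times[0,\infty),\pi\otimes\lambda)$: \[\theta_X(r)=\int_S\int_{-\infty}^{-r}\int\|f(A,-s)x\|\,\nu(dx)\,ds\,\pi(dA)+\int_S\int_{-\infty}^{-r}\|f(A,-s)\gamma_0\|\,ds\,\pi(dA).\] \textbf{Part II (supOU processes).} Let $n=d=1$, $S=(-\infty,0)$, $f(A,s)=e^{As}1_{[0,\infty)}(s)$, $\int_S-\frac1A\,\pi(dA)<\infty$, and write $\sigma^2=\Sigma+\int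 x^2\,\nu(dx)$. In each of (d)--(f) below the causal MMA process $X_t=\int_{(-\infty,0)}\int_{-\infty}^te^{A(t-s)}\Lambda(dA,ds)$ exists, and every such $X$ is $\theta$-weakly dependent with the stated coefficients; the stated identities hold for all $r\ge0$. (d) If $\mathbb E[L_1]=0$ and $\int_{|x|>1}x^2\nu(dx)<\infty$, the coefficients in (a) are \[\theta_X(r)=\Big(\int_{(-\infty,0)}\int_{-\infty}^{-r}e^{-2As}\sigma^2\,ds\,\pi(dA)\Big)^{1/2}=\Big(-\sigma^2\int_{(-\infty,0)}\frac{e^{2Ar}}{2A}\,\pi(dA)\Big)^{1/2}=\mathrm{Cov}(X_0,X_{2r})^{1/2}.\] (e) If $\mathbb E[L_1]=\mu$, $\int_{|x|>1}x^2\nu(dx)<\infty$ and $(\Sigma,\nu)\ne(0,0)$, the coefficients in (b) are \[\theta_X(r)=\Big(\mathrm{Cov}(X_0,X_{2r})+\frac{4\mu^2}{\sigma^4}\mathrm{Cov}(X_0,X_r)^2\Big)^{1/2}.\] (f) If $\Sigma=0$, $\int|x|\,\nu(dx)<\infty$, $\gamma_0\ge0$ and $\nu((-\infty,0))=0$ (the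 underlying Lévy process is a subordinator with finite mean $\mu=\mathbb E[L_1]$), the coefficients in (c) are \[\theta_X(r)=-\mu\int_{(-\infty,0)}\frac{e^{Ar}}{A}\,\pi(dA),\] and if in addition $\int_{|x|>1}x^2\nu(dx)<\infty$ and $\nu\ne0$, then $X$ is $\theta$-weakly dependent with these coefficients written as $\theta_X(r)=\frac{2\mu}{\sigma^2}\mathrm{Cov}(X_0,X_r)$. -/

import Mathlib

open MeasureTheory ProbabilityTheory Filter Topology
open scoped ENNReal Matrix Matrix.Norms.L2Operator

noncomputable section

namespace MMA

/-- `ℝᵏ` with the Euclidean norm. -/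
abbrev E (k : ℕ) : Type := EuclideanSpace ℝ (Fin k)

/-- The product of a matrix and a column vector, between Euclidean spaces. -/
def app {n d : ℕ} (M : Matrix (Fin n) (Fin d) ℝ) (x : E d) : E n :=
  WithLp.toLp 2 (M *ᵥ x.ofLp)

/-! ### Characteristic triplets -/

/-- A characteristic triplet `(γ, Σ, ν)` on `ℝᵈ`: a drift vector, a positive semidefinite matrix
and a Lévy measure. -/
structure LevyTriplet (d : ℕ) where
  gam : E d
  sig : Matrix (Fin d) (Fin d) ℝ
  nu : Measure (E d)
  sig_posSemidef : sig.PosSemidef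
  nu_zero : nu {0} = 0
  nu_levy : ∫⁻ x, min 1 (‖x‖ₑ ^ 2) ∂nu < ⊤

namespace LevyTriplet

variable {d : ℕ} (T : LevyTriplet d)

/-- The cumulant transform
`Φ(u) = i⟨γ,u⟩ - ⟨u,Σu⟩/2 + ∫ (exp(i⟨u,x⟩) - 1 - i⟨u,x⟩ 1_{‖x‖ ≤ 1}) ν(dx)`. -/
def cumulant (u : E d) : ℂ :=
  Complex.I * ((inner ℝ T.gam u : ℝ) : ℂ) - (1 / 2 : ℂ) * ((inner ℝ u (app T.sig u) : ℝ) : ℂ)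
    + ∫ x, (Complex.exp (Complex.I * ((inner ℝ u x : ℝ) : ℂ)) - 1
        - Complex.I * ((inner ℝ u x : ℝ) : ℂ) * (if ‖x‖ ≤ 1 then 1 else 0)) ∂T.nu

/-- `μ = γ + ∫_{‖x‖ > 1} x ν(dx)`. -/
def mean : E d := T.gam + ∫ x in {x : E d | 1 < ‖x‖}, x ∂T.nu

/-- `Σ_L = Σ + ∫ x x' ν(dx)`. -/
def sigL : Matrix (Fin d) (Fin d) ℝ :=
  T.sig + Matrix.of fun i j => ∫ x : E d, x i * x j ∂T.nu

/-- `γ₀ = γ - ∫_{‖x‖ ≤ 1} x ν(dx)`. -/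
def gam0 : E d := T.gam - ∫ x in {x : E d | ‖x‖ ≤ 1}, x ∂T.nu

end LevyTriplet

/-! ### Lévy bases -/

/-- Infinite divisibility: for each `k ≥ 1`, the measure is a `k`-fold convolution power of a
probability measure. -/
def IsInfinitelyDivisible {d : ℕ} (μ : Measure (E d)) : Prop :=
  ∀ k : ℕ, 0 < k → ∃ ρ : Measure (E d), IsProbabilityMeasure ρ ∧
    (Measure.pi fun _ : Fin k => ρ).map (fun x => ∑ i, x i) = μ

section Basis

variable {Ω S : Type*} [MeasurableSpace Ω] [MeasurableSpace S]

/-- The bounded Borel sets of `S × ℝ`: those whose projection to the time axis is bounded. -/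
def IsBddBorel (B : Set (S × ℝ)) : Prop :=
  MeasurableSet B ∧ ∃ N : ℝ, ∀ p ∈ B, |p.2| ≤ N

/-- `Λ` is a (homogeneous, factorisable) `ℝᵈ`-valued Lévy basis on `S × ℝ` with generating
quadruple `(γ, Σ, ν, π)`, where `T = (γ, Σ, ν)`. Only the values `Λ B` at bounded Borel sets `B`
matter. -/
structure IsLevyBasis (P : Measure Ω) (π : Measure S) {d : ℕ} (T : LevyTriplet d)
    (Λ : Set (S × ℝ) → Ω → E d) : Prop where
  measurable : ∀ B, IsBddBorel B → Measurable (Λ B)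
  infDiv : ∀ B, IsBddBorel B → IsInfinitelyDivisible (P.map (Λ B))
  indep : ∀ (k : ℕ) (B : Fin k → Set (S × ℝ)), (∀ i, IsBddBorel (B i)) →
    Pairwise (Function.onFun Disjoint B) → iIndepFun (fun i => Λ (B i)) P
  sigmaAdd : ∀ B : ℕ → Set (S × ℝ), (∀ i, IsBddBorel (B i)) →
    Pairwise (Function.onFun Disjoint B) → IsBddBorel (⋃ i, B i) →
    ∀ᵐ ω ∂P, Tendsto (fun k => ∑ i ∈ Finset.range k, Λ (B i) ω) atTop (𝓝 (Λ (⋃ i, B i) ω))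
  charFun_eq : ∀ B, IsBddBorel B → ∀ u : E d,
    charFun (P.map (Λ B)) u = Complex.exp (T.cumulant u * (((π.prod volume) B).toReal : ℂ))

/-- The value at time `1` of the underlying Lévy process, `L₁ = Λ(S × (0,1])`. -/
def levyOne {d : ℕ} (Λ : Set (S × ℝ) → Ω → E d) : Ω → E d :=
  Λ (Set.univ ×ˢ Set.Ioc 0 1)

/-! ### The integral of a deterministic function with respect to a Lévy basis -/

/-- `∫_A g dΛ = ∑ₐ a Λ({g = a} ∩ A)` for a simple function `g` (with bounded support). -/
def simpleIntegral {n d : ℕ} (Λ : Set (S × ℝ) → Ω → E d)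
    (g : SimpleFunc (S × ℝ) (Matrix (Fin n) (Fin d) ℝ)) (A : Set (S × ℝ)) (ω : Ω) : E n :=
  ∑ a ∈ g.range, app a (Λ (g ⁻¹' {a} ∩ A) ω)

/-- `f` is `Λ`-integrable and `Y` is (a version of) `∫ f dΛ`, as a limit in probability in the sense
of Rajput and Rosiński: there are simple functions `g k` with bounded supports that converge to `f`
almost everywhere, such that `∫_A g k dΛ` converges in probability for each Borel set `A`,
and `∫ g k dΛ → Y` in probability. -/
def IsLevyIntegral (P : Measure Ω) (π : Measure S) {n d : ℕ} (Λ : Set (S × ℝ) → Ω → E d)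
    (f : S × ℝ → Matrix (Fin n) (Fin d) ℝ) (Y : Ω → E n) : Prop :=
  ∃ g : ℕ → SimpleFunc (S × ℝ) (Matrix (Fin n) (Fin d) ℝ),
    (∀ k, ∃ N : ℝ, ∀ p : S × ℝ, N < |p.2| → g k p = 0) ∧
    (∀ᵐ p ∂(π.prod volume), Tendsto (fun k => g k p) atTop (𝓝 (f p))) ∧
    (∀ A : Set (S × ℝ), MeasurableSet A →
      ∃ Z : Ω → E n, TendstoInMeasure P (fun k => simpleIntegral Λ (g k) A) atTop Z) ∧
    TendstoInMeasure P (fun k => simpleIntegral Λ (g k) Set.univ) atTop Y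

/-! ### Causal mixed moving averages

A kernel `f` on `S × [0,∞)` is given as a function on `S × ℝ`; its values at negative times play no
role. -/

/-- The measure `π ⊗ λ` on `S × [0,∞)`. -/
def halfMeasure (π : Measure S) : Measure (S × ℝ) :=
  π.prod (volume.restrict (Set.Ici 0))

/-- The function `(A, s) ↦ f(A, t - s) 1_{s ≤ t}`. -/
def causalKernel {n d : ℕ} (f : S × ℝ → Matrix (Fin n) (Fin d) ℝ) (t : ℝ) :
    S × ℝ → Matrix (Fin n) (Fin d) ℝ :=
  fun p => if p.2 ≤ t then f (p.1, t - p.2) else 0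

/-- `∫∫ ‖f(A,s)γ + ∫ f(A,s)x (1_{[0,1]}(‖f(A,s)x‖) - 1_{[0,1]}(‖x‖)) ν(dx)‖ ds π(dA) < ∞`. -/
def DriftCond (π : Measure S) {n d : ℕ} (T : LevyTriplet d)
    (f : S × ℝ → Matrix (Fin n) (Fin d) ℝ) : Prop :=
  ∫⁻ p, ‖app (f p) T.gam + ∫ x, ((if ‖app (f p) x‖ ≤ 1 then (1 : ℝ) else 0)
      - (if ‖x‖ ≤ 1 then (1 : ℝ) else 0)) • app (f p) x ∂T.nu‖ₑ ∂(halfMeasure π) < ⊤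

/-- `∫∫ ‖f(A,s) Σ f(A,s)'‖ ds π(dA) < ∞`. -/
def GaussCond (π : Measure S) {n d : ℕ} (T : LevyTriplet d)
    (f : S × ℝ → Matrix (Fin n) (Fin d) ℝ) : Prop :=
  ∫⁻ p, ‖f p * T.sig * (f p)ᵀ‖ₑ ∂(halfMeasure π) < ⊤

/-- `∫∫∫ (1 ∧ ‖f(A,s)x‖²) ν(dx) ds π(dA) < ∞`. -/
def JumpCond (π : Measure S) {n d : ℕ} (T : LevyTriplet d)
    (f : S × ℝ → Matrix (Fin n) (Fin d) ℝ) : Prop :=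
  ∫⁻ p, ∫⁻ x, min 1 (‖app (f p) x‖ₑ ^ 2) ∂T.nu ∂(halfMeasure π) < ⊤

/-- `X` is the causal mixed moving average process
`X_t = ∫_S ∫_{-∞}^t f(A, t - s) Λ(dA, ds)` with kernel `f`, where `f` is measurable and satisfies
the integrability conditions. -/
structure IsCausalMMA (P : Measure Ω) (π : Measure S) {n d : ℕ} (T : LevyTriplet d)
    (Λ : Set (S × ℝ) → Ω → E d) (f : S × ℝ → Matrix (Fin n) (Fin d) ℝ)
    (X : ℝ → Ω → E n) : Prop where
  kernel_measurable : ∀ a b, Measurable fun p => f p a b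
  drift : DriftCond π T f
  gauss : GaussCond π T f
  jump : JumpCond π T f
  integral : ∀ t, IsLevyIntegral P π Λ (causalKernel f t) (X t)

/-! ### Weak dependence -/

/-- The supremum norm of a bounded function. -/
def supNorm {ι : Type*} (F : ι → ℝ) : ℝ := ⨆ x, |F x|

/-- `Lip(G) = sup_{x ≠ y} |G(x) - G(y)| / ∑ᵢ ‖xᵢ - yᵢ‖`. -/
def lipConst {n v : ℕ} (G : (Fin v → E n) → ℝ) : ℝ :=
  ⨆ q : {q : (Fin v → E n) × (Fin v → E n) // q.1 ≠ q.2},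
    |G q.1.1 - G q.1.2| / ∑ i, ‖q.1.1 i - q.1.2 i‖

/-- `X` is `θ`-weakly dependent with coefficients `θ(r)`, `r ≥ 0`. For nondecreasing tuples of times
`i` and `j`, the condition `∀ k l, i k + r ≤ j l` says that the last `i` plus `r` is at most the
first `j`. -/
def IsThetaWeaklyDependent (P : Measure Ω) {n : ℕ} (X : ℝ → Ω → E n) (θ : ℝ → ℝ) : Prop :=
  Tendsto θ atTop (𝓝 0) ∧
  ∃ c : ℝ, ∀ (u v : ℕ), 0 < u → 0 < v → ∀ r : ℝ, 0 ≤ r →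
    ∀ (i : Fin u → ℝ) (j : Fin v → ℝ), Monotone i → Monotone j → (∀ k l, i k + r ≤ j l) →
    ∀ (F : (Fin u → E n) → ℝ) (G : (Fin v → E n) → ℝ),
      Measurable F → (∀ x, |F x| ≤ 1) →
      (∀ y, |G y| ≤ 1) → (∃ K : ℝ, ∀ y z, |G y - G z| ≤ K * ∑ k, ‖y k - z k‖) →
      |cov[fun ω => F (fun k => X (i k) ω), fun ω => G (fun k => X (j k) ω); P]|
        ≤ c * (v * lipConst G * supNorm F) * θ r

end Basis

/-! ### The θ-coefficients of causal mixed moving averages -/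

section Coefficients

variable {S : Type*} [MeasurableSpace S] (π : Measure S) {n d : ℕ} (T : LevyTriplet d)
  (f : S × ℝ → Matrix (Fin n) (Fin d) ℝ)

/-- `∫_S ∫_{-∞}^{-r} tr(f(A,-s) Σ_L f(A,-s)') ds π(dA)`. -/
def tailVar (r : ℝ) : ℝ :=
  ∫ A, (∫ s in Set.Iic (-r), (f (A, -s) * T.sigL * (f (A, -s))ᵀ).trace) ∂π

/-- `∫_S ∫_{-∞}^{-r} f(A,-s) μ ds π(dA)`. -/
def tailMean (r : ℝ) : E n :=
  ∫ A, (∫ s in Set.Iic (-r), app (f (A, -s)) T.mean) ∂π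

/-- `∫_S ∫_{-∞}^{-r} ∫ ‖f(A,-s)x‖ ν(dx) ds π(dA) + ∫_S ∫_{-∞}^{-r} ‖f(A,-s)γ₀‖ ds π(dA)`. -/
def tailAbs (r : ℝ) : ℝ :=
  (∫ A, (∫ s in Set.Iic (-r), (∫ x, ‖app (f (A, -s)) x‖ ∂T.nu)) ∂π)
    + ∫ A, (∫ s in Set.Iic (-r), ‖app (f (A, -s)) T.gam0‖) ∂π

end Coefficients

/-! ### The supOU process -/

/-- The kernel `f(A,s) = exp(As) 1_{[0,∞)}(s)` of the supOU process, `A < 0`. -/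
def supOUKernel : Set.Iio (0 : ℝ) × ℝ → Matrix (Fin 1) (Fin 1) ℝ :=
  fun p => Matrix.of fun _ _ => if 0 ≤ p.2 then Real.exp ((p.1 : ℝ) * p.2) else 0

end MMA

end

/-! Weak dependence follows from truncation. Split `X t = N + Z`, where `N` integrates the kernel
over times in `(t - r, t]` and `Z` over times up to `t - r`. If all past times are at most `t - r`,
then `N` is independent of the past, so replacing each future value by its `N` makes the covariance
vanish. The error is controlled by `|Cov(U, V)| ≤ 2 ‖U‖_∞ E|V|` with `V = G(X) - G(N)`, hence by `2
‖F‖_∞ Lip(G) ∑ E‖Z‖`. So everything reduces to `E‖Z‖ ≤ c θ(r)` for the tail integral `Z`; this is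
`isThetaWeaklyDependent_of_tail`. The shift and reflection `s ↦ t - s` makes the bound independent
of `t`, and `θ(r) → 0` is dominated convergence.

In the square integrable cases `E‖Z‖ ≤ (E‖Z‖²)^(1/2)`, and `E‖Z‖²` is exactly the integral of the
trace plus the squared norm of the mean. For simple integrands the characteristic function is the
exponential of an integrated cumulant, so the first two moments come from expanding the cumulant at
zero (`moments_of_charFun`); they pass to general kernels by `L²` convergence. In the finite
variation case a second moment need not exist. There `|t|` is a constant times `∫ (1 - cos(ut)) / u²
du`, which turns a first absolute moment into an integral of `1 - Re` of the characteristic function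
and gives `E|Y| ≤ C ∫ |y| dν` (`lintegral_enorm_le_of_charFun`). The constant is absorbed by the `c`
allowed in the definition of weak dependence.

The integral is defined through the existence of some approximating sequence, so its value must be
shown not to depend on that sequence (`IsLevyIntegral.ae_unique`). The difference of two sequences
tends to zero almost everywhere and its integrals over every Borel set converge in probability. A
gliding hump argument on the cumulants (`tendsto_exp_integral_one`) shows that the characteristic
function of the limit is one. Uniqueness lets the moment formulas, proved for one convenient `Lᵖ`
approximation (`exists_isLevyIntegral`), apply to every MMA process, and it makes `X = N + Z` an
identity almost surely.

Independence of integrals over disjoint regions comes from the additivity of `∫ Φ(φ)` over disjoint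
supports, since `Φ(0) = 0`. For supOU processes all quantities are explicit exponentials: tail
variance and covariance are the same integral with different parameters, which gives the identities
in terms of covariances. -/

namespace MMA

/-! ### A gliding hump argument -/

section GlidingHump

variable {α : Type*} [MeasurableSpace α] {m : Measure α}

/-- A sequence of integrable functions that tends to zero almost everywhere is, along a subsequence,
concentrated on disjoint sets up to small errors. -/
theorem exists_concentrated_subsequence [SigmaFinite m] {β : ℕ → α → ℂ}
    (hmeas : ∀ k, Measurable (β k)) (hintg : ∀ k, Integrable (β k) m)
    (h0 : ∀ᵐ p ∂m, Tendsto (fun k => β k p) atTop (𝓝 0)) :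
    ∃ (κ : ℕ → ℕ) (A : ℕ → Set α), StrictMono κ ∧ (∀ j, MeasurableSet (A j)) ∧
      Pairwise (Function.onFun Disjoint A) ∧
      Tendsto (fun j => ∫ p in (A j)ᶜ, ‖β (κ j) p‖ ∂m) atTop (𝓝 0) := by
  obtain ⟨w, hwpos, hwm, hwint⟩ := exists_pos_lintegral_lt_of_sigmaFinite m (ε := 1) one_ne_zero
  -- The weight `w` is strictly positive and integrable. As `β k` tends to zero, almost every point
  -- lies in `C N` for large `N`, and on each `C N` all late `β k` are dominated by `w`. Hence late
  -- functions carry little mass inside `C N`, while a fixed function carries little mass outside `C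
  -- N` for large `N`.
  let C : ℕ → Set α := fun N => {p | ∀ k, N ≤ k → ‖β k p‖ ≤ w p}
  have hCm : ∀ N, MeasurableSet (C N) := fun N => by
    have : C N = ⋂ k, ⋂ (_ : N ≤ k), {p | ‖β k p‖ ≤ w p} := by ext p; simp [C]
    rw [this]
    exact MeasurableSet.iInter fun k => MeasurableSet.iInter fun _ =>
      measurableSet_le (hmeas k).norm hwm.coe_nnreal_real
  have hCmono : Monotone C := fun N M hNM p hp k hk => hp k (hNM.trans hk)
  have hwi : Integrable (fun p => (w p : ℝ)) m := by
    refine ⟨hwm.coe_nnreal_real.aestronglyMeasurable, ?_⟩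
    simp only [HasFiniteIntegral]
    refine lt_of_le_of_lt (le_of_eq ?_) (hwint.trans ENNReal.one_lt_top)
    congr with p
    simp
  have h1 : ∀ N, Tendsto (fun k => ∫ p in C N, ‖β k p‖ ∂m) atTop (𝓝 0) := fun N => by
    have := tendsto_integral_filter_of_dominated_convergence (μ := m.restrict (C N)) (l := atTop)
      (F := fun k p => ‖β k p‖) (f := fun _ => (0 : ℝ)) (fun p => (w p : ℝ))
      (Eventually.of_forall fun k => (hmeas k).norm.aestronglyMeasurable)
      (by
        filter_upwards [eventually_ge_atTop N] with k hk
        filter_upwards [ae_restrict_mem (hCm N)] with p hp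
        simpa using hp k hk)
      hwi.restrict
      (by
        filter_upwards [ae_restrict_of_ae h0] with p hp
        simpa using hp.norm)
    simpa using this
  have h2 : ∀ k, Tendsto (fun N => ∫ p in (C N)ᶜ, ‖β k p‖ ∂m) atTop (𝓝 0) := fun k => by
    simp_rw [← integral_indicator (hCm _).compl]
    have := tendsto_integral_of_dominated_convergence (μ := m)
      (F := fun N => (C N)ᶜ.indicator fun p => ‖β k p‖) (f := fun _ => (0 : ℝ))
      (fun p => ‖β k p‖)
      (fun N => ((hmeas k).norm.indicator (hCm N).compl).aestronglyMeasurable)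
      (hintg k).norm
      (fun N => Eventually.of_forall fun p => by
        simpa using norm_indicator_le_norm_self (fun p => ‖β k p‖) p)
      (by
        filter_upwards [h0] with p hp
        have hw : (0 : ℝ) < w p := by exact_mod_cast hwpos p
        have h3 : ∀ᶠ k in atTop, ‖β k p‖ < w p := by
          have := hp.norm
          rw [norm_zero] at this
          exact this.eventually_lt_const hw
        obtain ⟨N, hN⟩ := eventually_atTop.1 h3
        refine tendsto_const_nhds.congr' ?_
        filter_upwards [eventually_ge_atTop N] with M hM
        rw [Set.indicator_of_notMem]
        simp only [Set.mem_compl_iff, not_not]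
        exact fun k hk => (hN k (hM.trans hk)).le)
    simpa using this
  -- One turn of the construction: first take `k` so late that `β k` is small on `C N`, then `N'` so
  -- large that `β k` is small off `C N'`. The hump of `β k` then lies in `C N' \ C N`, and
  -- successive differences are disjoint.
  have step : ∀ j N : ℕ, ∃ k N' : ℕ, N < k ∧ k < N' ∧
      ∫ p in C N, ‖β k p‖ ∂m < 1 / ((j : ℝ) + 1) ∧
      ∫ p in (C N')ᶜ, ‖β k p‖ ∂m < 1 / ((j : ℝ) + 1) := fun j N => by
    have hj : (0 : ℝ) < 1 / ((j : ℝ) + 1) := by positivity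
    obtain ⟨k, hk1, hk2⟩ := (((h1 N).eventually_lt_const hj).and (eventually_gt_atTop N)).exists
    obtain ⟨N', hN1, hN2⟩ := (((h2 k).eventually_lt_const hj).and (eventually_gt_atTop k)).exists
    exact ⟨k, N', hk2, hN2, hk1, hN1⟩
  choose kf Nf hs1 hs2 hs3 hs4 using step
  let Ns : ℕ → ℕ := fun j => Nat.rec 0 (fun j N => Nf j N) j
  have hNs : ∀ j, Ns (j + 1) = Nf j (Ns j) := fun j => rfl
  have hNmono : StrictMono Ns := strictMono_nat_of_lt_succ fun j => (hs1 j _).trans (hs2 j _)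
  refine ⟨fun j => kf j (Ns j), fun j => C (Ns (j + 1)) \ C (Ns j), ?_, ?_, ?_, ?_⟩
  · exact strictMono_nat_of_lt_succ fun j => (hs2 j _).trans (hs1 (j + 1) _)
  · exact fun j => (hCm _).diff (hCm _)
  · have key : ∀ i j, i < j → Disjoint (C (Ns (i + 1)) \ C (Ns i)) (C (Ns (j + 1)) \ C (Ns j)) := by
      intro i j hij
      refine Set.disjoint_left.2 fun p hp hq =>
        hq.2 (hCmono (hNmono.monotone (show i + 1 ≤ j by omega)) hp.1)
    intro i j hij
    rcases lt_or_gt_of_ne hij with h | h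
    · exact key i j h
    · exact (key j i h).symm
  · have hlim : Tendsto (fun j : ℕ => 1 / ((j : ℝ) + 1) + 1 / ((j : ℝ) + 1)) atTop (𝓝 0) := by
      simpa using (tendsto_one_div_add_atTop_nhds_zero_nat (𝕜 := ℝ)).add
        (tendsto_one_div_add_atTop_nhds_zero_nat (𝕜 := ℝ))
    refine squeeze_zero (fun j => integral_nonneg fun _ => norm_nonneg _) (fun j => ?_) hlim
    have hsub : (C (Ns (j + 1)) \ C (Ns j))ᶜ ⊆ C (Ns j) ∪ (C (Ns (j + 1)))ᶜ := by
      intro p hp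
      simp only [Set.mem_compl_iff, Set.mem_sdiff, not_and, not_not, Set.mem_union] at hp ⊢
      tauto
    calc _ ≤ ∫ p in C (Ns j) ∪ (C (Ns (j + 1)))ᶜ, ‖β (kf j (Ns j)) p‖ ∂m :=
          setIntegral_mono_set (hintg _).norm.integrableOn
            (Eventually.of_forall fun _ => norm_nonneg _) hsub.eventuallyLE
      _ = ∫ p in C (Ns j), ‖β (kf j (Ns j)) p‖ ∂m
          + ∫ p in (C (Ns (j + 1)))ᶜ, ‖β (kf j (Ns j)) p‖ ∂m := by
          refine setIntegral_union ?_ (hCm _).compl (hintg _).norm.integrableOn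
            (hintg _).norm.integrableOn
          exact Set.disjoint_compl_right_iff_subset.2 (hCmono (hNmono.monotone (Nat.le_succ j)))
      _ ≤ _ := add_le_add (hs3 j _).le (hs4 j _).le

/-- If integrable functions tend to zero almost everywhere and the exponentials of their integrals
over every measurable set converge, then the exponentials of the integrals tend to one. -/
theorem tendsto_exp_integral_one [SigmaFinite m] {β : ℕ → α → ℂ}
    (hmeas : ∀ k, Measurable (β k)) (hintg : ∀ k, Integrable (β k) m)
    (h0 : ∀ᵐ p ∂m, Tendsto (fun k => β k p) atTop (𝓝 0))
    (hA : ∀ A, MeasurableSet A →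
      ∃ L, Tendsto (fun k => Complex.exp (∫ p in A, β k p ∂m)) atTop (𝓝 L)) :
    Tendsto (fun k => Complex.exp (∫ p, β k p ∂m)) atTop (𝓝 1) := by
  obtain ⟨κ, A, hκ, hAm, hAd, hlim⟩ := exists_concentrated_subsequence hmeas hintg h0
  have hsmall : ∀ (D : ℕ → Set α) (σ : ℕ → ℕ), Tendsto σ atTop atTop →
      (∀ j, D j ⊆ (A (σ j))ᶜ) →
      Tendsto (fun j => ∫ p in D j, β (κ (σ j)) p ∂m) atTop (𝓝 0) := by
    intro D σ hσ hD
    refine squeeze_zero_norm (fun j => ?_) (hlim.comp hσ)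
    refine (norm_integral_le_integral_norm _).trans ?_
    exact setIntegral_mono_set (hintg _).norm.integrableOn
            (Eventually.of_forall fun _ => norm_nonneg _) (hD j).eventuallyLE
  -- The union of the even humps. Odd-indexed functions have negligible integral over `B`, so the
  -- limit of the exponentials over `B`, which exists by hypothesis, must be `1`. Even-indexed
  -- functions have negligible integral over `Bᶜ`, so along them the exponential of the total
  -- integral has the same limit.
  let B : Set α := ⋃ j, A (2 * j)
  have hBm : MeasurableSet B := MeasurableSet.iUnion fun j => hAm _
  have hev : Tendsto (fun j : ℕ => 2 * j) atTop atTop :=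
    tendsto_atTop_mono (fun j => by simp only [id]; omega) tendsto_id
  have hod : Tendsto (fun j : ℕ => 2 * j + 1) atTop atTop :=
    tendsto_atTop_mono (fun j => by simp only [id]; omega) tendsto_id
  have hB1 := hsmall (fun _ => B) (fun j => 2 * j + 1) hod fun j => by
    rw [Set.subset_compl_iff_disjoint_right]
    exact Set.disjoint_iUnion_left.2 fun i => hAd (by omega)
  have hB2 := hsmall (fun _ => Bᶜ) (fun j => 2 * j) hev fun j =>
    Set.compl_subset_compl.2 (Set.subset_iUnion (fun j => A (2 * j)) j)
  obtain ⟨L, hL⟩ := hA B hBm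
  have hL1 : L = 1 := by
    have h := (Complex.continuous_exp.tendsto _).comp hB1
    rw [Complex.exp_zero] at h
    exact tendsto_nhds_unique (hL.comp (hκ.tendsto_atTop.comp hod)) h
  subst hL1
  -- The full sequence converges by hypothesis, so its limit may be found along the even
  -- subsequence.
  obtain ⟨K, hK⟩ := hA Set.univ MeasurableSet.univ
  simp only [setIntegral_univ] at hK
  have h3 : Tendsto (fun j => Complex.exp (∫ p, β (κ (2 * j)) p ∂m)) atTop (𝓝 (1 * 1)) := by
    have h := (Complex.continuous_exp.tendsto _).comp hB2
    rw [Complex.exp_zero] at h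
    refine ((hL.comp (hκ.tendsto_atTop.comp hev)).mul h).congr fun j => ?_
    simp only [Function.comp]
    rw [← Complex.exp_add, integral_add_compl hBm (hintg _)]
  have hK1 := tendsto_nhds_unique (hK.comp (hκ.tendsto_atTop.comp hev)) h3
  rwa [hK1, one_mul] at hK

end GlidingHump

/-! ### Moments of a real random variable from its characteristic function -/

section Moments

/-- Write `g(x) / s` as the slope of `g` between `0` and `x` times `x / s`. With `dslope` the slope
is continuous at `0`, so indices with `x i = 0` need no separate treatment. -/
theorem tendsto_comp_div_of_hasDerivAt {ι : Type*} {l : Filter ι} {g : ℝ → ℝ} {g' a : ℝ}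
    (hg : HasDerivAt g g' 0) (h0 : g 0 = 0) {x s : ι → ℝ} (hx : Tendsto x l (𝓝 0))
    (hxs : Tendsto (fun i => x i / s i) l (𝓝 a)) :
    Tendsto (fun i => g (x i) / s i) l (𝓝 (g' * a)) := by
  have hc : ContinuousAt (dslope g 0) 0 := continuousAt_dslope_same.2 hg.differentiableAt
  have h1 : Tendsto (fun i => dslope g 0 (x i)) l (𝓝 g') := by
    have := hc.tendsto.comp hx
    rwa [dslope_same, hg.deriv] at this
  refine (h1.mul hxs).congr fun i => ?_
  have := sub_smul_dslope g 0 (x i)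
  rw [h0, sub_zero, sub_zero, smul_eq_mul] at this
  rw [← this]
  ring

variable {Ω : Type*} [MeasurableSpace Ω] {P : Measure Ω} [IsProbabilityMeasure P]

theorem integrable_exp_ofReal_mul_I {Y : Ω → ℝ} (hY : AEMeasurable Y P) :
    Integrable (fun ω => Complex.exp ((Y ω : ℂ) * Complex.I)) P := by
  refine Integrable.of_bound (C := 1) ?_ (Eventually.of_forall fun ω => ?_)
  · exact (Complex.measurable_exp.comp_aemeasurable
      ((Complex.measurable_ofReal.comp_aemeasurable hY).mul_const _)).aestronglyMeasurable
  · rw [Complex.norm_exp_ofReal_mul_I]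

theorem integral_cos_eq {Y : Ω → ℝ} (hY : AEMeasurable Y P) :
    ∫ ω, Real.cos (Y ω) ∂P = (∫ ω, Complex.exp ((Y ω : ℂ) * Complex.I) ∂P).re := by
  rw [← RCLike.re_eq_complex_re, ← integral_re (integrable_exp_ofReal_mul_I hY)]
  simp [Complex.exp_ofReal_mul_I_re]

theorem integral_sin_eq {Y : Ω → ℝ} (hY : AEMeasurable Y P) :
    ∫ ω, Real.sin (Y ω) ∂P = (∫ ω, Complex.exp ((Y ω : ℂ) * Complex.I) ∂P).im := by
  rw [← RCLike.im_eq_complex_im, ← integral_im (integrable_exp_ofReal_mul_I hY)]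
  simp [Complex.exp_ofReal_mul_I_im]

theorem tendsto_inv_succ : Tendsto (fun k : ℕ => 1 / ((k : ℝ) + 1)) atTop (𝓝[≠] 0) := by
  refine tendsto_nhdsWithin_iff.2 ⟨tendsto_one_div_add_atTop_nhds_zero_nat, ?_⟩
  exact Eventually.of_forall fun k => by
    have : (0 : ℝ) < 1 / ((k : ℝ) + 1) := by positivity
    exact this.ne'

theorem tendsto_zero_of_tendsto_div {x : ℝ → ℝ} {a : ℝ}
    (h : Tendsto (fun h => x h / h) (𝓝[≠] 0) (𝓝 a)) : Tendsto x (𝓝[≠] 0) (𝓝 0) := by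
  have h1 : Tendsto (fun h : ℝ => h) (𝓝[≠] 0) (𝓝 0) := tendsto_id.mono_left nhdsWithin_le_nhds
  have h2 := h.mul h1
  rw [mul_zero] at h2
  refine h2.congr' ?_
  filter_upwards [self_mem_nhdsWithin] with t ht
  exact div_mul_cancel₀ _ ht

/-- The second difference quotient of the cosine. -/
theorem tendsto_two_sub_cos_div_sq (x : ℝ → ℝ) (a : ℝ)
    (hx : Tendsto (fun h => x h / h) (𝓝[≠] 0) (𝓝 a)) :
    Tendsto (fun h => (2 - 2 * Real.cos (x h)) / h ^ 2) (𝓝[≠] 0) (𝓝 (a ^ 2)) := by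
  -- Half-angle formula: `2 - 2 cos x = 4 sin²(x / 2)`.
  have h1 : Tendsto (fun h => x h / 2 / h) (𝓝[≠] 0) (𝓝 (a / 2)) :=
    (hx.div_const 2).congr fun h => by ring
  have h2 := tendsto_comp_div_of_hasDerivAt (Real.hasDerivAt_sin 0) Real.sin_zero
    (tendsto_zero_of_tendsto_div h1) h1
  have h3 := (h2.pow 2).const_mul 4
  have h4 : 4 * (Real.cos 0 * (a / 2)) ^ 2 = a ^ 2 := by rw [Real.cos_zero]; ring
  rw [h4] at h3
  refine h3.congr fun h => ?_
  rw [div_pow, Real.sin_sq_eq_half_sub, show 2 * (x h / 2) = x h by ring]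
  ring

theorem tendsto_mul_div_self (y : ℝ) : Tendsto (fun h : ℝ => h * y / h) (𝓝[≠] 0) (𝓝 y) := by
  refine tendsto_const_nhds.congr' ?_
  filter_upwards [self_mem_nhdsWithin] with h hh
  exact (mul_div_cancel_left₀ _ hh).symm

theorem tendsto_sin_mul_div (y : ℝ) :
    Tendsto (fun h : ℝ => Real.sin (h * y) / h) (𝓝[≠] 0) (𝓝 y) := by
  have h4 := tendsto_comp_div_of_hasDerivAt (Real.hasDerivAt_sin 0) Real.sin_zero
    (tendsto_zero_of_tendsto_div (tendsto_mul_div_self y)) (tendsto_mul_div_self y)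
  simpa using h4

/-- The mean of an integrable random variable from the logarithm of its characteristic function. -/
theorem integral_eq_of_charFun {Y : Ω → ℝ} (hY : Integrable Y P) {z : ℝ → ℂ} {b : ℝ}
    (hz : ∀ h : ℝ, ∫ ω, Complex.exp (((h * Y ω : ℝ) : ℂ) * Complex.I) ∂P = Complex.exp (z h))
    (hre : Tendsto (fun h => (z h).re) (𝓝[≠] 0) (𝓝 0))
    (him : Tendsto (fun h => (z h).im / h) (𝓝[≠] 0) (𝓝 b)) : ∫ ω, Y ω ∂P = b := by
  have him0 : Tendsto (fun h => (z h).im) (𝓝[≠] 0) (𝓝 0) := tendsto_zero_of_tendsto_div him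
  -- The imaginary part of `exp z` is `exp(Re z) sin(Im z)`. Its quotient by `h` tends to `b`, while
  -- on the probability side `sin(hY) / h` tends to `Y` under the bound `|Y|`.
  have h1 : Tendsto (fun h => Real.exp (z h).re * (Real.sin (z h).im / h)) (𝓝[≠] 0) (𝓝 b) := by
    have := ((Real.continuous_exp.tendsto 0).comp hre).mul
      (tendsto_comp_div_of_hasDerivAt (Real.hasDerivAt_sin 0) Real.sin_zero him0 him)
    simpa using this
  have h2 : Tendsto (fun h => ∫ ω, Real.sin (h * Y ω) / h ∂P) (𝓝[≠] 0) (𝓝 (∫ ω, Y ω ∂P)) := by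
    refine tendsto_integral_filter_of_dominated_convergence (fun ω => |Y ω|) ?_ ?_ hY.abs ?_
    · exact Eventually.of_forall fun h => ((Real.measurable_sin.comp_aemeasurable
        (hY.aemeasurable.const_mul h)).div_const h).aestronglyMeasurable
    · filter_upwards [self_mem_nhdsWithin] with h hh
      refine Eventually.of_forall fun ω => ?_
      have hh' : 0 < |h| := abs_pos.2 hh
      rw [Real.norm_eq_abs, abs_div, div_le_iff₀ hh', mul_comm, ← abs_mul]
      exact Real.abs_sin_le_abs
    · exact Eventually.of_forall fun ω => tendsto_sin_mul_div _
  refine tendsto_nhds_unique h2 (h1.congr fun h => ?_)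
  rw [integral_div, integral_sin_eq (hY.aemeasurable.const_mul h), hz, Complex.exp_im, mul_div_assoc]

/-- The first two moments of a random variable from the logarithm of its characteristic function. -/
theorem moments_of_charFun {Y : Ω → ℝ} (hY : AEMeasurable Y P) {z : ℝ → ℂ} {b c : ℝ}
    (hz : ∀ h : ℝ, ∫ ω, Complex.exp (((h * Y ω : ℝ) : ℂ) * Complex.I) ∂P = Complex.exp (z h))
    (hre : Tendsto (fun h => (z h).re / h ^ 2) (𝓝[≠] 0) (𝓝 (-c / 2)))
    (him : Tendsto (fun h => (z h).im / h) (𝓝[≠] 0) (𝓝 b)) :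
    MemLp Y 2 P ∧ ∫ ω, Y ω ∂P = b ∧ ∫ ω, Y ω ^ 2 ∂P = c + b ^ 2 := by
  have him0 : Tendsto (fun h => (z h).im) (𝓝[≠] 0) (𝓝 0) := tendsto_zero_of_tendsto_div him
  have hre0 : Tendsto (fun h => (z h).re) (𝓝[≠] 0) (𝓝 0) := by
    have h1 : Tendsto (fun h : ℝ => h) (𝓝[≠] 0) (𝓝 0) := tendsto_id.mono_left nhdsWithin_le_nhds
    have h2 : Tendsto (fun h => (z h).re / h) (𝓝[≠] 0) (𝓝 (-c / 2 * 0)) := by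
      refine (hre.mul h1).congr' ?_
      filter_upwards [self_mem_nhdsWithin] with t ht
      have : t ≠ 0 := ht
      field_simp
    exact tendsto_zero_of_tendsto_div h2
  -- Split `2 - 2 Re(exp z) = (2 - 2 exp(Re z)) + exp(Re z) (2 - 2 cos(Im z))`. After division by
  -- `h²` the first summand tends to `c` and the second to `b²`.
  have hlim : Tendsto (fun h => (2 - 2 * (Complex.exp (z h)).re) / h ^ 2) (𝓝[≠] 0)
      (𝓝 (c + b ^ 2)) := by
    have hg : HasDerivAt (fun x : ℝ => 2 - 2 * Real.exp x) (-2) 0 := by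
      simpa using ((Real.hasDerivAt_exp 0).const_mul 2).const_sub 2
    have h1 := tendsto_comp_div_of_hasDerivAt hg (by simp) hre0 hre
    have h2 := ((Real.continuous_exp.tendsto 0).comp hre0).mul (tendsto_two_sub_cos_div_sq (fun h => (z h).im) b him)
    have h3 := h1.add h2
    have h4 : -2 * (-c / 2) + Real.exp 0 * b ^ 2 = c + b ^ 2 := by rw [Real.exp_zero]; ring
    rw [h4] at h3
    refine h3.congr fun h => ?_
    simp only [Function.comp, Complex.exp_re]
    ring
  have hpt : ∀ ω, Tendsto (fun h => (2 - 2 * Real.cos (h * Y ω)) / h ^ 2) (𝓝[≠] 0)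
      (𝓝 (Y ω ^ 2)) := fun ω =>
    tendsto_two_sub_cos_div_sq _ _ (tendsto_mul_div_self _)
  have hcosint : ∀ h : ℝ, Integrable (fun ω => Real.cos (h * Y ω)) P := fun h =>
    Integrable.of_bound (C := 1)
      (Real.measurable_cos.comp_aemeasurable (hY.const_mul h)).aestronglyMeasurable
      (Eventually.of_forall fun ω => Real.abs_cos_le_one _)
  have hintg : ∀ h : ℝ, Integrable (fun ω => (2 - 2 * Real.cos (h * Y ω)) / h ^ 2) P := fun h =>
    ((integrable_const 2).sub ((hcosint h).const_mul 2)).div_const _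
  have hval : ∀ h : ℝ, ∫ ω, (2 - 2 * Real.cos (h * Y ω)) / h ^ 2 ∂P
      = (2 - 2 * (Complex.exp (z h)).re) / h ^ 2 := fun h => by
    rw [integral_div, integral_sub (integrable_const 2) ((hcosint h).const_mul 2),
      integral_const_mul, integral_cos_eq (hY.const_mul h), hz]
    simp
  have hnn : ∀ h ω, 0 ≤ (2 - 2 * Real.cos (h * Y ω)) / h ^ 2 := fun h ω =>
    div_nonneg (by linarith [Real.cos_le_one (h * Y ω)]) (sq_nonneg h)
  -- Fatou along `h = 1 / (k + 1)`: the nonnegative quotients converge pointwise to `Y²` and their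
  -- expectations converge, so `E Y²` is finite.
  have hmem : MemLp Y 2 P := by
    rw [memLp_two_iff_integrable_sq hY.aestronglyMeasurable]
    refine ⟨(hY.pow_const 2).aestronglyMeasurable, ?_⟩
    rw [hasFiniteIntegral_iff_ofReal (Eventually.of_forall fun ω => sq_nonneg _)]
    have h1 : ∀ ω, ENNReal.ofReal (Y ω ^ 2) = liminf (fun k : ℕ => ENNReal.ofReal
        ((2 - 2 * Real.cos (1 / ((k : ℝ) + 1) * Y ω)) / (1 / ((k : ℝ) + 1)) ^ 2)) atTop :=
      fun ω => ((ENNReal.tendsto_ofReal ((hpt ω).comp tendsto_inv_succ)).liminf_eq).symm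
    simp_rw [h1]
    refine (lintegral_liminf_le' fun k => (hintg _).aemeasurable.ennreal_ofReal).trans_lt ?_
    have h2 : ∀ k : ℕ, ∫⁻ ω, ENNReal.ofReal
        ((2 - 2 * Real.cos (1 / ((k : ℝ) + 1) * Y ω)) / (1 / ((k : ℝ) + 1)) ^ 2) ∂P
        = ENNReal.ofReal ((2 - 2 * (Complex.exp (z (1 / ((k : ℝ) + 1)))).re)
          / (1 / ((k : ℝ) + 1)) ^ 2) := fun k => by
      rw [← hval, ofReal_integral_eq_lintegral_ofReal (hintg _) (Eventually.of_forall (hnn _))]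
    simp_rw [h2]
    exact lt_of_eq_of_lt (ENNReal.tendsto_ofReal (hlim.comp tendsto_inv_succ)).liminf_eq
      ENNReal.ofReal_lt_top
  refine ⟨hmem, integral_eq_of_charFun (hmem.integrable one_le_two) hz hre0 him, ?_⟩
  -- Once `Y²` is known to be integrable it dominates the quotients, because `2 - 2 cos y ≤ y²`, and
  -- the inequality from Fatou becomes an equality.
  have hdom : Tendsto (fun h => ∫ ω, (2 - 2 * Real.cos (h * Y ω)) / h ^ 2 ∂P) (𝓝[≠] 0)
      (𝓝 (∫ ω, Y ω ^ 2 ∂P)) := by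
    refine tendsto_integral_filter_of_dominated_convergence (fun ω => Y ω ^ 2)
      (Eventually.of_forall fun h => (hintg h).aestronglyMeasurable) ?_ hmem.integrable_sq
      (Eventually.of_forall hpt)
    filter_upwards [self_mem_nhdsWithin] with h hh
    refine Eventually.of_forall fun ω => ?_
    have hh' : 0 < h ^ 2 := by have : h ≠ 0 := hh; positivity
    rw [Real.norm_of_nonneg (hnn h ω), div_le_iff₀ hh']
    have := Real.one_sub_sq_div_two_le_cos (x := h * Y ω)
    nlinarith
  exact tendsto_nhds_unique hdom (hlim.congr fun h => (hval h).symm)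

end Moments

/-! ### A bound for the first absolute moment -/

section AbsMoment

/-- Substitute `v = t u`; the measure `du / u²` scales by `|t|`. With `φ = 1 - cos` this represents
`|t|` as an integral over frequencies. The condition `φ 0 = 0` covers `t = 0`. -/
theorem lintegral_div_sq_scale {φ : ℝ → ℝ} (hφ : Measurable φ) (h0 : φ 0 = 0) (t : ℝ) :
    ∫⁻ u, ENNReal.ofReal (φ (t * u) / u ^ 2)
      = ENNReal.ofReal |t| * ∫⁻ u, ENNReal.ofReal (φ u / u ^ 2) := by
  rcases eq_or_ne t 0 with rfl | ht
  · simp [h0]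
  have hg : Measurable fun u : ℝ => ENNReal.ofReal (φ u / u ^ 2) := by fun_prop
  conv_rhs => rw [← Real.smul_map_volume_mul_left ht]
  rw [lintegral_smul_measure, lintegral_map hg (measurable_const_mul t), smul_eq_mul, ← mul_assoc,
    ← ENNReal.ofReal_mul (abs_nonneg t), abs_mul_abs_self, ← lintegral_const_mul _ (by fun_prop)]
  congr with u
  rw [← ENNReal.ofReal_mul (mul_self_nonneg t)]
  congr 1
  rcases eq_or_ne u 0 with rfl | hu
  · simp
  · field_simp

/-- `∫ (1 - cos u) / u² du`. -/
noncomputable def cosConst : ℝ≥0∞ := ∫⁻ u : ℝ, ENNReal.ofReal ((1 - Real.cos u) / u ^ 2)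

/-- `∫ min(2, u²/2) / u² du`. -/
noncomputable def minConst : ℝ≥0∞ := ∫⁻ u : ℝ, ENNReal.ofReal (min 2 (u ^ 2 / 2) / u ^ 2)

theorem one_sub_cos_le_min (u : ℝ) : 1 - Real.cos u ≤ min 2 (u ^ 2 / 2) :=
  le_min (by linarith [Real.neg_one_le_cos u]) (by linarith [Real.one_sub_sq_div_two_le_cos (x := u)])

theorem minConst_ne_top : minConst ≠ ⊤ := by
  -- The branches of the minimum meet at `u² = 4`, where the integrand is `1 / 2`; `5 / 2` is the
  -- constant for which `(5 / 2) / (1 + u²)` takes this value there, and it then dominates on both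
  -- sides.
  have h : Integrable fun u : ℝ => 5 / 2 * (1 + u ^ 2)⁻¹ := integrable_inv_one_add_sq.const_mul _
  refine ne_top_of_le_ne_top h.lintegral_lt_top.ne (lintegral_mono fun u => ?_)
  refine ENNReal.ofReal_le_ofReal ?_
  rcases eq_or_ne u 0 with rfl | hu
  · norm_num
  have hu2 : 0 < u ^ 2 := by positivity
  rw [← div_eq_mul_inv, div_le_div_iff₀ hu2 (by positivity)]
  rcases le_total (u ^ 2) 4 with h4 | h4
  · have := min_le_right 2 (u ^ 2 / 2)
    nlinarith
  · have := min_le_left 2 (u ^ 2 / 2)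
    nlinarith

theorem cosConst_ne_top : cosConst ≠ ⊤ :=
  ne_top_of_le_ne_top minConst_ne_top (lintegral_mono fun u => ENNReal.ofReal_le_ofReal
    (div_le_div_of_nonneg_right (one_sub_cos_le_min u) (sq_nonneg u)))

theorem cosConst_ne_zero : cosConst ≠ 0 := by
  intro h
  rw [cosConst, lintegral_eq_zero_iff (by fun_prop)] at h
  have h1 : volume (Set.Ioo (0 : ℝ) 1) = 0 := by
    refine measure_mono_null (fun u hu => ?_) (ae_iff.1 h)
    have hc : Real.cos u < 1 := by
      have := Real.cos_lt_cos_of_nonneg_of_le_pi (x := 0) (y := u) le_rfl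
        (by linarith [hu.2, Real.pi_gt_three]) hu.1
      rwa [Real.cos_zero] at this
    have : 0 < (1 - Real.cos u) / u ^ 2 := div_pos (by linarith) (pow_pos hu.1 2)
    simpa using this
  simp at h1

variable {Ω : Type*} [MeasurableSpace Ω] {P : Measure Ω} [IsProbabilityMeasure P]
  {α : Type*} [MeasurableSpace α] {ν : Measure α}

/-- With `q = x + i y` and `x ≤ 0`, `1 - eˣ cos y = (1 - eˣ) + eˣ (1 - cos y) ≤ -x + (1 - cos y)`.
-/
theorem one_sub_re_exp_le {q : ℂ} {a : ℝ} (hq : q.re ≤ 0) (ha : |q.im| ≤ |a|) :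
    1 - (Complex.exp q).re ≤ -q.re + min 2 (a ^ 2 / 2) := by
  rw [Complex.exp_re]
  have h1 := Real.add_one_le_exp q.re
  have h2 : Real.exp q.re ≤ 1 := Real.exp_le_one_iff.2 hq
  have h3 := one_sub_cos_le_min q.im
  have h4 : min 2 (q.im ^ 2 / 2) ≤ min 2 (a ^ 2 / 2) :=
    min_le_min_left _ (div_le_div_of_nonneg_right (sq_le_sq.2 ha) zero_le_two)
  have h5 : Real.exp q.re * (1 - Real.cos q.im) ≤ 1 * (1 - Real.cos q.im) :=
    mul_le_mul_of_nonneg_right h2 (by linarith [Real.cos_le_one q.im])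
  nlinarith

theorem norm_exp_sub_one_le (x : ℝ) : ‖Complex.exp ((x : ℂ) * Complex.I) - 1‖ ≤ |x| := by
  rw [mul_comm]
  exact Real.norm_exp_I_mul_ofReal_sub_one_le

theorem integrable_exp_sub_one {y : α → ℝ} (hy : Integrable y ν) (u : ℝ) :
    Integrable (fun x => Complex.exp (((u * y x : ℝ) : ℂ) * Complex.I) - 1) ν := by
  refine (hy.const_mul u).mono ?_ (Eventually.of_forall fun x => ?_)
  · exact ((Complex.measurable_exp.comp_aemeasurable ((Complex.measurable_ofReal.comp_aemeasurable
      (hy.aemeasurable.const_mul u)).mul_const _)).sub_const _).aestronglyMeasurable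
  · exact norm_exp_sub_one_le _

/-- The law of `Y` is that of a pure jump variable without drift and with jump intensity `ν`. By
Tonelli, `cosConst * E|Y|` is the integral of `(1 - Re exp q) / u²`, and `cosConst * ∫ |y| dν` is
the integral of `-Re q / u²`. The two integrands differ by at most the contribution of `Im q`, which
is at most linear in `u` and so costs a multiple of `minConst`. The measure `ν` may be infinite. -/
theorem lintegral_enorm_le_of_charFun [SFinite ν] {Y : Ω → ℝ} (hY : AEMeasurable Y P) {y : α → ℝ}
    (hy : Integrable y ν)
    (hz : ∀ u : ℝ, ∫ ω, Complex.exp (((u * Y ω : ℝ) : ℂ) * Complex.I) ∂P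
      = Complex.exp (∫ x, (Complex.exp (((u * y x : ℝ) : ℂ) * Complex.I) - 1) ∂ν)) :
    ∫⁻ ω, ‖Y ω‖ₑ ∂P ≤ (1 + minConst / cosConst) * ∫⁻ x, ‖y x‖ₑ ∂ν := by
  set q : ℝ → ℂ := fun u => ∫ x, (Complex.exp (((u * y x : ℝ) : ℂ) * Complex.I) - 1) ∂ν with hq
  set M : ℝ := ∫ x, |y x| ∂ν with hM
  have hM0 : 0 ≤ M := integral_nonneg fun _ => abs_nonneg _
  have hMe : ENNReal.ofReal M = ∫⁻ x, ‖y x‖ₑ ∂ν := by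
    rw [hM, ofReal_integral_eq_lintegral_ofReal hy.abs (Eventually.of_forall fun _ => abs_nonneg _)]
    simp only [Real.enorm_eq_ofReal_abs]
  have hqre : ∀ u, -(q u).re = ∫ x, (1 - Real.cos (u * y x)) ∂ν := fun u => by
    rw [← RCLike.re_eq_complex_re, ← integral_re (integrable_exp_sub_one hy u), ← integral_neg]
    congr with x
    rw [RCLike.re_eq_complex_re, Complex.sub_re, Complex.exp_ofReal_mul_I_re, Complex.one_re]
    ring
  have hcosi : ∀ u, Integrable (fun x => 1 - Real.cos (u * y x)) ν := fun u => by
    refine (integrable_exp_sub_one hy u).re.neg.congr (Eventually.of_forall fun x => ?_)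
    simp only [Pi.neg_apply]
    rw [RCLike.re_eq_complex_re, Complex.sub_re, Complex.exp_ofReal_mul_I_re, Complex.one_re]
    ring
  have hcos0 : ∀ t : ℝ, 0 ≤ 1 - Real.cos t := fun t => by linarith [Real.cos_le_one t]
  -- From `|exp(i u y) - 1| ≤ |u y|`, integrated over `ν`.
  have hqim : ∀ u, |(q u).im| ≤ |M * u| := fun u => by
    refine (Complex.abs_im_le_norm _).trans ((norm_integral_le_integral_norm _).trans ?_)
    rw [abs_mul, abs_of_nonneg hM0, mul_comm, hM, ← integral_const_mul]
    refine integral_mono (integrable_exp_sub_one hy u).norm (hy.abs.const_mul _) fun x => ?_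
    refine (norm_exp_sub_one_le _).trans ?_
    rw [abs_mul]
  have hcm : Measurable fun t : ℝ => 1 - Real.cos t := by fun_prop
  have hmm : Measurable fun t : ℝ => min 2 (t ^ 2 / 2) := by fun_prop
  have hscale : ∀ t : ℝ, ∫⁻ u, ENNReal.ofReal ((1 - Real.cos (u * t)) / u ^ 2)
      = cosConst * ‖t‖ₑ := fun t => by
    have := lintegral_div_sq_scale hcm (by simp) t
    simp only [mul_comm t] at this
    rw [this, mul_comm, Real.enorm_eq_ofReal_abs, cosConst]
  have hnu : ∫⁻ u, ENNReal.ofReal (-(q u).re / u ^ 2) = cosConst * ∫⁻ x, ‖y x‖ₑ ∂ν := by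
    calc _ = ∫⁻ u : ℝ, ∫⁻ x, ENNReal.ofReal ((1 - Real.cos (u * y x)) / u ^ 2) ∂ν := by
          congr with u
          rw [hqre, ← integral_div, ofReal_integral_eq_lintegral_ofReal ((hcosi u).div_const _)
            (Eventually.of_forall fun x => div_nonneg (hcos0 _) (sq_nonneg u))]
      _ = ∫⁻ x, (∫⁻ u : ℝ, ENNReal.ofReal ((1 - Real.cos (u * y x)) / u ^ 2)) ∂ν := by
          refine lintegral_lintegral_swap ?_
          have h1 : AEMeasurable (fun p : ℝ × α => y p.2) ((volume : Measure ℝ).prod ν) :=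
            hy.aemeasurable.comp_snd
          exact ((hcm.comp_aemeasurable (measurable_fst.aemeasurable.mul h1)).div
            (measurable_fst.pow_const 2).aemeasurable).ennreal_ofReal
      _ = _ := by
          simp_rw [hscale]
          rw [lintegral_const_mul'' _ hy.aemeasurable.enorm]
  have hP : cosConst * ∫⁻ ω, ‖Y ω‖ₑ ∂P
      = ∫⁻ u, ENNReal.ofReal ((1 - (Complex.exp (q u)).re) / u ^ 2) := by
    calc _ = ∫⁻ ω, (∫⁻ u : ℝ, ENNReal.ofReal ((1 - Real.cos (u * Y ω)) / u ^ 2)) ∂P := by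
          simp_rw [hscale]
          rw [lintegral_const_mul'' _ hY.enorm]
      _ = ∫⁻ u : ℝ, ∫⁻ ω, ENNReal.ofReal ((1 - Real.cos (u * Y ω)) / u ^ 2) ∂P := by
          refine lintegral_lintegral_swap ?_
          have h1 : AEMeasurable (fun p : Ω × ℝ => Y p.1) (P.prod (volume : Measure ℝ)) :=
            hY.comp_fst
          exact ((hcm.comp_aemeasurable (measurable_snd.aemeasurable.mul h1)).div
            (measurable_snd.pow_const 2).aemeasurable).ennreal_ofReal
      _ = _ := by
          congr with u
          have hci : Integrable (fun ω => Real.cos (u * Y ω)) P := Integrable.of_bound (C := 1)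
            (Real.measurable_cos.comp_aemeasurable (hY.const_mul u)).aestronglyMeasurable
            (Eventually.of_forall fun ω => Real.abs_cos_le_one _)
          have hsi : Integrable (fun ω => 1 - Real.cos (u * Y ω)) P := (integrable_const 1).sub hci
          rw [← ofReal_integral_eq_lintegral_ofReal (hsi.div_const _)
            (Eventually.of_forall fun x => div_nonneg (hcos0 _) (sq_nonneg u)), integral_div]
          congr 2
          rw [integral_sub (integrable_const 1) hci, integral_cos_eq (hY.const_mul u), hz, ← congrFun hq u]
          simp
  have hmin : ∫⁻ u, ENNReal.ofReal (min 2 ((M * u) ^ 2 / 2) / u ^ 2)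
      = ENNReal.ofReal M * minConst := by
    have := lintegral_div_sq_scale hmm (by simp) M
    rwa [abs_of_nonneg hM0] at this
  -- Pointwise in the frequency, `one_sub_re_exp_le` with `a = M u`; integrating gives the jump term
  -- and the rescaled `minConst`.
  have hle : cosConst * ∫⁻ ω, ‖Y ω‖ₑ ∂P
      ≤ cosConst * ∫⁻ x, ‖y x‖ₑ ∂ν + ENNReal.ofReal M * minConst := by
    rw [hP, ← hnu, ← hmin, ← lintegral_add_right _ (by fun_prop)]
    refine lintegral_mono fun u => ?_
    have hre : (q u).re ≤ 0 := by
      have : 0 ≤ -(q u).re := by rw [hqre]; exact integral_nonneg fun x => hcos0 _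
      linarith
    rw [← ENNReal.ofReal_add (div_nonneg (by linarith) (sq_nonneg u))
      (div_nonneg (le_min zero_le_two (by positivity)) (sq_nonneg u)), ← add_div]
    exact ENNReal.ofReal_le_ofReal (div_le_div_of_nonneg_right
      (one_sub_re_exp_le hre (hqim u)) (sq_nonneg u))
  rw [hMe] at hle
  calc ∫⁻ ω, ‖Y ω‖ₑ ∂P = cosConst * (∫⁻ ω, ‖Y ω‖ₑ ∂P) / cosConst := by
        rw [mul_comm, ENNReal.mul_div_cancel_right cosConst_ne_zero cosConst_ne_top]
    _ ≤ (cosConst * ∫⁻ x, ‖y x‖ₑ ∂ν + (∫⁻ x, ‖y x‖ₑ ∂ν) * minConst) / cosConst :=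
        ENNReal.div_le_div_right hle _
    _ = _ := by
        rw [ENNReal.add_div, mul_comm cosConst, ENNReal.mul_div_cancel_right cosConst_ne_zero
          cosConst_ne_top, add_mul, one_mul, mul_div_assoc, mul_comm (minConst / cosConst)]

end AbsMoment

/-! ### The cumulant transform -/

theorem app_apply {n d : ℕ} (M : Matrix (Fin n) (Fin d) ℝ) (x : E d) (i : Fin n) :
    app M x i = ∑ j, M i j * x j := rfl

theorem inner_eq_sum {k : ℕ} (x y : E k) : inner ℝ x y = ∑ i, x i * y i := by
  rw [PiLp.inner_apply]
  exact Finset.sum_congr rfl fun i _ => by simp [mul_comm]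

theorem app_smul {n d : ℕ} (M : Matrix (Fin n) (Fin d) ℝ) (c : ℝ) (x : E d) :
    app M (c • x) = c • app M x := by
  ext i
  simp only [app_apply, PiLp.smul_apply, smul_eq_mul, Finset.mul_sum]
  exact Finset.sum_congr rfl fun j _ => by ring

theorem norm_app_le {n d : ℕ} (M : Matrix (Fin n) (Fin d) ℝ) (x : E d) :
    ‖app M x‖ ≤ ‖M‖ * ‖x‖ := Matrix.l2_opNorm_mulVec M x

namespace LevyTriplet

variable {d : ℕ} (T : LevyTriplet d)

/-- The measure with density `min(1, ‖x‖²)` with respect to `ν` is finite. The density vanishes only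
at the origin, which is a null set, so it can be inverted and `ν` is recovered as a measure with
density over a finite one. This makes Tonelli available. -/
instance : SFinite T.nu := by
  set f : E d → ℝ≥0∞ := fun x => min 1 (‖x‖ₑ ^ 2) with hf
  have hfm : Measurable f := by fun_prop
  have : IsFiniteMeasure (T.nu.withDensity f) := isFiniteMeasure_withDensity T.nu_levy.ne
  have h0 : ∀ᵐ x ∂T.nu, f x ≠ 0 := by
    have : ∀ᵐ x ∂T.nu, x ≠ 0 := by
      rw [ae_iff]
      simpa using T.nu_zero
    filter_upwards [this] with x hx
    simp [hf, hx]
  have h1 : ∀ᵐ x ∂T.nu, f x ≠ ⊤ := Eventually.of_forall fun x =>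
    ne_top_of_le_ne_top ENNReal.one_ne_top (min_le_left _ _)
  have h2 := withDensity_inv_same hfm h0 h1
  rw [← h2]
  infer_instance

theorem integrable_min : Integrable (fun x : E d => min 1 (‖x‖ ^ 2)) T.nu := by
  refine ⟨by fun_prop, ?_⟩
  rw [hasFiniteIntegral_iff_ofReal (Eventually.of_forall fun x => by positivity)]
  refine lt_of_le_of_lt (le_of_eq ?_) T.nu_levy
  congr with x
  rw [ENNReal.ofReal_min, ENNReal.ofReal_one, ENNReal.ofReal_pow (norm_nonneg x), ofReal_norm]

theorem integrableOn_sq (h2 : ∫⁻ x in {x : E d | 1 < ‖x‖}, ‖x‖ₑ ^ 2 ∂T.nu < ⊤) :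
    IntegrableOn (fun x : E d => ‖x‖ ^ 2) {x : E d | 1 < ‖x‖} T.nu := by
  refine ⟨by fun_prop, ?_⟩
  rw [hasFiniteIntegral_iff_ofReal (Eventually.of_forall fun x => by positivity)]
  refine lt_of_le_of_lt (le_of_eq ?_) h2
  congr with x
  rw [ENNReal.ofReal_pow (norm_nonneg x), ofReal_norm]

theorem measurableSet_large : MeasurableSet {x : E d | 1 < ‖x‖} :=
  measurableSet_lt measurable_const measurable_norm

theorem integrable_sq (h2 : ∫⁻ x in {x : E d | 1 < ‖x‖}, ‖x‖ₑ ^ 2 ∂T.nu < ⊤) :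
    Integrable (fun x : E d => ‖x‖ ^ 2) T.nu := by
  refine (T.integrable_min.add ((integrable_indicator_iff measurableSet_large).2
    (T.integrableOn_sq h2))).mono' (by fun_prop) (Eventually.of_forall fun x => ?_)
  rw [Real.norm_of_nonneg (sq_nonneg _), Pi.add_apply]
  by_cases hx : 1 < ‖x‖
  · rw [Set.indicator_of_mem (by exact hx)]
    have : 0 ≤ min 1 (‖x‖ ^ 2) := by positivity
    linarith
  · rw [Set.indicator_of_notMem (by exact hx), add_zero, min_eq_right]
    rw [not_lt] at hx
    exact pow_le_one₀ (norm_nonneg _) hx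

theorem integrableOn_norm_of_sq (h2 : ∫⁻ x in {x : E d | 1 < ‖x‖}, ‖x‖ₑ ^ 2 ∂T.nu < ⊤) :
    IntegrableOn (fun x : E d => x) {x : E d | 1 < ‖x‖} T.nu := by
  refine (T.integrableOn_sq h2).mono' (by fun_prop) ?_
  filter_upwards [ae_restrict_mem measurableSet_large] with x hx
  have : 1 < ‖x‖ := hx
  nlinarith

theorem integrable_id (h1 : ∫⁻ x, ‖x‖ₑ ∂T.nu < ⊤) : Integrable (fun x : E d => x) T.nu :=
  ⟨by fun_prop, h1⟩

theorem norm_exp_I_sub_one_sub_le (y : ℝ) :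
    ‖Complex.exp (Complex.I * (y : ℂ)) - 1 - Complex.I * (y : ℂ)‖ ≤ 3 * y ^ 2 := by
  have hn : ‖Complex.I * (y : ℂ)‖ = |y| := by simp
  rcases le_total |y| 1 with h | h
  · have := Complex.norm_exp_sub_one_sub_id_le (x := Complex.I * (y : ℂ)) (by rw [hn]; exact h)
    rw [hn, sq_abs] at this
    nlinarith [sq_nonneg y]
  · have h1 : ‖Complex.exp (Complex.I * (y : ℂ)) - 1‖ ≤ |y| := Real.norm_exp_I_mul_ofReal_sub_one_le
    have h2 := norm_sub_le (Complex.exp (Complex.I * (y : ℂ)) - 1) (Complex.I * (y : ℂ))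
    rw [hn] at h2
    nlinarith [sq_abs y]

/-- The integrand of the jump part of the cumulant transform. -/
noncomputable def jumpIntegrand (u x : E d) : ℂ :=
  Complex.exp (Complex.I * ((inner ℝ u x : ℝ) : ℂ)) - 1
        - Complex.I * ((inner ℝ u x : ℝ) : ℂ) * (if ‖x‖ ≤ 1 then 1 else 0)

theorem norm_jumpIntegrand_le (u x : E d) :
    ‖jumpIntegrand u x‖ ≤ (3 * ‖u‖ ^ 2 + 2) * min 1 (‖x‖ ^ 2) := by
  have hin := abs_real_inner_le_norm u x
  unfold jumpIntegrand
  split_ifs with hx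
  · rw [mul_one, min_eq_right (pow_le_one₀ (norm_nonneg _) hx)]
    refine (norm_exp_I_sub_one_sub_le _).trans ?_
    have : (inner ℝ u x : ℝ) ^ 2 ≤ (‖u‖ * ‖x‖) ^ 2 := by rw [← sq_abs]; gcongr
    nlinarith [sq_nonneg ‖x‖]
  · rw [mul_zero, sub_zero, min_eq_left (one_le_pow₀ (not_le.1 hx).le)]
    refine (norm_sub_le _ _).trans ?_
    rw [mul_comm, Complex.norm_exp_ofReal_mul_I, norm_one]
    nlinarith [sq_nonneg ‖u‖]

theorem measurable_jumpIntegrand (u : E d) : Measurable (jumpIntegrand u) := by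
  have h1 : Measurable fun x : E d => (inner ℝ u x : ℝ) := by fun_prop
  have h2 : Measurable fun x : E d => if ‖x‖ ≤ 1 then (1 : ℂ) else 0 :=
    Measurable.ite (measurableSet_le measurable_norm measurable_const) measurable_const
      measurable_const
  unfold jumpIntegrand
  fun_prop

theorem integrable_jumpIntegrand (u : E d) : Integrable (jumpIntegrand u) T.nu :=
  (T.integrable_min.const_mul (3 * ‖u‖ ^ 2 + 2)).mono' (measurable_jumpIntegrand u).aestronglyMeasurable
    (Eventually.of_forall (norm_jumpIntegrand_le u))

theorem cumulant_eq (u : E d) : T.cumulant u =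
    Complex.I * ((inner ℝ T.gam u : ℝ) : ℂ) - (1 / 2 : ℂ) * ((inner ℝ u (app T.sig u) : ℝ) : ℂ)
    + ∫ x, jumpIntegrand u x ∂T.nu := rfl

theorem continuous_app {n : ℕ} (M : Matrix (Fin n) (Fin d) ℝ) : Continuous (app M) := by
  unfold app
  fun_prop

theorem cumulant_zero : T.cumulant 0 = 0 := by
  simp [cumulant]

/-- Continuity of the cumulant at zero: it lets kernels that converge to zero almost everywhere
produce cumulants that do so too, as the uniqueness argument requires. -/
theorem tendsto_cumulant_zero : Tendsto T.cumulant (𝓝 0) (𝓝 0) := by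
  have h1 : Tendsto (fun u => ∫ x, jumpIntegrand u x ∂T.nu) (𝓝 0)
      (𝓝 (∫ x, jumpIntegrand 0 x ∂T.nu)) := by
    -- The constant is `3 ‖u‖² + 2` at `‖u‖ = 1`.
    refine tendsto_integral_filter_of_dominated_convergence (fun x => 5 * min 1 (‖x‖ ^ 2))
      (Eventually.of_forall fun u => (measurable_jumpIntegrand u).aestronglyMeasurable) ?_
      (T.integrable_min.const_mul _) ?_
    · filter_upwards [Metric.ball_mem_nhds (0 : E d) one_pos] with u hu
      refine Eventually.of_forall fun x => (norm_jumpIntegrand_le u x).trans ?_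
      have hu' : ‖u‖ < 1 := by simpa using hu
      have : ‖u‖ ^ 2 ≤ 1 := pow_le_one₀ (norm_nonneg _) hu'.le
      gcongr
      linarith
    · refine Eventually.of_forall fun x => ?_
      have : Continuous fun u : E d => jumpIntegrand u x := by
        unfold jumpIntegrand
        fun_prop
      exact this.tendsto 0
  have h2 : Continuous fun u : E d => Complex.I * ((inner ℝ T.gam u : ℝ) : ℂ)
      - (1 / 2 : ℂ) * ((inner ℝ u (app T.sig u) : ℝ) : ℂ) := by
    have := continuous_app T.sig
    fun_prop
  have h3 := (h2.tendsto 0).add h1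
  rw [← cumulant_eq, cumulant_zero] at h3
  exact h3

theorem jumpIntegrand_re (u x : E d) : (jumpIntegrand u x).re = Real.cos (inner ℝ u x) - 1 := by
  unfold jumpIntegrand
  split_ifs <;> simp [mul_comm Complex.I, Complex.exp_ofReal_mul_I_re]

theorem jumpIntegrand_im (u x : E d) : (jumpIntegrand u x).im
    = Real.sin (inner ℝ u x) - inner ℝ u x * (if ‖x‖ ≤ 1 then 1 else 0) := by
  unfold jumpIntegrand
  split_ifs <;> simp [mul_comm Complex.I, Complex.exp_ofReal_mul_I_im]

theorem cumulant_re (u : E d) : (T.cumulant u).re =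
    -(1 / 2) * inner ℝ u (app T.sig u) + ∫ x, (Real.cos (inner ℝ u x) - 1) ∂T.nu := by
  have h : (∫ x, jumpIntegrand u x ∂T.nu).re = ∫ x, (Real.cos (inner ℝ u x) - 1) ∂T.nu := by
    rw [← RCLike.re_eq_complex_re, ← integral_re (T.integrable_jumpIntegrand u)]
    congr with x
    exact jumpIntegrand_re u x
  rw [cumulant_eq, Complex.add_re, h]
  simp

theorem cumulant_im (u : E d) : (T.cumulant u).im = inner ℝ T.gam u
    + ∫ x, (Real.sin (inner ℝ u x) - inner ℝ u x * (if ‖x‖ ≤ 1 then 1 else 0)) ∂T.nu := by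
  have h : (∫ x, jumpIntegrand u x ∂T.nu).im
      = ∫ x, (Real.sin (inner ℝ u x) - inner ℝ u x * (if ‖x‖ ≤ 1 then 1 else 0)) ∂T.nu := by
    rw [← RCLike.im_eq_complex_im, ← integral_im (T.integrable_jumpIntegrand u)]
    congr with x
    exact jumpIntegrand_im u x
  rw [cumulant_eq, Complex.add_im, h]
  simp

theorem integrable_mul_apply (h2 : ∫⁻ x in {x : E d | 1 < ‖x‖}, ‖x‖ₑ ^ 2 ∂T.nu < ⊤) (i j : Fin d) :
    Integrable (fun x : E d => x i * x j) T.nu := by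
  refine (T.integrable_sq h2).mono' (by fun_prop) (Eventually.of_forall fun x => ?_)
  rw [norm_mul, sq]
  exact mul_le_mul (PiLp.norm_apply_le x i) (PiLp.norm_apply_le x j) (norm_nonneg _) (norm_nonneg _)

theorem integrable_inner_mul_inner (h2 : ∫⁻ x in {x : E d | 1 < ‖x‖}, ‖x‖ₑ ^ 2 ∂T.nu < ⊤)
    (a b : E d) : Integrable (fun x : E d => (inner ℝ a x : ℝ) * inner ℝ b x) T.nu := by
  refine ((T.integrable_sq h2).const_mul (‖a‖ * ‖b‖)).mono' (by fun_prop)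
    (Eventually.of_forall fun x => ?_)
  rw [norm_mul]
  calc _ ≤ (‖a‖ * ‖x‖) * (‖b‖ * ‖x‖) := mul_le_mul (norm_inner_le_norm a x) (norm_inner_le_norm b x)
        (norm_nonneg _) (by positivity)
    _ = _ := by ring

/-- The bilinear form of `Σ_L` splits into the Gaussian form and the second moment form of the
jumps, in which the derivatives of the cumulant appear. -/
theorem inner_app_sigL (h2 : ∫⁻ x in {x : E d | 1 < ‖x‖}, ‖x‖ₑ ^ 2 ∂T.nu < ⊤) (a b : E d) :
    inner ℝ a (app T.sigL b)
      = inner ℝ a (app T.sig b) + ∫ x, (inner ℝ a x : ℝ) * inner ℝ b x ∂T.nu := by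
  have h : ∫ x, (inner ℝ a x : ℝ) * inner ℝ b x ∂T.nu
      = ∑ i, ∑ j, a i * (b j * ∫ x : E d, x i * x j ∂T.nu) := by
    simp_rw [inner_eq_sum, Finset.sum_mul_sum]
    rw [integral_finsetSum]
    · refine Finset.sum_congr rfl fun i _ => ?_
      rw [integral_finsetSum]
      · refine Finset.sum_congr rfl fun j _ => ?_
        rw [← integral_const_mul, ← integral_const_mul]
        congr with x
        ring
      · exact fun j _ => (((T.integrable_mul_apply h2 i j).const_mul (a i * b j))).congr
          (Eventually.of_forall fun x => by ring)
    · exact fun i _ => integrable_finsetSum _ fun j _ =>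
        (((T.integrable_mul_apply h2 i j).const_mul (a i * b j))).congr
          (Eventually.of_forall fun x => by ring)
  rw [h, inner_eq_sum, inner_eq_sum, ← Finset.sum_add_distrib]
  refine Finset.sum_congr rfl fun i _ => ?_
  simp only [app_apply, sigL, Matrix.add_apply, Matrix.of_apply, Finset.mul_sum,
    ← Finset.sum_add_distrib]
  exact Finset.sum_congr rfl fun j _ => by ring

/-- The jump part of the real part is `-1/2` times `∫ (2 - 2 cos(h⟨a,x⟩)) dν`; the integrand over
`h²` tends to `⟨a,x⟩²` and is dominated by it. -/
theorem tendsto_cumulant_re_div_sq (h2 : ∫⁻ x in {x : E d | 1 < ‖x‖}, ‖x‖ₑ ^ 2 ∂T.nu < ⊤) (a : E d) :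
    Tendsto (fun h : ℝ => (T.cumulant (h • a)).re / h ^ 2) (𝓝[≠] 0)
      (𝓝 (-(inner ℝ a (app T.sigL a)) / 2)) := by
  have h1 : Tendsto (fun h : ℝ => ∫ x, (2 - 2 * Real.cos (h * inner ℝ a x)) / h ^ 2 ∂T.nu) (𝓝[≠] 0)
      (𝓝 (∫ x, (inner ℝ a x : ℝ) ^ 2 ∂T.nu)) := by
    refine tendsto_integral_filter_of_dominated_convergence (fun x => (inner ℝ a x : ℝ) ^ 2)
      (Eventually.of_forall fun h => by fun_prop) ?_
      ((T.integrable_inner_mul_inner h2 a a).congr (Eventually.of_forall fun x => (sq _).symm))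
      (Eventually.of_forall fun x => tendsto_two_sub_cos_div_sq _ _ (tendsto_mul_div_self _))
    filter_upwards [self_mem_nhdsWithin] with h hh
    refine Eventually.of_forall fun x => ?_
    have hh' : 0 < h ^ 2 := by have : h ≠ 0 := hh; positivity
    rw [Real.norm_of_nonneg (div_nonneg (by linarith [Real.cos_le_one (h * inner ℝ a x)])
      hh'.le), div_le_iff₀ hh']
    have := Real.one_sub_sq_div_two_le_cos (x := h * inner ℝ a x)
    nlinarith
  have h3 := (h1.const_mul (-1 / 2)).const_add (-(1 / 2) * inner ℝ a (app T.sig a))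
  have h4 : -(1 / 2) * inner ℝ a (app T.sig a) + -1 / 2 * ∫ x, (inner ℝ a x : ℝ) ^ 2 ∂T.nu
      = -(inner ℝ a (app T.sigL a)) / 2 := by
    rw [T.inner_app_sigL h2]
    simp only [← sq]
    ring
  rw [h4] at h3
  refine h3.congr' ?_
  filter_upwards [self_mem_nhdsWithin] with h hh
  have hh' : h ≠ 0 := hh
  rw [cumulant_re, app_smul, real_inner_smul_left, real_inner_smul_right, add_div]
  congr 1
  · field_simp
  · rw [← integral_const_mul, ← integral_div]
    congr with x
    rw [real_inner_smul_left]
    ring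

theorem tendsto_cumulant_re (a : E d) :
    Tendsto (fun h : ℝ => (T.cumulant (h • a)).re) (𝓝[≠] 0) (𝓝 0) := by
  have h1 : Tendsto (fun h : ℝ => h • a) (𝓝[≠] 0) (𝓝 0) := by
    have : Tendsto (fun h : ℝ => h • a) (𝓝 0) (𝓝 ((0 : ℝ) • a)) :=
      (continuous_id.smul continuous_const).tendsto 0
    rw [zero_smul] at this
    exact this.mono_left nhdsWithin_le_nhds
  exact (Complex.continuous_re.tendsto 0).comp (T.tendsto_cumulant_zero.comp h1)

theorem abs_sin_sub_le (y : ℝ) : |Real.sin y - y| ≤ 3 * y ^ 2 := by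
  have h := norm_exp_I_sub_one_sub_le y
  have h1 := (Complex.abs_im_le_norm _).trans h
  have h2 : (Complex.exp (Complex.I * (y : ℂ)) - 1 - Complex.I * (y : ℂ)).im = Real.sin y - y := by
    simp [mul_comm Complex.I, Complex.exp_ofReal_mul_I_im]
  rwa [h2] at h1

/-- Small jumps are compensated and contribute at most `3 ‖a‖² ‖x‖²` once `|h| < 1`, since then `h²
≤ |h|`; they vanish in the limit. Large jumps are uncompensated, are bounded by `‖a‖ ‖x‖`, and
produce the mean. Only a first moment of the large jumps enters, so this serves the finite variation
case as well. -/
theorem tendsto_cumulant_im_div (hx : IntegrableOn (fun x : E d => x) {x : E d | 1 < ‖x‖} T.nu)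
    (a : E d) : Tendsto (fun h : ℝ => (T.cumulant (h • a)).im / h) (𝓝[≠] 0)
      (𝓝 (inner ℝ a T.mean)) := by
  have hx' := (integrable_indicator_iff measurableSet_large).2 hx
  have h1 : Tendsto (fun h : ℝ => ∫ x, (Real.sin (h * inner ℝ a x) / h
      - inner ℝ a x * (if ‖x‖ ≤ 1 then 1 else 0)) ∂T.nu) (𝓝[≠] 0)
      (𝓝 (∫ x, (inner ℝ a x - inner ℝ a x * (if ‖x‖ ≤ 1 then 1 else 0)) ∂T.nu)) := by
    have hite : Measurable fun x : E d => if ‖x‖ ≤ 1 then (1 : ℝ) else 0 :=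
      Measurable.ite (measurableSet_le measurable_norm measurable_const) measurable_const
        measurable_const
    refine tendsto_integral_filter_of_dominated_convergence (fun x => 3 * ‖a‖ ^ 2 * min 1 (‖x‖ ^ 2)
        + ‖a‖ * ‖{x : E d | 1 < ‖x‖}.indicator (fun x => x) x‖)
      (Eventually.of_forall fun h => by fun_prop) ?_
      ((T.integrable_min.const_mul _).add (hx'.norm.const_mul _))
      (Eventually.of_forall fun x => (tendsto_sin_mul_div _).sub_const _)
    have hball : ∀ᶠ h : ℝ in 𝓝[≠] 0, |h| < 1 := by
      have : ∀ᶠ h : ℝ in 𝓝 0, |h| < 1 := by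
        filter_upwards [Metric.ball_mem_nhds (0 : ℝ) one_pos] with h hh
        simpa using hh
      exact this.filter_mono nhdsWithin_le_nhds
    filter_upwards [self_mem_nhdsWithin, hball] with h hh hh1
    refine Eventually.of_forall fun x => ?_
    have hh0 : h ≠ 0 := hh
    have hh' : 0 < |h| := abs_pos.2 hh0
    have hin := abs_real_inner_le_norm a x
    by_cases hx1 : ‖x‖ ≤ 1
    · rw [if_pos hx1, mul_one, Set.indicator_of_notMem (by simpa using hx1), norm_zero, mul_zero,
        add_zero, min_eq_right (pow_le_one₀ (norm_nonneg _) hx1), Real.norm_eq_abs]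
      have e : Real.sin (h * inner ℝ a x) / h - inner ℝ a x
          = (Real.sin (h * inner ℝ a x) - h * inner ℝ a x) / h := by field_simp
      rw [e, abs_div, div_le_iff₀ hh']
      refine (abs_sin_sub_le _).trans ?_
      have h5 : (inner ℝ a x : ℝ) ^ 2 ≤ (‖a‖ * ‖x‖) ^ 2 := by rw [← sq_abs]; gcongr
      have h6 : h ^ 2 ≤ |h| := by rw [← sq_abs]; nlinarith
      calc 3 * (h * inner ℝ a x) ^ 2 = 3 * (h ^ 2 * (inner ℝ a x) ^ 2) := by ring
        _ ≤ 3 * (|h| * (‖a‖ * ‖x‖) ^ 2) := by gcongr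
        _ = _ := by ring
    · rw [if_neg hx1, mul_zero, sub_zero, Set.indicator_of_mem (by simpa using hx1),
        Real.norm_eq_abs, abs_div, div_le_iff₀ hh']
      have h5 : |Real.sin (h * inner ℝ a x)| ≤ |h| * (‖a‖ * ‖x‖) := by
        refine Real.abs_sin_le_abs.trans ?_
        rw [abs_mul]
        gcongr
      have : 0 ≤ 3 * ‖a‖ ^ 2 * min 1 (‖x‖ ^ 2) * |h| := by positivity
      nlinarith
  have h3 := h1.const_add (inner ℝ T.gam a)
  have h4 : inner ℝ T.gam a + ∫ x, (inner ℝ a x - inner ℝ a x * (if ‖x‖ ≤ 1 then 1 else 0)) ∂T.nu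
      = inner ℝ a T.mean := by
    rw [mean, inner_add_right, real_inner_comm, ← integral_indicator measurableSet_large,
      ← integral_inner hx']
    congr 2
    ext x
    by_cases hx1 : ‖x‖ ≤ 1
    · rw [if_pos hx1, Set.indicator_of_notMem (by simpa using hx1)]
      simp
    · rw [if_neg hx1, Set.indicator_of_mem (by simpa using hx1)]
      simp
  rw [h4] at h3
  refine h3.congr' ?_
  filter_upwards [self_mem_nhdsWithin] with h hh
  have hh' : h ≠ 0 := hh
  rw [cumulant_im, real_inner_smul_right, add_div, ← integral_div]
  congr 1
  · field_simp
  · congr with x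
    rw [real_inner_smul_left]
    field_simp

/-- The cumulant transform in the finite variation case. -/
theorem cumulant_eq_of_integrable (hs : T.sig = 0) (h1 : ∫⁻ x, ‖x‖ₑ ∂T.nu < ⊤) (u : E d) :
    T.cumulant u = Complex.I * ((inner ℝ u T.gam0 : ℝ) : ℂ)
      + ∫ x, (Complex.exp (((inner ℝ u x : ℝ) : ℂ) * Complex.I) - 1) ∂T.nu := by
  have hi := T.integrable_id h1
  have hS : MeasurableSet {x : E d | ‖x‖ ≤ 1} := measurableSet_le measurable_norm measurable_const
  have hi1 := hi.indicator hS
  have h2 : ∫ x, (inner ℝ u ({x : E d | ‖x‖ ≤ 1}.indicator (fun x => x) x) : ℝ) ∂T.nu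
      = inner ℝ u (∫ x in {x : E d | ‖x‖ ≤ 1}, x ∂T.nu) := by
    rw [integral_inner hi1, integral_indicator hS]
  have hiu : Integrable (fun x => (inner ℝ u x : ℝ)) T.nu := hi.const_inner u
  have hq := integrable_exp_sub_one hiu 1
  simp only [one_mul] at hq
  have hc : Integrable (fun x => Complex.I
      * ((inner ℝ u ({x : E d | ‖x‖ ≤ 1}.indicator (fun x => x) x) : ℝ) : ℂ)) T.nu :=
    (hi1.const_inner u).ofReal.const_mul _
  have h3 : ∫ x, jumpIntegrand u x ∂T.nu
      = ∫ x, (Complex.exp (((inner ℝ u x : ℝ) : ℂ) * Complex.I) - 1) ∂T.nu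
        - Complex.I * ((inner ℝ u (∫ x in {x : E d | ‖x‖ ≤ 1}, x ∂T.nu) : ℝ) : ℂ) := by
    rw [← h2, ← integral_complex_ofReal, ← integral_const_mul, ← integral_sub hq hc]
    congr with x
    unfold jumpIntegrand
    by_cases hx1 : ‖x‖ ≤ 1
    · rw [if_pos hx1, Set.indicator_of_mem (by exact hx1), mul_comm Complex.I, mul_one]
    · rw [if_neg hx1, Set.indicator_of_notMem (by exact hx1), mul_comm Complex.I]
      simp
  have happ : app T.sig u = 0 := by
    ext i
    rw [hs, app_apply]
    simp
  rw [cumulant_eq, h3, gam0, inner_sub_right, happ, inner_zero_right, real_inner_comm]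
  push_cast
  ring

theorem mean_eq_gam0_add (h1 : ∫⁻ x, ‖x‖ₑ ∂T.nu < ⊤) : T.mean = T.gam0 + ∫ x, x ∂T.nu := by
  have hi := T.integrable_id h1
  have hS : MeasurableSet {x : E d | ‖x‖ ≤ 1} := measurableSet_le measurable_norm measurable_const
  have h2 := integral_add_compl hS hi
  have h3 : {x : E d | ‖x‖ ≤ 1}ᶜ = {x : E d | 1 < ‖x‖} := by ext x; simp
  rw [h3] at h2
  rw [mean, gam0, ← h2]
  abel

end LevyTriplet

/-! ### Scalar integrals of vector-valued simple functions -/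

section ScalarIntegral

variable {Ω S : Type*} [MeasurableSpace Ω] [MeasurableSpace S]

theorem IsBddBorel.empty : IsBddBorel (∅ : Set (S × ℝ)) := ⟨MeasurableSet.empty, 0, by simp⟩

theorem IsBddBorel.union {B C : Set (S × ℝ)} (hB : IsBddBorel B) (hC : IsBddBorel C) :
    IsBddBorel (B ∪ C) := by
  obtain ⟨N, hN⟩ := hB.2
  obtain ⟨M, hM⟩ := hC.2
  refine ⟨hB.1.union hC.1, max N M, fun p hp => ?_⟩
  rcases hp with hp | hp
  · exact (hN p hp).trans (le_max_left _ _)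
  · exact (hM p hp).trans (le_max_right _ _)

theorem IsBddBorel.mono {B C : Set (S × ℝ)} (hC : IsBddBorel C) (hB : MeasurableSet B)
    (h : B ⊆ C) : IsBddBorel B :=
  ⟨hB, hC.2.choose, fun p hp => hC.2.choose_spec p (h hp)⟩

theorem IsBddBorel.biUnion {ι : Type*} {s : Finset ι} {B : ι → Set (S × ℝ)}
    (h : ∀ i ∈ s, IsBddBorel (B i)) : IsBddBorel (⋃ i ∈ s, B i) := by
  classical
  induction s using Finset.induction_on with
  | empty => simpa using IsBddBorel.empty
  | insert a s ha ih =>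
    rw [Finset.set_biUnion_insert]
    exact (h a (Finset.mem_insert_self a s)).union
      (ih fun i hi => h i (Finset.mem_insert_of_mem hi))

theorem measure_lt_top_of_isBddBorel {π : Measure S} [IsProbabilityMeasure π] {B : Set (S × ℝ)}
    (hB : IsBddBorel B) : (π.prod volume) B < ⊤ := by
  obtain ⟨N, hN⟩ := hB.2
  refine (measure_mono (t := Set.univ ×ˢ Set.Icc (-N) N) fun p hp => ?_).trans_lt ?_
  · exact ⟨trivial, abs_le.1 (hN p hp)⟩
  · rw [Measure.prod_prod]
    simp

/-- A function vanishing at large times. -/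
def HasBddSupport {V : Type*} [Zero V] (φ : S × ℝ → V) : Prop :=
  ∃ N : ℝ, ∀ p : S × ℝ, N < |p.2| → φ p = 0

theorem HasBddSupport.isBddBorel {V : Type*} [Zero V] {φ : SimpleFunc (S × ℝ) V}
    (h : HasBddSupport φ) {a : V} (ha : a ≠ 0) : IsBddBorel (φ ⁻¹' {a}) := by
  obtain ⟨N, hN⟩ := h
  refine ⟨φ.measurableSet_fiber a, N, fun p hp => ?_⟩
  by_contra hlt
  exact ha ((hN p (not_le.1 hlt)) ▸ hp : _ = _).symm

theorem HasBddSupport.comp {S V W : Type*} [Zero V] [Zero W] {φ : S × ℝ → V}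
    (h : HasBddSupport φ) {g : V → W} (hg : g 0 = 0) : HasBddSupport (fun p => g (φ p)) := by
  obtain ⟨N, hN⟩ := h
  exact ⟨N, fun p hp => by simp only [hN p hp, hg]⟩

theorem HasBddSupport.comp₂ {S V W Z : Type*} [Zero V] [Zero W] [Zero Z] {φ : S × ℝ → V}
    {ψ : S × ℝ → W} (h : HasBddSupport φ) (h' : HasBddSupport ψ) {g : V → W → Z}
    (hg : g 0 0 = 0) : HasBddSupport (fun p => g (φ p) (ψ p)) := by
  obtain ⟨N, hN⟩ := h
  obtain ⟨M, hM⟩ := h'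
  refine ⟨max N M, fun p hp => ?_⟩
  simp only [hN p ((le_max_left _ _).trans_lt hp), hM p ((le_max_right _ _).trans_lt hp), hg]

/-! ### Finite additivity of a Lévy basis and linearity of the scalar integral. -/

variable {P : Measure Ω} {π : Measure S} {d : ℕ} {T : LevyTriplet d} {Λ : Set (S × ℝ) → Ω → E d}

/-- Countable additivity for the constant sequence `∅` makes the partial sums `k Λ(∅)` converge, so
their increments `Λ(∅)` tend to zero. -/
theorem IsLevyBasis.ae_empty (hΛ : IsLevyBasis P π T Λ) : ∀ᵐ ω ∂P, Λ ∅ ω = 0 := by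
  have h := hΛ.sigmaAdd (fun _ => ∅) (fun _ => IsBddBorel.empty)
    (fun i j _ => by simp [Function.onFun]) (by simpa using IsBddBorel.empty)
  filter_upwards [h] with ω hω
  have h1 := (hω.comp (tendsto_add_atTop_nat 1)).sub hω
  simp only [Function.comp, Finset.sum_range_succ, add_sub_cancel_left, sub_self] at h1
  exact tendsto_nhds_unique tendsto_const_nhds h1

theorem IsLevyBasis.ae_union (hΛ : IsLevyBasis P π T Λ) {B C : Set (S × ℝ)} (hB : IsBddBorel B)
    (hC : IsBddBorel C) (hd : Disjoint B C) :
    ∀ᵐ ω ∂P, Λ (B ∪ C) ω = Λ B ω + Λ C ω := by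
  -- Finite additivity is countable additivity for the sequence `B, C, ∅, ∅, …`.
  let F : ℕ → Set (S × ℝ) := fun i => if i = 0 then B else if i = 1 then C else ∅
  have hU : ⋃ i, F i = B ∪ C := by
    ext p
    simp only [Set.mem_iUnion, Set.mem_union]
    constructor
    · rintro ⟨i, hi⟩
      simp only [F] at hi
      split_ifs at hi
      · exact Or.inl hi
      · exact Or.inr hi
      · exact hi.elim
    · rintro (h | h)
      · exact ⟨0, by simpa [F] using h⟩
      · exact ⟨1, by simpa [F] using h⟩
  have hF : ∀ i, IsBddBorel (F i) := fun i => by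
    simp only [F]
    split_ifs
    exacts [hB, hC, IsBddBorel.empty]
  have hFd : Pairwise (Function.onFun Disjoint F) := by
    intro i j hij
    simp only [F, Function.onFun]
    split_ifs
    all_goals first
      | omega
      | exact hd
      | exact hd.symm
      | simp
  have h := hΛ.sigmaAdd F hF hFd (by rw [hU]; exact hB.union hC)
  filter_upwards [h, hΛ.ae_empty] with ω hω h0
  rw [hU] at hω
  refine tendsto_nhds_unique hω (tendsto_const_nhds.congr' ?_)
  filter_upwards [eventually_ge_atTop 2] with k hk
  obtain ⟨j, rfl⟩ := Nat.exists_eq_add_of_le hk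
  clear hk
  induction j with
  | zero => simp [Finset.sum_range_succ, F]
  | succ j ih =>
    rw [← add_assoc, Finset.sum_range_succ, ← ih]
    have : F (2 + j) = ∅ := by
      simp only [F]
      rw [if_neg (by omega), if_neg (by omega)]
    rw [this, h0, add_zero]

theorem IsLevyBasis.ae_biUnion (hΛ : IsLevyBasis P π T Λ) {ι : Type*} (s : Finset ι)
    (B : ι → Set (S × ℝ)) (hB : ∀ i ∈ s, IsBddBorel (B i))
    (hd : (s : Set ι).PairwiseDisjoint B) :
    ∀ᵐ ω ∂P, Λ (⋃ i ∈ s, B i) ω = ∑ i ∈ s, Λ (B i) ω := by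
  classical
  induction s using Finset.induction_on with
  | empty => simpa using hΛ.ae_empty
  | insert a s ha ih =>
    have hB' : ∀ i ∈ s, IsBddBorel (B i) := fun i hi => hB i (Finset.mem_insert_of_mem hi)
    have hd' : (s : Set ι).PairwiseDisjoint B :=
      hd.subset (by simp)
    have hdis : Disjoint (B a) (⋃ i ∈ s, B i) := by
      refine Set.disjoint_iUnion₂_right.2 fun i hi => hd (by simp) (by simp [hi]) ?_
      rintro rfl
      exact ha hi
    filter_upwards [ih hB' hd', hΛ.ae_union (hB a (Finset.mem_insert_self a s))
      (IsBddBorel.biUnion hB') hdis] with ω h1 h2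
    rw [Finset.set_biUnion_insert, h2, h1, Finset.sum_insert ha]

/-- The scalar integral `∑ₐ ⟨a, Λ({φ = a})⟩` of a vector-valued simple function. -/
noncomputable def sInt (Λ : Set (S × ℝ) → Ω → E d) (φ : SimpleFunc (S × ℝ) (E d)) (ω : Ω) : ℝ :=
  ∑ a ∈ φ.range, inner ℝ a (Λ (φ ⁻¹' {a}) ω)

/-- The scalar integral may be computed from any representation of the simple function. -/
theorem IsLevyBasis.sInt_eq_sum (hΛ : IsLevyBasis P π T Λ) {φ : SimpleFunc (S × ℝ) (E d)}
    {ι : Type*} (s : Finset ι) (B : ι → Set (S × ℝ)) (h : ι → E d)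
    (hB : ∀ i ∈ s, h i ≠ 0 → IsBddBorel (B i)) (hd : (s : Set ι).PairwiseDisjoint B)
    (heq : ∀ i ∈ s, ∀ p ∈ B i, φ p = h i) (hcov : ∀ p, φ p ≠ 0 → ∃ i ∈ s, p ∈ B i) :
    ∀ᵐ ω ∂P, sInt Λ φ ω = ∑ i ∈ s, inner ℝ (h i) (Λ (B i) ω) := by
  classical
  -- Indices with `h i = 0` are dropped because `B i` may then be unbounded, and those with `B i`
  -- empty because `h i` need not then be a value of `φ`. The remaining sets with a common value
  -- partition the fibre of `φ` over it.
  set s' := s.filter fun i => h i ≠ 0 ∧ (B i).Nonempty with hs'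
  have hss : ∀ i ∈ s', i ∈ s := fun i hi => (Finset.mem_filter.1 hi).1
  have hmaps : ∀ i ∈ s', h i ∈ φ.range := fun i hi => by
    obtain ⟨h1, h2, p, hp⟩ := Finset.mem_filter.1 hi
    rw [SimpleFunc.mem_range]
    exact ⟨p, heq i h1 p hp⟩
  have hfib : ∀ a ∈ φ.range, ∀ᵐ ω ∂P, (inner ℝ a (Λ (φ ⁻¹' {a}) ω) : ℝ)
      = ∑ i ∈ s' with h i = a, inner ℝ (h i) (Λ (B i) ω) := by
    intro a _
    rcases eq_or_ne a 0 with rfl | ha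
    · refine Eventually.of_forall fun ω => ?_
      rw [inner_zero_left]
      symm
      refine Finset.sum_eq_zero fun i hi => ?_
      rw [(Finset.mem_filter.1 hi).2, inner_zero_left]
    · have hpre : φ ⁻¹' {a} = ⋃ i ∈ s'.filter (fun i => h i = a), B i := by
        ext p
        simp only [Set.mem_preimage, Set.mem_singleton_iff, Set.mem_iUnion, Finset.mem_filter, hs',
          exists_prop]
        constructor
        · intro hp
          obtain ⟨i, hi, hpi⟩ := hcov p (by rw [hp]; exact ha)
          have := heq i hi p hpi
          exact ⟨i, ⟨⟨hi, by rw [← this, hp]; exact ha, p, hpi⟩, by rw [← this, hp]⟩, hpi⟩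
        · rintro ⟨i, ⟨⟨hi, _, _⟩, h2⟩, hpi⟩
          rw [heq i hi p hpi, h2]
      have := hΛ.ae_biUnion (s'.filter fun i => h i = a) B
        (fun i hi => by
          have h1 := Finset.mem_filter.1 (Finset.mem_filter.1 hi).1
          exact hB i h1.1 h1.2.1)
        (hd.subset fun i hi => hss i (Finset.mem_filter.1 hi).1)
      filter_upwards [this] with ω hω
      rw [hpre, hω, inner_sum]
      exact Finset.sum_congr rfl fun i hi => by rw [(Finset.mem_filter.1 hi).2]
  have hall := (ae_ball_iff (Finset.countable_toSet φ.range)).2 hfib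
  filter_upwards [hall, hΛ.ae_empty] with ω h1 h0
  have h2 : ∑ i ∈ s, (inner ℝ (h i) (Λ (B i) ω) : ℝ) = ∑ i ∈ s', inner ℝ (h i) (Λ (B i) ω) := by
    symm
    refine Finset.sum_subset (Finset.filter_subset _ _) fun i hi hni => ?_
    rw [hs', Finset.mem_filter] at hni
    by_cases hz : h i = 0
    · rw [hz, inner_zero_left]
    · have : B i = ∅ := by
        by_contra hne
        exact hni ⟨hi, hz, Set.nonempty_iff_ne_empty.2 hne⟩
      rw [this, h0, inner_zero_right]
  rw [h2, sInt, Finset.sum_congr rfl h1, Finset.sum_fiberwise_of_maps_to hmaps]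

/-- All three functions are constant on the fibres of `SimpleFunc.pair φ ψ`, and on this common
refinement linearity is that of the inner product. -/
theorem IsLevyBasis.sInt_comb (hΛ : IsLevyBasis P π T Λ) {φ ψ χ : SimpleFunc (S × ℝ) (E d)}
    (hφ : HasBddSupport φ) (hψ : HasBddSupport ψ) (b c : ℝ) (hχ : ∀ p, χ p = b • φ p + c • ψ p) :
    ∀ᵐ ω ∂P, sInt Λ χ ω = b * sInt Λ φ ω + c * sInt Λ ψ ω := by
  set κ := SimpleFunc.pair φ ψ with hκ
  have hbd : ∀ q : E d × E d, q ≠ 0 → IsBddBorel (κ ⁻¹' {q}) := fun q hq => by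
    have : HasBddSupport κ := HasBddSupport.comp₂ hφ hψ (g := fun x y => (x, y)) rfl
    exact this.isBddBorel hq
  have key : ∀ (ξ : SimpleFunc (S × ℝ) (E d)) (g : E d × E d → E d), g 0 = 0 →
      (∀ p, ξ p = g (κ p)) → ∀ᵐ ω ∂P, sInt Λ ξ ω
        = ∑ q ∈ κ.range, inner ℝ (g q) (Λ (κ ⁻¹' {q}) ω) := by
    intro ξ g hg hξ
    refine hΛ.sInt_eq_sum κ.range (fun q => κ ⁻¹' {q}) g (fun q _ hq => hbd q ?_) ?_ ?_ ?_
    · rintro rfl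
      exact hq hg
    · intro q _ q' _ hqq
      exact Disjoint.preimage _ (Set.disjoint_singleton.2 hqq)
    · intro q _ p hp
      rw [hξ, show κ p = q from hp]
    · intro p _
      exact ⟨κ p, κ.mem_range_self p, rfl⟩
  filter_upwards [key φ Prod.fst rfl fun p => rfl, key ψ Prod.snd rfl fun p => rfl,
    key χ (fun q => b • q.1 + c • q.2) (by simp) hχ] with ω h1 h2 h3
  rw [h1, h2, h3, Finset.mul_sum, Finset.mul_sum, ← Finset.sum_add_distrib]
  refine Finset.sum_congr rfl fun q _ => ?_
  rw [inner_add_left, real_inner_smul_left, real_inner_smul_left]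

/-- The fibre over `0` is not bounded in time, so nothing is known about `Λ` there; the inner
product with `0` removes that term. -/
theorem sInt_eq_sum_filter {Ω : Type*} {Λ : Set (S × ℝ) → Ω → E d} (φ : SimpleFunc (S × ℝ) (E d)) (ω : Ω) :
    sInt Λ φ ω = ∑ a ∈ φ.range.filter (· ≠ 0), inner ℝ a (Λ (φ ⁻¹' {a}) ω) := by
  classical
  rw [sInt]
  symm
  refine Finset.sum_subset (Finset.filter_subset _ _) fun a ha hna => ?_
  have : a = 0 := by
    by_contra h
    exact hna (Finset.mem_filter.2 ⟨ha, h⟩)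
  rw [this, inner_zero_left]

theorem IsLevyBasis.measurable_sInt (hΛ : IsLevyBasis P π T Λ) {φ : SimpleFunc (S × ℝ) (E d)}
    (hφ : HasBddSupport φ) : Measurable (sInt Λ φ) := by
  have : sInt Λ φ = fun ω => ∑ a ∈ φ.range.filter (· ≠ 0), inner ℝ a (Λ (φ ⁻¹' {a}) ω) :=
    funext fun ω => sInt_eq_sum_filter φ ω
  rw [this]
  refine Finset.measurable_sum _ fun a ha => ?_
  exact (hΛ.measurable _ (hφ.isBddBorel (Finset.mem_filter.1 ha).2)).const_inner

variable [IsProbabilityMeasure π]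

theorem HasBddSupport.integrable {V : Type*} [NormedAddCommGroup V] {φ : SimpleFunc (S × ℝ) V}
    (hφ : HasBddSupport φ) : Integrable φ (π.prod volume) := by
  rw [SimpleFunc.integrable_iff]
  exact fun a ha => measure_lt_top_of_isBddBorel (hφ.isBddBorel ha)

theorem HasBddSupport.integrable_map {V W : Type*} [Zero V] [NormedAddCommGroup W]
    {φ : SimpleFunc (S × ℝ) V} (hφ : HasBddSupport φ) {g : V → W} (hg : g 0 = 0) :
    Integrable (fun p => g (φ p)) (π.prod volume) :=
  HasBddSupport.integrable (φ := φ.map g) (hφ.comp hg)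

theorem HasBddSupport.integral_map {V W : Type*} [NormedAddCommGroup V] [NormedAddCommGroup W]
    [NormedSpace ℝ W] [CompleteSpace W]
    {φ : SimpleFunc (S × ℝ) V} (hφ : HasBddSupport φ) {g : V → W} (hg : g 0 = 0) :
    ∫ p, g (φ p) ∂(π.prod volume) = ∑ a ∈ φ.range, (π.prod volume).real (φ ⁻¹' {a}) • g a := by
  rw [← SimpleFunc.map_integral φ g hφ.integrable hg,
    SimpleFunc.integral_eq_integral _ (hφ.integrable_map hg)]
  rfl

/-- The characteristic function of a scalar integral. -/
theorem IsLevyBasis.integral_exp_sInt (hΛ : IsLevyBasis P π T Λ) {φ : SimpleFunc (S × ℝ) (E d)}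
    (hφ : HasBddSupport φ) : ∫ ω, Complex.exp ((sInt Λ φ ω : ℂ) * Complex.I) ∂P
      = Complex.exp (∫ p, T.cumulant (φ p) ∂(π.prod volume)) := by
  classical
  set s := φ.range.filter (· ≠ 0) with hs
  have hs0 : ∀ i : s, (i : E d) ≠ 0 := fun i => (Finset.mem_filter.1 i.2).2
  -- Independence of a Lévy basis is stated for families indexed by `Fin k`, so the nonzero values
  -- are enumerated.
  let e : Fin s.card ≃ s := s.equivFin.symm
  have hI : ∀ ω, (sInt Λ φ ω : ℂ) * Complex.I
      = ∑ i : Fin s.card, ((inner ℝ (Λ (φ ⁻¹' {(e i : E d)}) ω) (e i : E d) : ℝ) : ℂ)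
        * Complex.I := fun ω => by
    rw [sInt_eq_sum_filter, ← Finset.sum_mul, ← Complex.ofReal_sum,
      Equiv.sum_comp e fun a : s => (inner ℝ (Λ (φ ⁻¹' {(a : E d)}) ω) (a : E d) : ℝ),
      Finset.sum_coe_sort s fun a => (inner ℝ (Λ (φ ⁻¹' {a}) ω) a : ℝ)]
    simp only [real_inner_comm, hs]
  have hbd : ∀ i, IsBddBorel (φ ⁻¹' {(e i : E d)}) := fun i => hφ.isBddBorel (hs0 _)
  have hind := hΛ.indep s.card (fun i => φ ⁻¹' {(e i : E d)}) hbd (fun i j hij =>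
    Disjoint.preimage _ (Set.disjoint_singleton.2 fun h => hij (e.injective (Subtype.ext h))))
  have hmul := hind.integral_fun_prod_comp (f := fun i (x : E d) =>
    Complex.exp (((inner ℝ x (e i : E d) : ℝ) : ℂ) * Complex.I))
    (fun i => (hΛ.measurable _ (hbd i)).aemeasurable)
    (fun i => by fun_prop)
  have hchar : ∀ i, ∫ ω, Complex.exp (((inner ℝ (Λ (φ ⁻¹' {(e i : E d)}) ω) (e i : E d) : ℝ) : ℂ)
      * Complex.I) ∂P
      = Complex.exp ((π.prod volume).real (φ ⁻¹' {(e i : E d)}) • T.cumulant (e i : E d)) :=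
    fun i => by
    have h := hΛ.charFun_eq _ (hbd i) (e i : E d)
    rw [charFun_apply, integral_map (hΛ.measurable _ (hbd i)).aemeasurable (by fun_prop)] at h
    rw [h, Complex.real_smul, mul_comm]
    rfl
  simp_rw [hI, Complex.exp_sum]
  rw [hmul]
  simp_rw [hchar]
  rw [← Complex.exp_sum, hφ.integral_map T.cumulant_zero,
    Equiv.sum_comp e fun a : s => (π.prod volume).real (φ ⁻¹' {(a : E d)}) • T.cumulant (a : E d),
    Finset.sum_coe_sort s fun a => (π.prod volume).real (φ ⁻¹' {a}) • T.cumulant a]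
  congr 1
  refine Finset.sum_subset (Finset.filter_subset _ _) fun a ha hna => ?_
  have : a = 0 := by
    by_contra h
    exact hna (Finset.mem_filter.2 ⟨ha, h⟩)
  rw [this, T.cumulant_zero, smul_zero]

end ScalarIntegral

/-! ### Convergence in measure -/

section InMeasure

variable {Ω : Type*} [MeasurableSpace Ω] {P : Measure Ω} [IsFiniteMeasure P]

/-- On a finite measure space convergence in measure means almost everywhere convergence along a
further subsequence of each subsequence, so continuity suffices and no uniform continuity is needed.
-/
theorem tendstoInMeasure_comp₂ {V W Z : Type*} [PseudoEMetricSpace V] [PseudoEMetricSpace W]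
    [PseudoEMetricSpace Z] {f : ℕ → Ω → V} {f' : Ω → V} {g : ℕ → Ω → W} {g' : Ω → W}
    {Φ : V → W → Z} (hΦ : Continuous (Function.uncurry Φ))
    (hfm : ∀ k, AEStronglyMeasurable (f k) P) (hgm : ∀ k, AEStronglyMeasurable (g k) P)
    (hf : TendstoInMeasure P f atTop f') (hg : TendstoInMeasure P g atTop g') :
    TendstoInMeasure P (fun k ω => Φ (f k ω) (g k ω)) atTop (fun ω => Φ (f' ω) (g' ω)) := by
  rw [exists_seq_tendstoInMeasure_atTop_iff
    (fun k => hΦ.comp_aestronglyMeasurable₂ (hfm k) (hgm k))]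
  intro ns hns
  obtain ⟨ns₁, h1, h1'⟩ := (exists_seq_tendstoInMeasure_atTop_iff hfm).1 hf ns hns
  obtain ⟨ns₂, h2, h2'⟩ := (exists_seq_tendstoInMeasure_atTop_iff hgm).1 hg _ (hns.comp h1)
  refine ⟨ns₁ ∘ ns₂, h1.comp h2, ?_⟩
  filter_upwards [h1', h2'] with ω hω1 hω2
  exact (hΦ.tendsto (f' ω, g' ω)).comp ((hω1.comp h2.tendsto_atTop).prodMk_nhds hω2)

theorem tendstoInMeasure_comp {V Z : Type*} [PseudoEMetricSpace V]
    [PseudoEMetricSpace Z] {f : ℕ → Ω → V} {f' : Ω → V}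
    {Φ : V → Z} (hΦ : Continuous Φ) (hfm : ∀ k, AEStronglyMeasurable (f k) P)
    (hf : TendstoInMeasure P f atTop f') :
    TendstoInMeasure P (fun k ω => Φ (f k ω)) atTop (fun ω => Φ (f' ω)) :=
  tendstoInMeasure_comp₂ (Φ := fun x _ => Φ x) (hΦ.comp continuous_fst) hfm hfm hf hf

theorem tendsto_integral_exp_of_tendstoInMeasure {f : ℕ → Ω → ℝ} {g : Ω → ℝ}
    (hfm : ∀ k, AEStronglyMeasurable (f k) P) (hf : TendstoInMeasure P f atTop g) :
    Tendsto (fun k => ∫ ω, Complex.exp ((f k ω : ℂ) * Complex.I) ∂P) atTop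
      (𝓝 (∫ ω, Complex.exp ((g ω : ℂ) * Complex.I) ∂P)) := by
  refine tendsto_of_subseq_tendsto fun ns hns => ?_
  obtain ⟨ms, _, hms⟩ := (hf.comp hns).exists_seq_tendsto_ae
  have hc : Continuous fun x : ℝ => Complex.exp ((x : ℂ) * Complex.I) := by fun_prop
  refine ⟨ms, tendsto_integral_of_dominated_convergence (fun _ => 1)
    (fun k => hc.comp_aestronglyMeasurable (hfm _)) (integrable_const _)
    (fun k => Eventually.of_forall fun ω => by rw [Complex.norm_exp_ofReal_mul_I]) ?_⟩
  filter_upwards [hms] with ω hω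
  exact (hc.tendsto _).comp hω

theorem ae_eq_of_forall_inner {n : ℕ} {P : Measure Ω} {X Y : Ω → E n}
    (h : ∀ u : E n, ∀ᵐ ω ∂P, (inner ℝ u (X ω) : ℝ) = inner ℝ u (Y ω)) : X =ᵐ[P] Y := by
  have h1 : ∀ᵐ ω ∂P, ∀ i : Fin n, (inner ℝ (EuclideanSpace.single i (1 : ℝ)) (X ω) : ℝ)
      = inner ℝ (EuclideanSpace.single i (1 : ℝ)) (Y ω) := ae_all_iff.2 fun i => h _
  filter_upwards [h1] with ω hω
  ext i
  simpa [EuclideanSpace.inner_single_left] using hω i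

/-- A random vector whose characteristic function is constantly one vanishes. -/
theorem ae_eq_zero_of_integral_exp {n : ℕ} [IsProbabilityMeasure P] {X : Ω → E n}
    (hX : AEMeasurable X P)
    (h : ∀ u : E n, ∫ ω, Complex.exp (((inner ℝ u (X ω) : ℝ) : ℂ) * Complex.I) ∂P = 1) :
    ∀ᵐ ω ∂P, X ω = 0 := by
  have : IsProbabilityMeasure (P.map X) := Measure.isProbabilityMeasure_map hX
  have h1 : P.map X = Measure.dirac 0 := by
    refine Measure.ext_of_charFun (funext fun u => ?_)
    rw [charFun_dirac, charFun_apply, integral_map hX (by fun_prop)]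
    simp_rw [real_inner_comm, h]
    simp
  have h2 : ∀ᵐ x ∂(P.map X), x = 0 := by
    rw [h1, ae_dirac_eq]
    exact rfl
  exact ae_of_ae_map hX h2

end InMeasure

/-! ### Integrals of matrix-valued kernels -/

section MatrixIntegral

variable {Ω S : Type*} [MeasurableSpace Ω] [MeasurableSpace S]
  {P : Measure Ω} {π : Measure S} {n d : ℕ} {T : LevyTriplet d} {Λ : Set (S × ℝ) → Ω → E d}

theorem app_zero_left (x : E d) : app (0 : Matrix (Fin n) (Fin d) ℝ) x = 0 := by
  ext i
  simp [app_apply]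

theorem app_zero_right (M : Matrix (Fin n) (Fin d) ℝ) : app M 0 = 0 := by
  ext i
  simp [app_apply]

theorem app_add_left (M N : Matrix (Fin n) (Fin d) ℝ) (x : E d) :
    app (M + N) x = app M x + app N x := by
  ext i
  simp [app_apply, add_mul, Finset.sum_add_distrib]

theorem app_sub_left (M N : Matrix (Fin n) (Fin d) ℝ) (x : E d) :
    app (M - N) x = app M x - app N x := by
  ext i
  simp [app_apply, sub_mul, Finset.sum_sub_distrib]

theorem app_sub_right (M : Matrix (Fin n) (Fin d) ℝ) (x y : E d) :
    app M (x - y) = app M x - app M y := by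
  ext i
  simp [app_apply, mul_sub, Finset.sum_sub_distrib]

theorem inner_app_transpose (M : Matrix (Fin n) (Fin d) ℝ) (u : E n) (x : E d) :
    inner ℝ (app Mᵀ u) x = (inner ℝ u (app M x) : ℝ) := by
  simp only [inner_eq_sum, app_apply, Matrix.transpose_apply, Finset.sum_mul, Finset.mul_sum]
  rw [Finset.sum_comm]
  exact Finset.sum_congr rfl fun i _ => Finset.sum_congr rfl fun j _ => by ring

theorem continuous_app_left (x : E d) :
    Continuous fun M : Matrix (Fin n) (Fin d) ℝ => app M x := by
  unfold app
  fun_prop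

theorem continuous_app_transpose (u : E n) :
    Continuous fun M : Matrix (Fin n) (Fin d) ℝ => app Mᵀ u :=
  (continuous_app_left u).comp continuous_id.matrix_transpose

/-- The vector-valued simple function `gᵀ u` restricted to `A`. -/
noncomputable def rowSimple (g : SimpleFunc (S × ℝ) (Matrix (Fin n) (Fin d) ℝ)) (A : Set (S × ℝ))
    (u : E n) : SimpleFunc (S × ℝ) (E d) :=
  (g.restrict A).map fun a => app aᵀ u

theorem rowSimple_apply (g : SimpleFunc (S × ℝ) (Matrix (Fin n) (Fin d) ℝ)) {A : Set (S × ℝ)}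
    (hA : MeasurableSet A) (u : E n) (p : S × ℝ) :
    rowSimple g A u p = A.indicator (fun p => app (g p)ᵀ u) p := by
  rw [rowSimple, SimpleFunc.map_apply, SimpleFunc.restrict_apply g hA]
  by_cases hp : p ∈ A
  · rw [Set.indicator_of_mem hp, Set.indicator_of_mem hp]
  · rw [Set.indicator_of_notMem hp, Set.indicator_of_notMem hp, Matrix.transpose_zero,
      app_zero_left]

theorem HasBddSupport.rowSimple {g : SimpleFunc (S × ℝ) (Matrix (Fin n) (Fin d) ℝ)}
    (hg : HasBddSupport g) {A : Set (S × ℝ)} (hA : MeasurableSet A) (u : E n) :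
    HasBddSupport (rowSimple g A u) := by
  obtain ⟨N, hN⟩ := hg
  refine ⟨N, fun p hp => ?_⟩
  rw [rowSimple_apply g hA]
  refine Set.indicator_apply_eq_zero.2 fun _ => ?_
  rw [hN p hp, Matrix.transpose_zero, app_zero_left]

/-- The vector `u` is moved across the matrix by transposition. This reduces statements about
vector-valued integrals to scalar ones, tested against every `u`. -/
theorem IsLevyBasis.inner_simpleIntegral (hΛ : IsLevyBasis P π T Λ)
    {g : SimpleFunc (S × ℝ) (Matrix (Fin n) (Fin d) ℝ)} (hg : HasBddSupport g)
    {A : Set (S × ℝ)} (hA : MeasurableSet A) (u : E n) :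
    ∀ᵐ ω ∂P, (inner ℝ u (simpleIntegral Λ g A ω) : ℝ) = sInt Λ (rowSimple g A u) ω := by
  have h := hΛ.sInt_eq_sum (φ := rowSimple g A u) g.range (fun a => g ⁻¹' {a} ∩ A)
    (fun a => app aᵀ u)
    (fun a _ ha => by
      have ha0 : a ≠ 0 := by
        rintro rfl
        exact ha (by rw [Matrix.transpose_zero, app_zero_left])
      exact (hg.isBddBorel ha0).mono ((g.measurableSet_fiber a).inter hA) Set.inter_subset_left)
    (fun a _ b _ hab => (Disjoint.preimage _ (Set.disjoint_singleton.2 hab)).mono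
      Set.inter_subset_left Set.inter_subset_left)
    (fun a _ p hp => by
      rw [rowSimple_apply g hA, Set.indicator_of_mem hp.2, show g p = a from hp.1])
    (fun p hp => by
      rw [rowSimple_apply g hA] at hp
      exact ⟨g p, g.mem_range_self p, rfl, Set.mem_of_indicator_ne_zero hp⟩)
  filter_upwards [h] with ω hω
  rw [hω, simpleIntegral, inner_sum]
  exact Finset.sum_congr rfl fun a _ => (inner_app_transpose a u _).symm

theorem IsLevyBasis.measurable_simpleIntegral (hΛ : IsLevyBasis P π T Λ)
    {g : SimpleFunc (S × ℝ) (Matrix (Fin n) (Fin d) ℝ)} (hg : HasBddSupport g)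
    {A : Set (S × ℝ)} (hA : MeasurableSet A) : Measurable (simpleIntegral Λ g A) := by
  unfold simpleIntegral
  refine Finset.measurable_sum _ fun a _ => ?_
  by_cases ha : a = 0
  · simp only [ha, app_zero_left]
    exact measurable_const
  · exact (LevyTriplet.continuous_app a).measurable.comp (hΛ.measurable _
      ((hg.isBddBorel ha).mono ((g.measurableSet_fiber a).inter hA) Set.inter_subset_left))

theorem IsLevyBasis.simpleIntegral_add (hΛ : IsLevyBasis P π T Λ)
    {g h : SimpleFunc (S × ℝ) (Matrix (Fin n) (Fin d) ℝ)} (hg : HasBddSupport g)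
    (hh : HasBddSupport h) {A : Set (S × ℝ)} (hA : MeasurableSet A) :
    simpleIntegral Λ (g + h) A =ᵐ[P] fun ω => simpleIntegral Λ g A ω + simpleIntegral Λ h A ω := by
  refine ae_eq_of_forall_inner fun u => ?_
  have hgh : HasBddSupport (g + h : SimpleFunc (S × ℝ) (Matrix (Fin n) (Fin d) ℝ)) :=
    hg.comp₂ hh (g := fun a b => a + b) (add_zero 0)
  filter_upwards [hΛ.inner_simpleIntegral hg hA u, hΛ.inner_simpleIntegral hh hA u,
    hΛ.inner_simpleIntegral hgh hA u, hΛ.sInt_comb (χ := rowSimple (g + h) A u)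
      (hg.rowSimple hA u) (hh.rowSimple hA u) 1 1 (fun p => by
        simp only [rowSimple_apply _ hA, one_smul]
        by_cases hp : p ∈ A
        · simp [hp, app_add_left]
        · simp [hp])] with ω h1 h2 h3 h4
  rw [inner_add_right, h1, h2, h3, h4, one_mul, one_mul]

theorem IsLevyBasis.simpleIntegral_restrict (hΛ : IsLevyBasis P π T Λ)
    {g : SimpleFunc (S × ℝ) (Matrix (Fin n) (Fin d) ℝ)} (hg : HasBddSupport g)
    {A B : Set (S × ℝ)} (hA : MeasurableSet A) (hB : MeasurableSet B) :
    simpleIntegral Λ (g.restrict A) B =ᵐ[P] simpleIntegral Λ g (A ∩ B) := by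
  refine ae_eq_of_forall_inner fun u => ?_
  have hgr : HasBddSupport (g.restrict A) := by
    obtain ⟨N, hN⟩ := hg
    refine ⟨N, fun p hp => ?_⟩
    rw [SimpleFunc.restrict_apply g hA]
    exact Set.indicator_apply_eq_zero.2 fun _ => hN p hp
  have heq : rowSimple (g.restrict A) B u = rowSimple g (A ∩ B) u := by
    ext1 p
    rw [rowSimple_apply _ hB, rowSimple_apply _ (hA.inter hB)]
    simp only [SimpleFunc.restrict_apply g hA]
    by_cases hpA : p ∈ A <;> by_cases hpB : p ∈ B <;>
      simp [hpA, hpB, app_zero_left]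
  filter_upwards [hΛ.inner_simpleIntegral hgr hB u,
    hΛ.inner_simpleIntegral hg (hA.inter hB) u] with ω h1 h2
  rw [h1, h2, heq]

/-! ### Integrals of general kernels: sums, restrictions, uniqueness. -/

variable {F F' : S × ℝ → Matrix (Fin n) (Fin d) ℝ} {Y Y' : Ω → E n}

theorem IsLevyIntegral.aemeasurable (hΛ : IsLevyBasis P π T Λ) (h : IsLevyIntegral P π Λ F Y) :
    AEMeasurable Y P := by
  obtain ⟨g, hg, -, -, hY⟩ := h
  exact hY.aemeasurable fun k =>
    (hΛ.measurable_simpleIntegral (hg k) MeasurableSet.univ).aemeasurable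

theorem IsLevyIntegral.add [IsFiniteMeasure P] (hΛ : IsLevyBasis P π T Λ) (h : IsLevyIntegral P π Λ F Y)
    (h' : IsLevyIntegral P π Λ F' Y') :
    IsLevyIntegral P π Λ (fun p => F p + F' p) (fun ω => Y ω + Y' ω) := by
  obtain ⟨g, hg, hgF, hgA, hgY⟩ := h
  obtain ⟨g', hg', hgF', hgA', hgY'⟩ := h'
  have hlim : ∀ (A : Set (S × ℝ)) (Z Z' : Ω → E n), MeasurableSet A →
      TendstoInMeasure P (fun k => simpleIntegral Λ (g k) A) atTop Z →
      TendstoInMeasure P (fun k => simpleIntegral Λ (g' k) A) atTop Z' →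
      TendstoInMeasure P (fun k => simpleIntegral Λ (g k + g' k) A) atTop
        (fun ω => Z ω + Z' ω) := by
    intro A Z Z' hA hZ hZ'
    refine (tendstoInMeasure_comp₂ (Φ := fun x y : E n => x + y) continuous_add
      (fun k => (hΛ.measurable_simpleIntegral (hg k) hA).aestronglyMeasurable)
      (fun k => (hΛ.measurable_simpleIntegral (hg' k) hA).aestronglyMeasurable) hZ hZ').congr_left
      fun k => (hΛ.simpleIntegral_add (hg k) (hg' k) hA).symm
  refine ⟨fun k => g k + g' k, fun k => (HasBddSupport.comp₂ (hg k) (hg' k)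
    (g := fun a b => a + b) (add_zero 0)), ?_, fun A hA => ?_, ?_⟩
  · filter_upwards [hgF, hgF'] with p h1 h2
    exact h1.add h2
  · obtain ⟨Z, hZ⟩ := hgA A hA
    obtain ⟨Z', hZ'⟩ := hgA' A hA
    exact ⟨_, hlim A Z Z' hA hZ hZ'⟩
  · exact hlim Set.univ Y Y' MeasurableSet.univ hgY hgY'

/-- Here the convergence over every Borel set required by the definition is used: the restrictions
to `A` of the approximants of `F` are admissible approximants of `A.indicator F`. They vanish off
`A`, which independence needs. -/
theorem IsLevyIntegral.exists_restrict (hΛ : IsLevyBasis P π T Λ) (h : IsLevyIntegral P π Λ F Y)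
    {A : Set (S × ℝ)} (hA : MeasurableSet A) :
    ∃ (Z : Ω → E n) (g : ℕ → SimpleFunc (S × ℝ) (Matrix (Fin n) (Fin d) ℝ)),
      IsLevyIntegral P π Λ (A.indicator F) Z ∧ (∀ k, HasBddSupport (g k)) ∧
      (∀ k, ∀ p ∉ A, g k p = 0) ∧
      TendstoInMeasure P (fun k => simpleIntegral Λ (g k) Set.univ) atTop Z := by
  obtain ⟨g, hg, hgF, hgA, hgY⟩ := h
  obtain ⟨Z, hZ⟩ := hgA A hA
  have hbd : ∀ k, HasBddSupport ((g k).restrict A) := fun k => by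
    obtain ⟨N, hN⟩ := hg k
    refine ⟨N, fun p hp => ?_⟩
    rw [SimpleFunc.restrict_apply _ hA]
    exact Set.indicator_apply_eq_zero.2 fun _ => hN p hp
  have hlim : TendstoInMeasure P (fun k => simpleIntegral Λ ((g k).restrict A) Set.univ) atTop Z := by
    refine hZ.congr_left fun k => ?_
    have := hΛ.simpleIntegral_restrict (hg k) hA MeasurableSet.univ
    rw [Set.inter_univ] at this
    exact this.symm
  refine ⟨Z, fun k => (g k).restrict A, ⟨_, hbd, ?_, fun B hB => ?_, hlim⟩, hbd, fun k p hp => ?_,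
    hlim⟩
  · filter_upwards [hgF] with p hp
    simp only [SimpleFunc.restrict_apply _ hA]
    by_cases hpA : p ∈ A
    · simpa [hpA] using hp
    · simp [hpA]
  · obtain ⟨W, hW⟩ := hgA (A ∩ B) (hA.inter hB)
    exact ⟨W, hW.congr_left fun k => (hΛ.simpleIntegral_restrict (hg k) hA hB).symm⟩
  · rw [SimpleFunc.restrict_apply _ hA, Set.indicator_of_notMem hp]

variable [IsProbabilityMeasure P] [IsProbabilityMeasure π]

/-- The integral of a kernel is almost surely unique. -/
theorem IsLevyIntegral.ae_unique (hΛ : IsLevyBasis P π T Λ) (h : IsLevyIntegral P π Λ F Y)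
    (h' : IsLevyIntegral P π Λ F Y') : Y =ᵐ[P] Y' := by
  have hYm := h.aemeasurable hΛ
  have hYm' := h'.aemeasurable hΛ
  obtain ⟨g, hg, hgF, hgA, hgY⟩ := h
  obtain ⟨g', hg', hgF', hgA', hgY'⟩ := h'
  have hb : ∀ k, HasBddSupport (g k) := hg
  have hb' : ∀ k, HasBddSupport (g' k) := hg'
  suffices H : ∀ᵐ ω ∂P, Y ω - Y' ω = 0 by
    filter_upwards [H] with ω hω
    exact sub_eq_zero.1 hω
  refine ae_eq_zero_of_integral_exp (hYm.sub hYm') fun u => ?_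
  -- The difference of the two approximating sequences, paired with `u` and restricted to `A`. Its
  -- scalar integrals converge in probability for every `A`, and without restriction it tends to
  -- zero almost everywhere.
  let φ : Set (S × ℝ) → ℕ → SimpleFunc (S × ℝ) (E d) := fun A k =>
    rowSimple (g k) A u - rowSimple (g' k) A u
  have hφbd : ∀ A, MeasurableSet A → ∀ k, HasBddSupport (φ A k) := fun A hA k =>
    ((hb k).rowSimple hA u).comp₂ ((hb' k).rowSimple hA u)
      (g := fun a b => a - b) (sub_zero 0)
  have hφA : ∀ A, MeasurableSet A → ∀ k p, φ A k p = A.indicator (φ Set.univ k) p := by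
    intro A hA k p
    simp only [φ, SimpleFunc.coe_sub, Pi.sub_apply, rowSimple_apply _ hA]
    by_cases hp : p ∈ A
    · simp [hp, rowSimple_apply _ MeasurableSet.univ]
    · simp [hp]
  have hexp : ∀ A, MeasurableSet A → ∀ k, Complex.exp (∫ p in A, T.cumulant (φ Set.univ k p)
      ∂(π.prod volume)) = ∫ ω, Complex.exp ((sInt Λ (φ A k) ω : ℂ) * Complex.I) ∂P := by
    intro A hA k
    rw [hΛ.integral_exp_sInt (hφbd A hA k), ← integral_indicator hA]
    congr 2
    ext p
    rw [hφA A hA]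
    by_cases hp : p ∈ A
    · simp [hp]
    · simp [hp, T.cumulant_zero]
  have hconv : ∀ A, MeasurableSet A → ∀ Z Z' : Ω → E n,
      TendstoInMeasure P (fun k => simpleIntegral Λ (g k) A) atTop Z →
      TendstoInMeasure P (fun k => simpleIntegral Λ (g' k) A) atTop Z' →
      Tendsto (fun k => Complex.exp (∫ p in A, T.cumulant (φ Set.univ k p) ∂(π.prod volume))) atTop
        (𝓝 (∫ ω, Complex.exp (((inner ℝ u (Z ω - Z' ω) : ℝ) : ℂ) * Complex.I) ∂P)) := by
    intro A hA Z Z' hZ hZ'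
    simp_rw [hexp A hA]
    refine tendsto_integral_exp_of_tendstoInMeasure
      (fun k => (hΛ.measurable_sInt (hφbd A hA k)).aestronglyMeasurable) ?_
    have h1 := tendstoInMeasure_comp₂ (Φ := fun x y : E n => (inner ℝ u (x - y) : ℝ))
      (by fun_prop)
      (fun k => (hΛ.measurable_simpleIntegral (hg k) hA).aestronglyMeasurable)
      (fun k => (hΛ.measurable_simpleIntegral (hg' k) hA).aestronglyMeasurable) hZ hZ'
    refine h1.congr_left fun k => ?_
    filter_upwards [hΛ.inner_simpleIntegral (hg k) hA u, hΛ.inner_simpleIntegral (hg' k) hA u,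
      hΛ.sInt_comb (χ := φ A k) ((hb k).rowSimple hA u)
        ((hb' k).rowSimple hA u) 1 (-1)
        (fun p => by simp [φ, sub_eq_add_neg])] with ω h2 h3 h4
    rw [inner_sub_right, h2, h3, h4]
    ring
  -- The gliding hump lemma applied to the cumulants of the differences; the limit is the
  -- characteristic function of `Y - Y'` at `u`, which is therefore `1`.
  have hlim := tendsto_exp_integral_one (m := π.prod volume)
    (β := fun k p => T.cumulant (φ Set.univ k p))
    (fun k => ((φ Set.univ k).map T.cumulant).measurable)
    (fun k => (hφbd Set.univ MeasurableSet.univ k).integrable_map T.cumulant_zero)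
    (by
      filter_upwards [hgF, hgF'] with p h1 h2
      refine T.tendsto_cumulant_zero.comp ?_
      have h3 := (((continuous_app_transpose u).tendsto _).comp h1).sub
        (((continuous_app_transpose u).tendsto _).comp h2)
      rw [sub_self] at h3
      refine h3.congr fun k => ?_
      simp [φ, rowSimple_apply _ MeasurableSet.univ])
    (fun A hA => by
      obtain ⟨Z, hZ⟩ := hgA A hA
      obtain ⟨Z', hZ'⟩ := hgA' A hA
      exact ⟨_, hconv A hA Z Z' hZ hZ'⟩)
  have h5 := hconv Set.univ MeasurableSet.univ Y Y' hgY hgY'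
  simp only [setIntegral_univ] at h5
  exact tendsto_nhds_unique h5 hlim

end MatrixIntegral

/-! ### Independence of integrals over disjoint sets -/

section Independence

variable {Ω S : Type*} [MeasurableSpace Ω] [MeasurableSpace S]
  {P : Measure Ω} {π : Measure S} {n d : ℕ} {T : LevyTriplet d} {Λ : Set (S × ℝ) → Ω → E d}

/-- `Y` is a limit in probability of scalar integrals of simple functions supported in `D`. -/
def IsScalarLimit (P : Measure Ω) (Λ : Set (S × ℝ) → Ω → E d) (D : Set (S × ℝ)) (Y : Ω → ℝ) :
    Prop :=
  ∃ φ : ℕ → SimpleFunc (S × ℝ) (E d), (∀ k, HasBddSupport (φ k)) ∧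
    (∀ k, ∀ p ∉ D, φ k p = 0) ∧ TendstoInMeasure P (fun k => sInt Λ (φ k)) atTop Y

theorem IsScalarLimit.zero {D : Set (S × ℝ)} : IsScalarLimit P Λ D (fun _ => 0) := by
  refine ⟨fun _ => 0, fun _ => ⟨0, fun _ _ => rfl⟩, fun _ _ _ => rfl, ?_⟩
  have : ∀ ω, sInt Λ (0 : SimpleFunc (S × ℝ) (E d)) ω = 0 := fun ω => by
    rw [sInt]
    refine Finset.sum_eq_zero fun a ha => ?_
    obtain ⟨p, rfl⟩ := SimpleFunc.mem_range.1 ha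
    exact inner_zero_left _
  intro ε hε
  simp [this, hε.not_ge]

theorem IsScalarLimit.add [IsFiniteMeasure P] (hΛ : IsLevyBasis P π T Λ) {D : Set (S × ℝ)}
    {Y Z : Ω → ℝ} (hY : IsScalarLimit P Λ D Y) (hZ : IsScalarLimit P Λ D Z) :
    IsScalarLimit P Λ D (fun ω => Y ω + Z ω) := by
  obtain ⟨φ, hφ, hφD, hφY⟩ := hY
  obtain ⟨ψ, hψ, hψD, hψZ⟩ := hZ
  refine ⟨fun k => φ k + ψ k, fun k => (hφ k).comp₂ (hψ k) (g := fun a b => a + b) (add_zero 0),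
    fun k p hp => by simp [hφD k p hp, hψD k p hp], ?_⟩
  refine (tendstoInMeasure_comp₂ (Φ := fun x y : ℝ => x + y) continuous_add
    (fun k => (hΛ.measurable_sInt (hφ k)).aestronglyMeasurable)
    (fun k => (hΛ.measurable_sInt (hψ k)).aestronglyMeasurable) hφY hψZ).congr_left fun k => ?_
  filter_upwards [hΛ.sInt_comb (χ := φ k + ψ k) (hφ k) (hψ k) 1 1 (fun p => by simp)] with ω hω
  rw [hω, one_mul, one_mul]

theorem IsScalarLimit.sum [IsFiniteMeasure P] (hΛ : IsLevyBasis P π T Λ) {D : Set (S × ℝ)}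
    {ι : Type*} (s : Finset ι) {Y : ι → Ω → ℝ} (hY : ∀ i, IsScalarLimit P Λ D (Y i)) :
    IsScalarLimit P Λ D (fun ω => ∑ i ∈ s, Y i ω) := by
  classical
  induction s using Finset.induction_on with
  | empty => simpa using IsScalarLimit.zero
  | insert a s ha ih =>
    simp_rw [Finset.sum_insert ha]
    exact (hY a).add hΛ ih

/-- At each point one of the two approximants vanishes and `Φ(0) = 0`, so the cumulant of their sum
is the sum of their cumulants. The characteristic functions factor before the limit, hence in the
limit. -/
theorem IsScalarLimit.integral_exp_add [IsProbabilityMeasure P] [IsProbabilityMeasure π]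
    (hΛ : IsLevyBasis P π T Λ) {D : Set (S × ℝ)}
    {Y Z : Ω → ℝ} (hY : IsScalarLimit P Λ D Y) (hZ : IsScalarLimit P Λ Dᶜ Z) :
    ∫ ω, Complex.exp (((Y ω + Z ω : ℝ) : ℂ) * Complex.I) ∂P
      = (∫ ω, Complex.exp ((Y ω : ℂ) * Complex.I) ∂P)
        * ∫ ω, Complex.exp ((Z ω : ℂ) * Complex.I) ∂P := by
  obtain ⟨φ, hφ, hφD, hφY⟩ := hY
  obtain ⟨ψ, hψ, hψD, hψZ⟩ := hZ
  have hφm := fun k => (hΛ.measurable_sInt (hφ k)).aestronglyMeasurable (μ := P)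
  have hψm := fun k => (hΛ.measurable_sInt (hψ k)).aestronglyMeasurable (μ := P)
  have h1 := tendsto_integral_exp_of_tendstoInMeasure hφm hφY
  have h2 := tendsto_integral_exp_of_tendstoInMeasure hψm hψZ
  have h3 := tendsto_integral_exp_of_tendstoInMeasure (fun k => (hφm k).add (hψm k))
    (tendstoInMeasure_comp₂ (Φ := fun x y : ℝ => x + y) continuous_add hφm hψm hφY hψZ)
  refine tendsto_nhds_unique h3 ((h1.mul h2).congr fun k => ?_)
  have hbd : HasBddSupport (φ k + ψ k : SimpleFunc (S × ℝ) (E d)) :=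
    (hφ k).comp₂ (hψ k) (g := fun a b => a + b) (add_zero 0)
  have h4 : ∫ ω, Complex.exp (((sInt Λ (φ k) + sInt Λ (ψ k)) ω : ℂ) * Complex.I) ∂P
      = ∫ ω, Complex.exp ((sInt Λ (φ k + ψ k) ω : ℂ) * Complex.I) ∂P := by
    refine integral_congr_ae ?_
    filter_upwards [hΛ.sInt_comb (χ := φ k + ψ k) (hφ k) (hψ k) 1 1 (fun p => by simp)] with ω hω
    simp only [hω, one_mul, Pi.add_apply]
  rw [h4, hΛ.integral_exp_sInt hbd, hΛ.integral_exp_sInt (hφ k), hΛ.integral_exp_sInt (hψ k),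
    ← Complex.exp_add, ← integral_add ((hφ k).integrable_map T.cumulant_zero)
      ((hψ k).integrable_map T.cumulant_zero)]
  congr 2
  ext p
  by_cases hp : p ∈ D
  · simp [hψD k p (fun h => h hp), T.cumulant_zero]
  · simp [hφD k p hp, T.cumulant_zero]

/-- The given approximants need not vanish off `D`. Restricting them to `D` approximates the same
kernel, and uniqueness identifies the limit. -/
theorem IsLevyIntegral.isScalarLimit [IsProbabilityMeasure P] [IsProbabilityMeasure π]
    (hΛ : IsLevyBasis P π T Λ) {D : Set (S × ℝ)} (hD : MeasurableSet D)
    {F : S × ℝ → Matrix (Fin n) (Fin d) ℝ} {Y : Ω → E n} (h : IsLevyIntegral P π Λ F Y)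
    (hF : ∀ p ∉ D, F p = 0) (u : E n) : IsScalarLimit P Λ D (fun ω => inner ℝ u (Y ω)) := by
  obtain ⟨Z, g, hZ, hg, hgD, hlim⟩ := h.exists_restrict hΛ hD
  have hFD : D.indicator F = F := by
    rw [Set.indicator_eq_self]
    exact fun p hp => by_contra fun hn => hp (hF p hn)
  rw [hFD] at hZ
  have hYZ := h.ae_unique hΛ hZ
  refine ⟨fun k => rowSimple (g k) Set.univ u, fun k => (hg k).rowSimple MeasurableSet.univ u,
    fun k p hp => ?_, ?_⟩
  · rw [rowSimple_apply _ MeasurableSet.univ, Set.indicator_univ, hgD k p hp,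
      Matrix.transpose_zero, app_zero_left]
  · refine (tendstoInMeasure_comp (Φ := fun x : E n => (inner ℝ u x : ℝ)) (by fun_prop)
      (fun k => (hΛ.measurable_simpleIntegral (hg k) MeasurableSet.univ).aestronglyMeasurable)
      hlim).congr (fun k => hΛ.inner_simpleIntegral (hg k) MeasurableSet.univ u) ?_
    filter_upwards [hYZ] with ω hω
    rw [hω]

/-- The space `Fin u → E n` carries the supremum norm rather than an inner product, so joint
independence is tested with dual characteristic functions; this splits a functional into inner
products coordinate by coordinate. -/
theorem exists_inner_of_dual {u : ℕ} (M : StrongDual ℝ (Fin u → E n)) :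
    ∃ a : Fin u → E n, ∀ x, M x = ∑ i, inner ℝ (a i) (x i) := by
  refine ⟨fun i => (InnerProductSpace.toDual ℝ (E n)).symm
    (M.comp (ContinuousLinearMap.single ℝ (fun _ : Fin u => E n) i)), fun x => ?_⟩
  simp only [InnerProductSpace.toDual_symm_apply, ContinuousLinearMap.comp_apply]
  rw [← map_sum]
  congr 1
  ext1 i
  simp

/-- Integrals of kernels supported in a set are independent of those of kernels supported in the
complement. -/
theorem indepFun_of_disjoint_support [IsProbabilityMeasure P] [IsProbabilityMeasure π]
    (hΛ : IsLevyBasis P π T Λ) {D : Set (S × ℝ)} (hD : MeasurableSet D) {u v : ℕ}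
    {F : Fin u → S × ℝ → Matrix (Fin n) (Fin d) ℝ} {X : Fin u → Ω → E n}
    {H : Fin v → S × ℝ → Matrix (Fin n) (Fin d) ℝ} {Y : Fin v → Ω → E n}
    (hX : ∀ i, IsLevyIntegral P π Λ (F i) (X i)) (hF : ∀ i, ∀ p ∉ D, F i p = 0)
    (hY : ∀ j, IsLevyIntegral P π Λ (H j) (Y j)) (hH : ∀ j, ∀ p ∈ D, H j p = 0) :
    IndepFun (fun ω i => X i ω) (fun ω j => Y j ω) P := by
  have hXm : AEMeasurable (fun ω i => X i ω) P :=
    aemeasurable_pi_lambda _ fun i => (hX i).aemeasurable hΛ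
  have hYm : AEMeasurable (fun ω j => Y j ω) P :=
    aemeasurable_pi_lambda _ fun j => (hY j).aemeasurable hΛ
  rw [indepFun_iff_charFunDual_prod hXm hYm]
  intro L
  obtain ⟨a, ha⟩ := exists_inner_of_dual (L.comp (.inl ℝ (Fin u → E n) (Fin v → E n)))
  obtain ⟨b, hb⟩ := exists_inner_of_dual (L.comp (.inr ℝ (Fin u → E n) (Fin v → E n)))
  have hL : ∀ x y, L (x, y) = ∑ i, (inner ℝ (a i) (x i) : ℝ) + ∑ j, (inner ℝ (b j) (y j) : ℝ) := by
    intro x y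
    rw [← ha, ← hb, ContinuousLinearMap.comp_apply, ContinuousLinearMap.comp_apply, ← map_add]
    simp
  have h1 : IsScalarLimit P Λ D (fun ω => ∑ i, (inner ℝ (a i) (X i ω) : ℝ)) :=
    IsScalarLimit.sum hΛ _ fun i => (hX i).isScalarLimit hΛ hD (hF i) (a i)
  have h2 : IsScalarLimit P Λ Dᶜ (fun ω => ∑ j, (inner ℝ (b j) (Y j ω) : ℝ)) :=
    IsScalarLimit.sum hΛ _ fun j => (hY j).isScalarLimit hΛ hD.compl
      (fun p hp => hH j p (by simpa using hp)) (b j)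
  have h3 := h1.integral_exp_add hΛ h2
  rw [charFunDual_apply, charFunDual_apply, charFunDual_apply,
    integral_map (hXm.prodMk hYm) (by fun_prop), integral_map hXm (by fun_prop),
    integral_map hYm (by fun_prop)]
  simp_rw [ha, hb, hL]
  exact h3

end Independence

/-! ### Moments of scalar integrals of simple functions -/

section SimpleMoments

variable {Ω S : Type*} [MeasurableSpace Ω] [MeasurableSpace S]
  {P : Measure Ω} {π : Measure S} [IsProbabilityMeasure P] [IsProbabilityMeasure π]
  {d : ℕ} {T : LevyTriplet d} {Λ : Set (S × ℝ) → Ω → E d}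

theorem IsLevyBasis.integral_exp_mul_sInt (hΛ : IsLevyBasis P π T Λ)
    {φ : SimpleFunc (S × ℝ) (E d)} (hφ : HasBddSupport φ) (h : ℝ) :
    ∫ ω, Complex.exp (((h * sInt Λ φ ω : ℝ) : ℂ) * Complex.I) ∂P
      = Complex.exp (∑ a ∈ φ.range, (π.prod volume).real (φ ⁻¹' {a}) • T.cumulant (h • a)) := by
  have hbd : HasBddSupport (φ.map fun a => h • a) := hφ.comp (g := fun a => h • a) (smul_zero h)
  have h1 : ∫ ω, Complex.exp (((h * sInt Λ φ ω : ℝ) : ℂ) * Complex.I) ∂P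
      = ∫ ω, Complex.exp ((sInt Λ (φ.map fun a => h • a) ω : ℂ) * Complex.I) ∂P := by
    refine integral_congr_ae ?_
    filter_upwards [hΛ.sInt_comb (χ := φ.map fun a => h • a) hφ hφ h 0 (fun p => by simp)] with ω hω
    rw [hω, zero_mul, add_zero]
  rw [h1, hΛ.integral_exp_sInt hbd]
  congr 1
  exact hφ.integral_map (g := fun a => T.cumulant (h • a)) (by rw [smul_zero, T.cumulant_zero])

/-- The logarithm of the characteristic function is a finite sum of cumulants, so its expansion at
zero is obtained term by term. -/
theorem IsLevyBasis.sInt_moments (hΛ : IsLevyBasis P π T Λ)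
    (h2 : ∫⁻ x in {x : E d | 1 < ‖x‖}, ‖x‖ₑ ^ 2 ∂T.nu < ⊤)
    {φ : SimpleFunc (S × ℝ) (E d)} (hφ : HasBddSupport φ) :
    MemLp (sInt Λ φ) 2 P ∧ ∫ ω, sInt Λ φ ω ∂P = ∫ p, inner ℝ (φ p) T.mean ∂(π.prod volume) ∧
      ∫ ω, sInt Λ φ ω ^ 2 ∂P = ∫ p, inner ℝ (φ p) (app T.sigL (φ p)) ∂(π.prod volume)
        + (∫ p, inner ℝ (φ p) T.mean ∂(π.prod volume)) ^ 2 := by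
  refine moments_of_charFun (hΛ.measurable_sInt hφ).aemeasurable
    (hΛ.integral_exp_mul_sInt hφ) ?_ ?_
  · have h3 : -(∫ p, inner ℝ (φ p) (app T.sigL (φ p)) ∂(π.prod volume)) / 2
        = ∑ a ∈ φ.range, (π.prod volume).real (φ ⁻¹' {a}) * (-(inner ℝ a (app T.sigL a)) / 2) := by
      rw [hφ.integral_map (g := fun a => (inner ℝ a (app T.sigL a) : ℝ)) (inner_zero_left _),
        ← Finset.sum_neg_distrib, Finset.sum_div]
      exact Finset.sum_congr rfl fun a _ => by rw [smul_eq_mul]; ring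
    rw [h3]
    refine (tendsto_finsetSum φ.range fun a _ => (T.tendsto_cumulant_re_div_sq h2 a).const_mul
      ((π.prod volume).real (φ ⁻¹' {a}))).congr fun h => ?_
    rw [Complex.re_sum, Finset.sum_div]
    exact Finset.sum_congr rfl fun a _ => by rw [Complex.smul_re, smul_eq_mul]; ring
  · rw [hφ.integral_map (g := fun a => (inner ℝ a T.mean : ℝ)) (inner_zero_left _)]
    refine (tendsto_finsetSum φ.range fun a _ => (T.tendsto_cumulant_im_div
      (T.integrableOn_norm_of_sq h2) a).const_mul
      ((π.prod volume).real (φ ⁻¹' {a}))).congr fun h => ?_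
    rw [Complex.im_sum, Finset.sum_div]
    exact Finset.sum_congr rfl fun a _ => by rw [Complex.smul_im, smul_eq_mul]; ring

/-- The intensity of the first absolute moment, `∫ |⟨a,x⟩| ν(dx) + |⟨a,γ₀⟩|`. -/
noncomputable def absIntensity (T : LevyTriplet d) (a : E d) : ℝ≥0∞ :=
  ∫⁻ x, ‖(inner ℝ a x : ℝ)‖ₑ ∂T.nu + ‖(inner ℝ a T.gam0 : ℝ)‖ₑ

/-- The constant of the bound for first absolute moments. -/
noncomputable def absConst : ℝ≥0∞ := 1 + minConst / cosConst

theorem absConst_ne_top : absConst ≠ ⊤ :=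
  ENNReal.add_ne_top.2 ⟨ENNReal.one_ne_top, ENNReal.div_ne_top minConst_ne_top cosConst_ne_zero⟩

/-- After subtraction of the drift `(π ⊗ λ)(B) ⟨a, γ₀⟩` the variable is driftless with jump
intensity `(π ⊗ λ)(B) ν`, to which `lintegral_enorm_le_of_charFun` applies. The drift itself is
added back by the triangle inequality. -/
theorem IsLevyBasis.lintegral_inner_le (hΛ : IsLevyBasis P π T Λ) (hs : T.sig = 0)
    (h1 : ∫⁻ x, ‖x‖ₑ ∂T.nu < ⊤) {B : Set (S × ℝ)} (hB : IsBddBorel B) (a : E d) :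
    ∫⁻ ω, ‖(inner ℝ a (Λ B ω) : ℝ)‖ₑ ∂P
      ≤ absConst * ((π.prod volume) B * absIntensity T a) := by
  set c : ℝ≥0∞ := (π.prod volume) B with hc
  have hct : c ≠ ⊤ := (measure_lt_top_of_isBddBorel hB).ne
  set s : ℝ := c.toReal with hsdef
  have hΛm := hΛ.measurable B hB
  have hYm : Measurable fun ω => (inner ℝ a (Λ B ω) : ℝ) - s * inner ℝ a T.gam0 :=
    (hΛm.const_inner).sub_const _
  have hintg : Integrable (fun x => (inner ℝ a x : ℝ)) (c • T.nu) :=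
    ((T.integrable_id h1).const_inner a).smul_measure hct
  have hchar : ∀ u : ℝ, ∫ ω, Complex.exp (((u * ((inner ℝ a (Λ B ω) : ℝ)
      - s * inner ℝ a T.gam0) : ℝ) : ℂ) * Complex.I) ∂P
      = Complex.exp (∫ x, (Complex.exp (((u * inner ℝ a x : ℝ) : ℂ) * Complex.I) - 1)
        ∂(c • T.nu)) := by
    intro u
    have h := hΛ.charFun_eq _ hB (u • a)
    rw [charFun_apply, integral_map hΛm.aemeasurable (by fun_prop),
      T.cumulant_eq_of_integrable hs h1] at h
    have e1 : ∀ ω, Complex.exp (((u * ((inner ℝ a (Λ B ω) : ℝ)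
        - s * inner ℝ a T.gam0) : ℝ) : ℂ) * Complex.I)
        = Complex.exp (-((u * (s * inner ℝ a T.gam0) : ℝ) : ℂ) * Complex.I)
          * Complex.exp (((inner ℝ (Λ B ω) (u • a) : ℝ) : ℂ) * Complex.I) := fun ω => by
      rw [← Complex.exp_add]
      congr 1
      rw [real_inner_smul_right, real_inner_comm]
      push_cast
      ring
    simp_rw [e1]
    rw [integral_const_mul, h, ← Complex.exp_add, integral_smul_measure]
    congr 1
    simp only [real_inner_smul_left, Complex.real_smul]
    push_cast
    ring
  have hmain := lintegral_enorm_le_of_charFun hYm.aemeasurable hintg hchar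
  rw [lintegral_smul_measure, smul_eq_mul] at hmain
  have hcs : ENNReal.ofReal s = c := ENNReal.ofReal_toReal hct
  calc ∫⁻ ω, ‖(inner ℝ a (Λ B ω) : ℝ)‖ₑ ∂P
      ≤ ∫⁻ ω, (‖(inner ℝ a (Λ B ω) : ℝ) - s * inner ℝ a T.gam0‖ₑ
          + ‖s * (inner ℝ a T.gam0 : ℝ)‖ₑ) ∂P := by
        refine lintegral_mono fun ω => ?_
        calc ‖(inner ℝ a (Λ B ω) : ℝ)‖ₑ = ‖((inner ℝ a (Λ B ω) : ℝ) - s * inner ℝ a T.gam0)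
              + s * inner ℝ a T.gam0‖ₑ := by rw [sub_add_cancel]
          _ ≤ _ := enorm_add_le _ _
    _ = ∫⁻ ω, ‖(inner ℝ a (Λ B ω) : ℝ) - s * inner ℝ a T.gam0‖ₑ ∂P
          + c * ‖(inner ℝ a T.gam0 : ℝ)‖ₑ := by
        rw [lintegral_add_left hYm.enorm, lintegral_const, measure_univ, mul_one, enorm_mul,
          Real.enorm_of_nonneg ENNReal.toReal_nonneg, hcs]
    _ ≤ absConst * (c * ∫⁻ x, ‖(inner ℝ a x : ℝ)‖ₑ ∂T.nu)
          + absConst * (c * ‖(inner ℝ a T.gam0 : ℝ)‖ₑ) := by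
        refine add_le_add hmain ?_
        rw [absConst, add_mul, one_mul]
        exact le_self_add
    _ = _ := by
        rw [absIntensity]
        ring

theorem IsLevyBasis.lintegral_sInt_le (hΛ : IsLevyBasis P π T Λ) (hs : T.sig = 0)
    (h1 : ∫⁻ x, ‖x‖ₑ ∂T.nu < ⊤) {φ : SimpleFunc (S × ℝ) (E d)} (hφ : HasBddSupport φ) :
    ∫⁻ ω, ‖sInt Λ φ ω‖ₑ ∂P
      ≤ absConst * ∫⁻ p, absIntensity T (φ p) ∂(π.prod volume) := by
  have h3 : ∫⁻ p, absIntensity T (φ p) ∂(π.prod volume)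
      = ∑ a ∈ φ.range, absIntensity T a * (π.prod volume) (φ ⁻¹' {a}) := by
    rw [← SimpleFunc.map_lintegral, ← SimpleFunc.lintegral_eq_lintegral]
    rfl
  rw [h3, Finset.mul_sum]
  simp_rw [sInt_eq_sum_filter]
  have hm : ∀ a ∈ φ.range.filter (· ≠ 0), Measurable fun ω => ‖(inner ℝ a (Λ (φ ⁻¹' {a}) ω) : ℝ)‖ₑ :=
    fun a ha => ((hΛ.measurable _ (hφ.isBddBorel (Finset.mem_filter.1 ha).2)).const_inner).enorm
  calc _ ≤ ∫⁻ ω, ∑ a ∈ φ.range.filter (· ≠ 0), ‖(inner ℝ a (Λ (φ ⁻¹' {a}) ω) : ℝ)‖ₑ ∂P :=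
        lintegral_mono fun ω => enorm_sum_le _ _
    _ = ∑ a ∈ φ.range.filter (· ≠ 0), ∫⁻ ω, ‖(inner ℝ a (Λ (φ ⁻¹' {a}) ω) : ℝ)‖ₑ ∂P :=
        lintegral_finsetSum' _ fun a ha => (hm a ha).aemeasurable
    _ ≤ ∑ a ∈ φ.range.filter (· ≠ 0),
          absConst * (absIntensity T a * (π.prod volume) (φ ⁻¹' {a})) := by
        refine Finset.sum_le_sum fun a ha => ?_
        rw [mul_comm (absIntensity T a)]
        exact hΛ.lintegral_inner_le hs h1 (hφ.isBddBorel (Finset.mem_filter.1 ha).2) a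
    _ ≤ _ := Finset.sum_le_sum_of_subset (Finset.filter_subset _ _)

theorem absIntensity_le (a : E d) :
    absIntensity T a ≤ ‖a‖ₑ * (∫⁻ x, ‖x‖ₑ ∂T.nu + ‖T.gam0‖ₑ) := by
  have h : ∀ x : E d, ‖(inner ℝ a x : ℝ)‖ₑ ≤ ‖a‖ₑ * ‖x‖ₑ := fun x => by
    rw [← ofReal_norm, ← ofReal_norm a, ← ofReal_norm x, ← ENNReal.ofReal_mul (norm_nonneg a)]
    exact ENNReal.ofReal_le_ofReal (norm_inner_le_norm a x)
  rw [absIntensity, mul_add, ← lintegral_const_mul _ (by fun_prop)]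
  exact add_le_add (lintegral_mono h) (h _)

/-- Scalar integrals of simple functions are bounded in `Lᵖ` by the `Lᵖ`-norm of the integrand and
the `L¹`-norm of its pairing with `w`. -/
def IsLpBounded (P : Measure Ω) (π : Measure S) (Λ : Set (S × ℝ) → Ω → E d) (p : ℝ≥0∞) (w : E d) :
    Prop :=
  ∃ C : ℝ≥0∞, C ≠ ⊤ ∧ ∀ φ : SimpleFunc (S × ℝ) (E d), HasBddSupport φ →
    eLpNorm (sInt Λ φ) p P ≤ C * (eLpNorm φ p (π.prod volume)
      + eLpNorm (fun q => (inner ℝ (φ q) w : ℝ)) 1 (π.prod volume))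

/-- The intensity, drift included, is already bounded by the `L¹` norm of the integrand, so `w = 0`
suffices. -/
theorem IsLevyBasis.isLpBounded_one (hΛ : IsLevyBasis P π T Λ) (hs : T.sig = 0)
    (h1 : ∫⁻ x, ‖x‖ₑ ∂T.nu < ⊤) : IsLpBounded P π Λ 1 0 := by
  refine ⟨absConst * (∫⁻ x, ‖x‖ₑ ∂T.nu + ‖T.gam0‖ₑ), ENNReal.mul_ne_top absConst_ne_top
    (ENNReal.add_ne_top.2 ⟨h1.ne, enorm_ne_top⟩), fun φ hφ => ?_⟩
  rw [eLpNorm_one_eq_lintegral_enorm]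
  refine (hΛ.lintegral_sInt_le hs h1 hφ).trans ?_
  rw [mul_assoc]
  gcongr
  calc _ ≤ ∫⁻ q, (∫⁻ x, ‖x‖ₑ ∂T.nu + ‖T.gam0‖ₑ) * ‖φ q‖ₑ ∂(π.prod volume) :=
        lintegral_mono fun q => (absIntensity_le _).trans_eq (mul_comm _ _)
    _ = (∫⁻ x, ‖x‖ₑ ∂T.nu + ‖T.gam0‖ₑ) * eLpNorm φ 1 (π.prod volume) := by
        rw [lintegral_const_mul _ φ.measurable.enorm, eLpNorm_one_eq_lintegral_enorm]
    _ ≤ _ := by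
        gcongr
        exact le_self_add

theorem eLpNorm_two_sq_eq {α : Type*} [MeasurableSpace α] {μ : Measure α} {V : Type*}
    [NormedAddCommGroup V] {f : α → V} (hf : MemLp f 2 μ) :
    eLpNorm f 2 μ ^ 2 = ENNReal.ofReal (∫ x, ‖f x‖ ^ 2 ∂μ) := by
  rw [hf.eLpNorm_eq_integral_rpow_norm two_ne_zero ENNReal.ofNat_ne_top,
    ← ENNReal.ofReal_pow (by positivity)]
  congr 1
  simp only [ENNReal.toReal_ofNat, Real.rpow_two]
  rw [← Real.rpow_natCast, ← Real.rpow_mul (by positivity)]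
  norm_num

/-- The second moment is a quadratic form, bounded by the `L²` norm, plus the square of the mean. On
an infinite measure space the mean is not controlled by the `L²` norm, which is why the `L¹` norm of
the pairing with `T.mean` appears. -/
theorem IsLevyBasis.isLpBounded_two (hΛ : IsLevyBasis P π T Λ)
    (h2 : ∫⁻ x in {x : E d | 1 < ‖x‖}, ‖x‖ₑ ^ 2 ∂T.nu < ⊤) : IsLpBounded P π Λ 2 T.mean := by
  refine ⟨ENNReal.ofReal (‖T.sigL‖ + 1), ENNReal.ofReal_ne_top, fun φ hφ => ?_⟩
  obtain ⟨hm, hmean, hsq⟩ := hΛ.sInt_moments h2 hφ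
  -- The summand `1` ensures `K ≥ 1`, so that `K a² + b² ≤ K² (a + b)²` and the square root can be
  -- taken.
  set K := ‖T.sigL‖ + 1 with hK
  have hK1 : 1 ≤ K := by simp [hK]
  have hφ2 : MemLp φ 2 (π.prod volume) := by
    rw [SimpleFunc.memLp_iff_integrable two_ne_zero ENNReal.ofNat_ne_top]
    exact hφ.integrable
  have hq : Integrable (fun q => ‖φ q‖ ^ 2) (π.prod volume) := hφ2.integrable_norm_pow two_ne_zero
  have hi : Integrable (fun q => (inner ℝ (φ q) T.mean : ℝ)) (π.prod volume) :=
    hφ.integrable_map (g := fun a => (inner ℝ a T.mean : ℝ)) (inner_zero_left _)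
  set a := eLpNorm φ 2 (π.prod volume) with ha
  set b := eLpNorm (fun q => (inner ℝ (φ q) T.mean : ℝ)) 1 (π.prod volume) with hb
  have hb' : ENNReal.ofReal ((∫ q, inner ℝ (φ q) T.mean ∂(π.prod volume)) ^ 2) ≤ b ^ 2 := by
    rw [← sq_abs, ENNReal.ofReal_pow (abs_nonneg _)]
    gcongr
    rw [← Real.enorm_eq_ofReal_abs, hb, eLpNorm_one_eq_lintegral_enorm]
    exact enorm_integral_le_lintegral_enorm _
  have hle : eLpNorm (sInt Λ φ) 2 P ^ 2 ≤ (ENNReal.ofReal K * (a + b)) ^ 2 := by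
    rw [eLpNorm_two_sq_eq hm]
    simp only [Real.norm_eq_abs, sq_abs]
    rw [hsq]
    have hquad : ∫ q, inner ℝ (φ q) (app T.sigL (φ q)) ∂(π.prod volume)
        ≤ K * ∫ q, ‖φ q‖ ^ 2 ∂(π.prod volume) := by
      rw [← integral_const_mul]
      refine integral_mono (hφ.integrable_map (g := fun a => (inner ℝ a (app T.sigL a) : ℝ))
        (inner_zero_left _)) (hq.const_mul _) fun q => ?_
      refine (real_inner_le_norm _ _).trans ?_
      have := norm_app_le T.sigL (φ q)
      nlinarith [norm_nonneg (φ q)]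
    calc _ ≤ ENNReal.ofReal (K * ∫ q, ‖φ q‖ ^ 2 ∂(π.prod volume)
            + (∫ q, inner ℝ (φ q) T.mean ∂(π.prod volume)) ^ 2) :=
          ENNReal.ofReal_le_ofReal (by linarith)
      _ ≤ ENNReal.ofReal K * a ^ 2 + b ^ 2 := by
          refine ENNReal.ofReal_add_le.trans (add_le_add ?_ hb')
          rw [ENNReal.ofReal_mul (by linarith), ha, eLpNorm_two_sq_eq hφ2]
      _ ≤ ENNReal.ofReal K ^ 2 * (a ^ 2 + b ^ 2) := by
          have h1K : 1 ≤ ENNReal.ofReal K := by simpa using hK1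
          rw [mul_add]
          gcongr
          · exact le_self_pow h1K two_ne_zero
          · exact le_mul_of_one_le_left' (one_le_pow₀ h1K)
      _ ≤ _ := by
          rw [mul_pow]
          gcongr
          rw [add_sq]
          gcongr
          exact le_self_add
  exact (ENNReal.pow_right_strictMono two_ne_zero).le_iff_le.1 hle

end SimpleMoments

/-! ### Existence of integrals -/

section Existence

theorem norm_app_transpose_le {n d : ℕ} (M : Matrix (Fin n) (Fin d) ℝ) (u : E n) :
    ‖app Mᵀ u‖ ≤ ‖M‖ * ‖u‖ := by
  have h : ‖Mᵀ‖ = ‖M‖ := by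
    rw [← Matrix.conjTranspose_eq_transpose_of_trivial, Matrix.l2_opNorm_conjTranspose]
  rw [← h]
  exact norm_app_le _ _

theorem tendsto_eLpNorm_indicator_compl {α V : Type*} [MeasurableSpace α] [NormedAddCommGroup V]
    {μ : Measure α} {p : ℝ≥0∞} (hp0 : p ≠ 0) (hpt : p ≠ ⊤) {G : α → V} (hG : MemLp G p μ)
    {D : ℕ → Set α} (hDm : ∀ N, MeasurableSet (D N)) (hD : ∀ q, ∀ᶠ N in atTop, q ∈ D N) :
    Tendsto (fun N => eLpNorm ((D N)ᶜ.indicator G) p μ) atTop (𝓝 0) := by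
  have hpr : 0 < p.toReal := ENNReal.toReal_pos hp0 hpt
  have h1 : Tendsto (fun N => ∫⁻ q, ‖(D N)ᶜ.indicator G q‖ₑ ^ p.toReal ∂μ) atTop
      (𝓝 (∫⁻ _, 0 ∂μ)) := by
    refine tendsto_lintegral_of_dominated_convergence' (fun q => ‖G q‖ₑ ^ p.toReal)
      (fun N => ((hG.1.indicator (hDm N).compl).enorm.pow_const _))
      (fun N => Eventually.of_forall fun q => ?_)
      (lintegral_rpow_enorm_lt_top_of_eLpNorm_lt_top hp0 hpt hG.2).ne
      (Eventually.of_forall fun q => ?_)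
    · simp only
      gcongr
      exact enorm_indicator_le_enorm_self _ _
    · refine tendsto_const_nhds.congr' ?_
      filter_upwards [hD q] with N hN
      rw [Set.indicator_of_notMem (by simpa using hN), enorm_zero, ENNReal.zero_rpow_of_pos hpr]
  rw [lintegral_zero] at h1
  have h2 := ((ENNReal.continuous_rpow_const (y := 1 / p.toReal)).tendsto 0).comp h1
  rw [ENNReal.zero_rpow_of_pos (by positivity)] at h2
  exact h2.congr fun N => (eLpNorm_eq_lintegral_rpow_enorm_toReal hp0 hpt).symm

theorem tendsto_integral_inner {α V : Type*} [MeasurableSpace α] [NormedAddCommGroup V]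
    [InnerProductSpace ℝ V] {μ : Measure α} {f g : ℕ → α → V} {f' g' : α → V}
    (hf : ∀ k, MemLp (f k) 2 μ) (hf' : MemLp f' 2 μ) (hg : ∀ k, MemLp (g k) 2 μ)
    (hg' : MemLp g' 2 μ) (hff : Tendsto (fun k => eLpNorm (f k - f') 2 μ) atTop (𝓝 0))
    (hgg : Tendsto (fun k => eLpNorm (g k - g') 2 μ) atTop (𝓝 0)) :
    Tendsto (fun k => ∫ x, (inner ℝ (f k x) (g k x) : ℝ) ∂μ) atTop
      (𝓝 (∫ x, (inner ℝ (f' x) (g' x) : ℝ) ∂μ)) := by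
  have key : ∀ {a b : α → V} (ha : MemLp a 2 μ) (hb : MemLp b 2 μ),
      (inner ℝ (ha.toLp a) (hb.toLp b) : ℝ) = ∫ x, (inner ℝ (a x) (b x) : ℝ) ∂μ := by
    intro a b ha hb
    rw [L2.inner_def]
    refine integral_congr_ae ?_
    filter_upwards [ha.coeFn_toLp, hb.coeFn_toLp] with x h1 h2
    rw [h1, h2]
  have h1 := (Lp.tendsto_Lp_iff_tendsto_eLpNorm'' f hf f' hf').2 hff
  have h2 := (Lp.tendsto_Lp_iff_tendsto_eLpNorm'' g hg g' hg').2 hgg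
  have h3 := h1.inner h2 (𝕜 := ℝ)
  simp_rw [key] at h3
  exact h3

theorem tendsto_integral_of_tendsto_eLpNorm_one {α V : Type*} [MeasurableSpace α]
    [NormedAddCommGroup V] [NormedSpace ℝ V] {μ : Measure α} {f : ℕ → α → V} {f' : α → V}
    (hf : ∀ k, Integrable (f k) μ) (hf' : Integrable f' μ)
    (hff : Tendsto (fun k => eLpNorm (f k - f') 1 μ) atTop (𝓝 0)) :
    Tendsto (fun k => ∫ x, f k x ∂μ) atTop (𝓝 (∫ x, f' x ∂μ)) :=
  tendsto_integral_of_L1' f' hf'.1 (Eventually.of_forall hf) hff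

variable {Ω S : Type*} [MeasurableSpace Ω] [MeasurableSpace S]
  {P : Measure Ω} {π : Measure S} [IsProbabilityMeasure π]
  {n d : ℕ} {T : LevyTriplet d} {Λ : Set (S × ℝ) → Ω → E d}

theorem HasBddSupport.memLp {V : Type*} [NormedAddCommGroup V] {φ : SimpleFunc (S × ℝ) V}
    (hφ : HasBddSupport φ) {p : ℝ≥0∞} (hp0 : p ≠ 0) (hpt : p ≠ ⊤) : MemLp φ p (π.prod volume) := by
  rw [SimpleFunc.memLp_iff_integrable hp0 hpt]
  exact hφ.integrable

/-- Two norms are approximated at once: cut off in time so that both tails are small, then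
approximate in `Lᵖ` on the remaining strip. The strip has finite measure, so by Hölder the `Lᵖ`
error also controls the `L¹` error of the pairing with `w`. -/
theorem exists_simpleFunc_approx {p : ℝ≥0∞} (hp1 : 1 ≤ p) (hpt : p ≠ ⊤) {w : E d}
    {F : S × ℝ → Matrix (Fin n) (Fin d) ℝ} (hF : MemLp F p (π.prod volume))
    (hw : Integrable (fun q => app (F q) w) (π.prod volume)) {ε : ℝ≥0∞} (hε : ε ≠ 0) :
    ∃ g : SimpleFunc (S × ℝ) (Matrix (Fin n) (Fin d) ℝ), HasBddSupport g ∧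
      eLpNorm (F - ⇑g) p (π.prod volume) ≤ ε ∧
      eLpNorm (fun q => app (F q - g q) w) 1 (π.prod volume) ≤ ε := by
  have hp0 : p ≠ 0 := (zero_lt_one.trans_le hp1).ne'
  set m := π.prod (volume : Measure ℝ) with hm
  let D : ℕ → Set (S × ℝ) := fun N => {q | |q.2| ≤ N}
  have hDm : ∀ N, MeasurableSet (D N) := fun N =>
    measurableSet_le (measurable_snd.abs) measurable_const
  have hD : ∀ q, ∀ᶠ N in atTop, q ∈ D N := fun q => by
    obtain ⟨N, hN⟩ := exists_nat_ge |q.2|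
    filter_upwards [eventually_ge_atTop N] with M hM
    exact hN.trans (by exact_mod_cast hM)
  have hε2 : (0 : ℝ≥0∞) < ε / 2 := ENNReal.div_pos hε ENNReal.ofNat_ne_top
  have h1 := tendsto_eLpNorm_indicator_compl hp0 hpt hF hDm hD
  have h2 := tendsto_eLpNorm_indicator_compl one_ne_zero ENNReal.one_ne_top
    (memLp_one_iff_integrable.2 hw) hDm hD
  obtain ⟨N, hN1, hN2⟩ := ((h1.eventually_lt_const hε2).and (h2.eventually_lt_const hε2)).exists
  have hbd : IsBddBorel (D N) := ⟨hDm N, N, fun q hq => hq⟩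
  have hmN : m (D N) ≠ ⊤ := (measure_lt_top_of_isBddBorel hbd).ne
  set r : ℝ := 1 / (1 : ℝ≥0∞).toReal - 1 / p.toReal with hr
  have hr0 : 0 ≤ r := by
    have h3 : 1 ≤ p.toReal := by
      rw [← ENNReal.toReal_one]
      exact ENNReal.toReal_mono hpt hp1
    rw [hr, ENNReal.toReal_one, div_one, sub_nonneg, one_div]
    exact inv_le_one_of_one_le₀ h3
  -- The summand `1` serves the `Lᵖ` error, and `‖w‖ m(D N)^r` is the Hölder cost of passing to
  -- `L¹`.
  set K : ℝ≥0∞ := 1 + ‖w‖ₑ * m (D N) ^ r with hK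
  have hKt : K ≠ ⊤ := ENNReal.add_ne_top.2 ⟨ENNReal.one_ne_top,
    ENNReal.mul_ne_top enorm_ne_top (ENNReal.rpow_ne_top_of_nonneg hr0 hmN)⟩
  have hK0 : K ≠ 0 := by
    rw [hK]
    exact (lt_of_lt_of_le zero_lt_one le_self_add).ne'
  obtain ⟨g₀, hg₀, hg₀m⟩ := hF.exists_simpleFunc_eLpNorm_sub_lt hpt
    (ε := ε / 2 / K) (ENNReal.div_pos hε2.ne' hKt).ne'
  have hδ : K * eLpNorm (F - ⇑g₀) p m ≤ ε / 2 := by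
    calc _ ≤ K * (ε / 2 / K) := by gcongr
      _ = ε / 2 := ENNReal.mul_div_cancel hK0 hKt
  set g := g₀.restrict (D N) with hg
  have hgq : ∀ q, F q - g q = (D N)ᶜ.indicator F q + (D N).indicator (F - ⇑g₀) q := fun q => by
    rw [hg, SimpleFunc.restrict_apply _ (hDm N)]
    by_cases hq : q ∈ D N <;> simp [hq]
  refine ⟨g, ⟨N, fun q hq => ?_⟩, ?_, ?_⟩
  · rw [hg, SimpleFunc.restrict_apply _ (hDm N), Set.indicator_of_notMem]
    exact not_le.2 hq
  · have e : F - ⇑g = (D N)ᶜ.indicator F + (D N).indicator (F - ⇑g₀) := funext hgq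
    rw [e]
    refine (eLpNorm_add_le (hF.1.indicator (hDm N).compl)
      ((hF.1.sub hg₀m.1).indicator (hDm N)) hp1).trans ?_
    calc _ ≤ ε / 2 + ε / 2 := by
          refine add_le_add hN1.le ((eLpNorm_indicator_le _).trans (le_trans ?_ hδ))
          rw [hK, add_mul, one_mul]
          exact le_self_add
      _ = ε := ENNReal.add_halves ε
  · have e : (fun q => app (F q - g q) w)
        = (D N)ᶜ.indicator (fun q => app (F q) w)
          + (D N).indicator (fun q => app (F q - g₀ q) w) := by
      ext1 q
      rw [hgq, app_add_left, Pi.add_apply]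
      by_cases hq : q ∈ D N <;> simp [hq, app_zero_left]
    have hmeas : AEStronglyMeasurable (fun q => app (F q - g₀ q) w) m :=
      (continuous_app_left w).comp_aestronglyMeasurable (hF.1.sub hg₀m.1)
    rw [e]
    refine (eLpNorm_add_le (hw.1.indicator (hDm N).compl)
      (hmeas.indicator (hDm N)) le_rfl).trans ?_
    calc _ ≤ ε / 2 + ε / 2 := by
          refine add_le_add hN2.le (le_trans ?_ hδ)
          rw [eLpNorm_indicator_eq_eLpNorm_restrict (hDm N)]
          calc _ ≤ eLpNorm (‖w‖ • (F - ⇑g₀)) 1 (m.restrict (D N)) := by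
                refine eLpNorm_mono fun q => ?_
                rw [Pi.smul_apply, norm_smul, norm_norm, mul_comm]
                exact norm_app_le _ _
            _ = ‖w‖ₑ * eLpNorm (F - ⇑g₀) 1 (m.restrict (D N)) := by
                rw [eLpNorm_const_smul, enorm_norm]
            _ ≤ ‖w‖ₑ * (eLpNorm (F - ⇑g₀) p (m.restrict (D N)) * m (D N) ^ r) := by
                gcongr
                have := eLpNorm_le_eLpNorm_mul_rpow_measure_univ hp1
                  ((hF.1.sub hg₀m.1 : AEStronglyMeasurable (F - ⇑g₀) m).restrict (s := D N))
                rwa [Measure.restrict_apply_univ] at this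
            _ ≤ ‖w‖ₑ * (eLpNorm (F - ⇑g₀) p m * m (D N) ^ r) := by
                gcongr
                exact Measure.restrict_le_self
            _ ≤ K * eLpNorm (F - ⇑g₀) p m := by
                rw [hK, add_mul, one_mul]
                refine le_trans (le_of_eq ?_) le_add_self
                ring
      _ = ε := ENNReal.add_halves ε

theorem exists_simpleFunc_seq {p : ℝ≥0∞} (hp1 : 1 ≤ p) (hpt : p ≠ ⊤) {w : E d}
    {F : S × ℝ → Matrix (Fin n) (Fin d) ℝ} (hF : MemLp F p (π.prod volume))
    (hw : Integrable (fun q => app (F q) w) (π.prod volume)) :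
    ∃ g : ℕ → SimpleFunc (S × ℝ) (Matrix (Fin n) (Fin d) ℝ), (∀ k, HasBddSupport (g k)) ∧
      (∀ᵐ q ∂(π.prod volume), Tendsto (fun k => g k q) atTop (𝓝 (F q))) ∧
      (∀ k, eLpNorm (F - ⇑(g k)) p (π.prod volume) ≤ 2⁻¹ ^ k) ∧
      ∀ k, eLpNorm (fun q => app (F q - g k q) w) 1 (π.prod volume) ≤ 2⁻¹ ^ k := by
  have hp0 : p ≠ 0 := (zero_lt_one.trans_le hp1).ne'
  have h2 : ∀ k : ℕ, (2⁻¹ : ℝ≥0∞) ^ k ≠ 0 := fun k =>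
    pow_ne_zero _ (ENNReal.inv_ne_zero.2 ENNReal.ofNat_ne_top)
  choose g hg1 hg2 hg3 using fun k : ℕ => exists_simpleFunc_approx hp1 hpt hF hw (h2 k)
  have hlim : Tendsto (fun k => eLpNorm (fun q => g k q - F q) p (π.prod volume)) atTop (𝓝 0) := by
    refine tendsto_of_tendsto_of_tendsto_of_le_of_le tendsto_const_nhds
      (ENNReal.tendsto_pow_atTop_nhds_zero_of_lt_one (r := 2⁻¹) (by norm_num)) (fun _ => zero_le) fun k => ?_
    refine le_trans (le_of_eq ?_) (hg2 k)
    exact eLpNorm_sub_comm _ _ _ _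
  -- Convergence almost everywhere requires a subsequence; the rate survives because `k ≤ ns k`.
  obtain ⟨ns, hns, hns'⟩ := (tendstoInMeasure_of_tendsto_eLpNorm hp0
    (fun k => ((hg1 k).memLp hp0 hpt).1) hF.1 hlim).exists_seq_tendsto_ae
  have hle : ∀ k, (2⁻¹ : ℝ≥0∞) ^ ns k ≤ 2⁻¹ ^ k := fun k =>
    pow_le_pow_of_le_one (zero_le) (by norm_num) (hns.id_le k)
  exact ⟨fun k => g (ns k), fun k => hg1 _, hns', fun k => (hg2 _).trans (hle k),
    fun k => (hg3 _).trans (hle k)⟩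

theorem IsLevyBasis.simpleIntegral_sub (hΛ : IsLevyBasis P π T Λ)
    {g h : SimpleFunc (S × ℝ) (Matrix (Fin n) (Fin d) ℝ)} (hg : HasBddSupport g)
    (hh : HasBddSupport h) {A : Set (S × ℝ)} (hA : MeasurableSet A) [IsFiniteMeasure P] :
    simpleIntegral Λ (g - h) A =ᵐ[P] simpleIntegral Λ g A - simpleIntegral Λ h A := by
  have hgh : HasBddSupport (g - h : SimpleFunc (S × ℝ) (Matrix (Fin n) (Fin d) ℝ)) :=
    hg.comp₂ hh (g := fun a b => a - b) (sub_zero 0)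
  have := hΛ.simpleIntegral_add hgh hh hA
  rw [sub_add_cancel] at this
  filter_upwards [this] with ω hω
  rw [Pi.sub_apply, hω, add_sub_cancel_right]

theorem IsLpBounded.eLpNorm_simpleIntegral_le [IsFiniteMeasure P] (hΛ : IsLevyBasis P π T Λ)
    {p : ℝ≥0∞} (hp1 : 1 ≤ p)
    {w : E d} (hb : IsLpBounded P π Λ p w) : ∃ C : ℝ≥0∞, C ≠ ⊤ ∧
      ∀ (g : SimpleFunc (S × ℝ) (Matrix (Fin n) (Fin d) ℝ)) (A : Set (S × ℝ)), HasBddSupport g →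
        MeasurableSet A → eLpNorm (simpleIntegral Λ g A) p P ≤ C * (eLpNorm g p (π.prod volume)
          + eLpNorm (fun q => app (g q) w) 1 (π.prod volume)) := by
  obtain ⟨C, hC, hCb⟩ := hb
  refine ⟨n * C, ENNReal.mul_ne_top (ENNReal.natCast_ne_top n) hC, fun g A hg hA => ?_⟩
  let e : Fin n → E n := fun i => EuclideanSpace.single i 1
  have he : ∀ i, ‖e i‖ = 1 := fun i => by simp [e]
  have hm := hΛ.measurable_simpleIntegral hg hA
  have hcoord : ∀ i, eLpNorm (fun ω => simpleIntegral Λ g A ω i) p P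
      ≤ C * (eLpNorm g p (π.prod volume) + eLpNorm (fun q => app (g q) w) 1 (π.prod volume)) := by
    intro i
    have h1 : (fun ω => simpleIntegral Λ g A ω i) =ᵐ[P] sInt Λ (rowSimple g A (e i)) := by
      filter_upwards [hΛ.inner_simpleIntegral hg hA (e i)] with ω hω
      rw [← hω]
      simp [e, EuclideanSpace.inner_single_left]
    rw [eLpNorm_congr_ae h1]
    refine (hCb _ (hg.rowSimple hA (e i))).trans ?_
    refine mul_le_mul_right (add_le_add (eLpNorm_mono fun q => ?_) (eLpNorm_mono fun q => ?_)) C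
    · rw [rowSimple_apply g hA]
      refine (norm_indicator_le_norm_self _ _).trans ?_
      have := norm_app_transpose_le (g q) (e i)
      rwa [he, mul_one] at this
    · rw [rowSimple_apply g hA]
      by_cases hq : q ∈ A
      · rw [Set.indicator_of_mem hq, inner_app_transpose]
        have := norm_inner_le_norm (𝕜 := ℝ) (e i) (app (g q) w)
        rwa [he, one_mul] at this
      · rw [Set.indicator_of_notMem hq, inner_zero_left, norm_zero]
        exact norm_nonneg _
  have hnorm : ∀ ω, ‖simpleIntegral Λ g A ω‖ ≤ ‖∑ i, ‖simpleIntegral Λ g A ω i‖‖ := fun ω => by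
    rw [Real.norm_of_nonneg (Finset.sum_nonneg fun i _ => norm_nonneg _), EuclideanSpace.norm_eq]
    refine Real.sqrt_le_iff.2 ⟨Finset.sum_nonneg fun i _ => norm_nonneg _, ?_⟩
    exact Finset.sum_sq_le_sq_sum_of_nonneg fun i _ => norm_nonneg _
  calc _ ≤ eLpNorm (fun ω => ∑ i, ‖simpleIntegral Λ g A ω i‖) p P := eLpNorm_mono hnorm
    _ ≤ ∑ i, eLpNorm (fun ω => ‖simpleIntegral Λ g A ω i‖) p P := by
        have : (fun ω => ∑ i, ‖simpleIntegral Λ g A ω i‖)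
            = ∑ i, fun ω => ‖simpleIntegral Λ g A ω i‖ := by
          ext ω
          simp
        rw [this]
        refine eLpNorm_sum_le (fun i _ => ?_) hp1
        exact (Measurable.norm (by fun_prop)).aestronglyMeasurable
    _ ≤ ∑ _i : Fin n, C * (eLpNorm g p (π.prod volume)
          + eLpNorm (fun q => app (g q) w) 1 (π.prod volume)) :=
        Finset.sum_le_sum fun i _ => by rw [eLpNorm_norm]; exact hcoord i
    _ = _ := by
        rw [Finset.sum_const, Finset.card_univ, Fintype.card_fin, nsmul_eq_mul, mul_assoc]

/-- The `Lᵖ` bound makes the integrals over each Borel set Cauchy, so completeness of `Lᵖ` gives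
limits for all sets from a single sequence. That sequence is returned as well, since moments are
computed by passing to the limit along it. -/
theorem exists_isLevyIntegral [IsProbabilityMeasure P] (hΛ : IsLevyBasis P π T Λ) {p : ℝ≥0∞}
    (hp1 : 1 ≤ p) (hpt : p ≠ ⊤) {w : E d} (hb : IsLpBounded P π Λ p w)
    {F : S × ℝ → Matrix (Fin n) (Fin d) ℝ} (hF : MemLp F p (π.prod volume))
    (hw : Integrable (fun q => app (F q) w) (π.prod volume)) :
    ∃ (Y : Ω → E n) (g : ℕ → SimpleFunc (S × ℝ) (Matrix (Fin n) (Fin d) ℝ)),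
      IsLevyIntegral P π Λ F Y ∧ MemLp Y p P ∧ (∀ k, HasBddSupport (g k)) ∧
      (∀ k, MemLp (simpleIntegral Λ (g k) Set.univ) p P) ∧
      Tendsto (fun k => eLpNorm (simpleIntegral Λ (g k) Set.univ - Y) p P) atTop (𝓝 0) ∧
      Tendsto (fun k => eLpNorm (⇑(g k) - F) p (π.prod volume)) atTop (𝓝 0) ∧
      Tendsto (fun k => eLpNorm (fun q => app (g k q - F q) w) 1 (π.prod volume)) atTop (𝓝 0) := by
  have hp0 : p ≠ 0 := (zero_lt_one.trans_le hp1).ne'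
  obtain ⟨g, hg, hgF, hg1, hg2⟩ := exists_simpleFunc_seq hp1 hpt hF hw
  obtain ⟨C, hC, hCb⟩ := hb.eLpNorm_simpleIntegral_le (n := n) hΛ hp1
  have happ : ∀ k, MemLp (fun q => app (g k q) w) 1 (π.prod volume) := fun k =>
    memLp_one_iff_integrable.2 ((hg k).integrable_map (g := fun M => app M w) (app_zero_left w))
  have hmem : ∀ k A, MeasurableSet A → MemLp (simpleIntegral Λ (g k) A) p P := fun k A hA =>
    ⟨(hΛ.measurable_simpleIntegral (hg k) hA).aestronglyMeasurable,
      (hCb _ A (hg k) hA).trans_lt (ENNReal.mul_lt_top hC.lt_top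
        (ENNReal.add_lt_top.2 ⟨((hg k).memLp hp0 hpt).2, (happ k).2⟩))⟩
  have hpow : ∀ {N k : ℕ}, N ≤ k → (2⁻¹ : ℝ≥0∞) ^ k ≤ 2⁻¹ ^ N := fun h =>
    pow_le_pow_of_le_one (zero_le) (by norm_num) h
  -- Two differences in each of two norms give four errors `2⁻ᴺ`; the extra `1` makes the inequality
  -- strict.
  have hcau : ∀ A, MeasurableSet A → ∀ N k l : ℕ, N ≤ k → N ≤ l →
      eLpNorm (simpleIntegral Λ (g k) A - simpleIntegral Λ (g l) A) p P
        < (C * 4 + 1) * 2⁻¹ ^ N := by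
    intro A hA N k l hk hl
    have hbd : HasBddSupport (g k - g l : SimpleFunc (S × ℝ) (Matrix (Fin n) (Fin d) ℝ)) :=
      (hg k).comp₂ (hg l) (g := fun a b => a - b) (sub_zero 0)
    rw [← eLpNorm_congr_ae (hΛ.simpleIntegral_sub (hg k) (hg l) hA)]
    have hgm := fun k => ((hg k).memLp (π := π) hp0 hpt).1
    have h1 : eLpNorm (g k - g l : SimpleFunc (S × ℝ) (Matrix (Fin n) (Fin d) ℝ)) p (π.prod volume)
        ≤ 2⁻¹ ^ N + 2⁻¹ ^ N := by
      have e : ⇑(g k - g l) = (F - ⇑(g l)) - (F - ⇑(g k)) := by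
        ext1 q
        simp
      rw [e]
      exact (eLpNorm_sub_le (hF.1.sub (hgm l)) (hF.1.sub (hgm k)) hp1).trans
        (add_le_add ((hg1 l).trans (hpow hl)) ((hg1 k).trans (hpow hk)))
    have h2 : eLpNorm (fun q => app ((g k - g l : SimpleFunc (S × ℝ) (Matrix (Fin n) (Fin d) ℝ)) q)
        w) 1 (π.prod volume) ≤ 2⁻¹ ^ N + 2⁻¹ ^ N := by
      have e : (fun q => app ((g k - g l : SimpleFunc (S × ℝ) (Matrix (Fin n) (Fin d) ℝ)) q) w)
          = (fun q => app (F q - g l q) w) - fun q => app (F q - g k q) w := by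
        ext1 q
        rw [Pi.sub_apply, ← app_sub_left]
        simp
      rw [e]
      have hsm : ∀ k, AEStronglyMeasurable (fun q => app (F q - g k q) w) (π.prod volume) :=
        fun k => (continuous_app_left w).comp_aestronglyMeasurable (hF.1.sub (hgm k))
      exact (eLpNorm_sub_le (hsm l) (hsm k) le_rfl).trans
        (add_le_add ((hg2 l).trans (hpow hl)) ((hg2 k).trans (hpow hk)))
    refine (hCb _ A hbd hA).trans_lt ?_
    calc _ ≤ C * ((2⁻¹ ^ N + 2⁻¹ ^ N) + (2⁻¹ ^ N + 2⁻¹ ^ N)) := by gcongr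
      _ = C * 4 * 2⁻¹ ^ N := by ring
      _ < C * 4 * 2⁻¹ ^ N + 2⁻¹ ^ N := by
          refine ENNReal.lt_add_right ?_ ?_
          · exact ENNReal.mul_ne_top (ENNReal.mul_ne_top hC ENNReal.ofNat_ne_top)
              (ENNReal.pow_ne_top (ENNReal.inv_ne_top.2 two_ne_zero))
          · exact pow_ne_zero _ (ENNReal.inv_ne_zero.2 ENNReal.ofNat_ne_top)
      _ = _ := by ring
  have hsum : ∑' N : ℕ, (C * 4 + 1) * (2⁻¹ : ℝ≥0∞) ^ N ≠ ⊤ := by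
    rw [ENNReal.tsum_mul_left, ENNReal.tsum_geometric, ENNReal.one_sub_inv_two, inv_inv]
    exact ENNReal.mul_ne_top (ENNReal.add_ne_top.2
      ⟨ENNReal.mul_ne_top hC ENNReal.ofNat_ne_top, ENNReal.one_ne_top⟩) ENNReal.ofNat_ne_top
  have hlim : ∀ A, MeasurableSet A → ∃ Z : Ω → E n, MemLp Z p P ∧
      Tendsto (fun k => eLpNorm (simpleIntegral Λ (g k) A - Z) p P) atTop (𝓝 0) :=
    fun A hA => Lp.cauchy_complete_eLpNorm hp1 (fun k => hmem k A hA) hsum (hcau A hA)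
  have hmeas : ∀ A, MeasurableSet A → ∀ Z : Ω → E n, MemLp Z p P →
      Tendsto (fun k => eLpNorm (simpleIntegral Λ (g k) A - Z) p P) atTop (𝓝 0) →
      TendstoInMeasure P (fun k => simpleIntegral Λ (g k) A) atTop Z :=
    fun A hA Z hZ h => tendstoInMeasure_of_tendsto_eLpNorm hp0 (fun k => (hmem k A hA).1) hZ.1 h
  obtain ⟨Y, hY, hYlim⟩ := hlim Set.univ MeasurableSet.univ
  have hzero : Tendsto (fun k : ℕ => (2⁻¹ : ℝ≥0∞) ^ k) atTop (𝓝 0) :=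
    ENNReal.tendsto_pow_atTop_nhds_zero_of_lt_one (by norm_num)
  refine ⟨Y, g, ⟨g, hg, hgF, fun A hA => ?_, hmeas _ MeasurableSet.univ Y hY hYlim⟩, hY, hg,
    fun k => hmem k _ MeasurableSet.univ, hYlim, ?_, ?_⟩
  · obtain ⟨Z, hZ, hZlim⟩ := hlim A hA
    exact ⟨Z, hmeas A hA Z hZ hZlim⟩
  · refine tendsto_of_tendsto_of_tendsto_of_le_of_le tendsto_const_nhds hzero
      (fun _ => zero_le) fun k => ?_
    rw [eLpNorm_sub_comm]
    exact hg1 k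
  · refine tendsto_of_tendsto_of_tendsto_of_le_of_le tendsto_const_nhds hzero
      (fun _ => zero_le) fun k => ?_
    refine le_trans (le_of_eq ?_) (hg2 k)
    rw [← eLpNorm_neg]
    congr 1
    ext1 q
    rw [Pi.neg_apply, app_sub_left, app_sub_left, neg_sub]

end Existence

/-! ### Moments of integrals -/

section Moments

theorem tendsto_eLpNorm_of_norm_le {α V W : Type*} [MeasurableSpace α] [NormedAddCommGroup V]
    [NormedAddCommGroup W] {μ : Measure α} {p : ℝ≥0∞} {f : ℕ → α → V} {g : ℕ → α → W} {C : ℝ}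
    (h : ∀ k x, ‖f k x‖ ≤ C * ‖g k x‖) (hg : Tendsto (fun k => eLpNorm (g k) p μ) atTop (𝓝 0)) :
    Tendsto (fun k => eLpNorm (f k) p μ) atTop (𝓝 0) := by
  have h1 : Tendsto (fun k => ENNReal.ofReal C * eLpNorm (g k) p μ) atTop (𝓝 0) := by
    have := ENNReal.Tendsto.const_mul hg (Or.inr (ENNReal.ofReal_ne_top (r := C)))
    rwa [mul_zero] at this
  exact tendsto_of_tendsto_of_tendsto_of_le_of_le tendsto_const_nhds h1 (fun _ => zero_le)
    fun k => eLpNorm_le_mul_eLpNorm_of_ae_le_mul (Eventually.of_forall (h k)) p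

variable {Ω S : Type*} [MeasurableSpace Ω] [MeasurableSpace S]
  {P : Measure Ω} {π : Measure S} [IsProbabilityMeasure P] [IsProbabilityMeasure π]
  {n d : ℕ} {T : LevyTriplet d} {Λ : Set (S × ℝ) → Ω → E d}
  {F : S × ℝ → Matrix (Fin n) (Fin d) ℝ} {Y : Ω → E n}

theorem enorm_inner_le {V : Type*} [NormedAddCommGroup V] [InnerProductSpace ℝ V] (x y : V) :
    ‖(inner ℝ x y : ℝ)‖ₑ ≤ ‖x‖ₑ * ‖y‖ₑ := by
  rw [← ofReal_norm, ← ofReal_norm, ← ofReal_norm, ← ENNReal.ofReal_mul (norm_nonneg _)]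
  exact ENNReal.ofReal_le_ofReal (norm_inner_le_norm _ _)

theorem memLp_app_transpose {α : Type*} [MeasurableSpace α] {μ : Measure α} {p : ℝ≥0∞}
    {G : α → Matrix (Fin n) (Fin d) ℝ} (hG : MemLp G p μ) (u : E n) :
    MemLp (fun q => app (G q)ᵀ u) p μ := by
  refine MemLp.of_le_mul (c := ‖u‖) hG
    ((continuous_app_transpose u).comp_aestronglyMeasurable hG.1)
    (Eventually.of_forall fun q => ?_)
  rw [mul_comm]
  exact norm_app_transpose_le _ _

theorem memLp_app {α : Type*} [MeasurableSpace α] {μ : Measure α} {p : ℝ≥0∞} {G : α → E n}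
    (hG : MemLp G p μ) (M : Matrix (Fin d) (Fin n) ℝ) : MemLp (fun q => app M (G q)) p μ := by
  refine MemLp.of_le_mul (c := ‖M‖) hG ?_ (Eventually.of_forall fun q => norm_app_le _ _)
  have hc : Continuous fun x : E n => app M x := by
    unfold app
    fun_prop
  exact hc.comp_aestronglyMeasurable hG.1

theorem integrable_inner_of_memLp_two {α V : Type*} [MeasurableSpace α] [NormedAddCommGroup V]
    [InnerProductSpace ℝ V] {μ : Measure α} {f g : α → V} (hf : MemLp f 2 μ) (hg : MemLp g 2 μ) :
    Integrable (fun x => (inner ℝ (f x) (g x) : ℝ)) μ := by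
  refine (hf.norm.integrable_mul hg.norm).mono (hf.1.inner hg.1)
    (Eventually.of_forall fun x => ?_)
  simp only [Pi.mul_apply, norm_mul, norm_norm]
  exact norm_inner_le_norm _ _

theorem integrable_inner_sigL {α : Type*} [MeasurableSpace α] {μ : Measure α}
    {G : α → Matrix (Fin n) (Fin d) ℝ} (hG : MemLp G 2 μ) (M : Matrix (Fin d) (Fin d) ℝ) (u : E n) :
    Integrable (fun q => (inner ℝ (app (G q)ᵀ u) (app M (app (G q)ᵀ u)) : ℝ)) μ :=
  integrable_inner_of_memLp_two (memLp_app_transpose hG u) (memLp_app (memLp_app_transpose hG u) M)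

/-- The formulas for simple integrands pass to the limit: both second moments are inner products of
`L²`-convergent functions, and the mean converges because `app (g k) T.mean` converges in `L¹`.
Uniqueness carries this over to the given integral. -/
theorem IsLevyIntegral.moments (hΛ : IsLevyBasis P π T Λ)
    (h2 : ∫⁻ x in {x : E d | 1 < ‖x‖}, ‖x‖ₑ ^ 2 ∂T.nu < ⊤)
    (hF : MemLp F 2 (π.prod volume)) (hw : Integrable (fun q => app (F q) T.mean) (π.prod volume))
    (h : IsLevyIntegral P π Λ F Y) :
    MemLp Y 2 P ∧ ∀ u : E n,
      ∫ ω, (inner ℝ u (Y ω) : ℝ) ∂P = inner ℝ u (∫ q, app (F q) T.mean ∂(π.prod volume)) ∧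
      ∫ ω, (inner ℝ u (Y ω) : ℝ) ^ 2 ∂P
        = ∫ q, (inner ℝ (app (F q)ᵀ u) (app T.sigL (app (F q)ᵀ u)) : ℝ) ∂(π.prod volume)
          + (inner ℝ u (∫ q, app (F q) T.mean ∂(π.prod volume))) ^ 2 := by
  obtain ⟨Y', g, hY', hYm, hg, hsm, hlim, hgF, hgw⟩ := exists_isLevyIntegral hΛ
    (p := 2) (by norm_num) (by norm_num) (hΛ.isLpBounded_two h2) hF hw
  have hYY := h.ae_unique hΛ hY'
  refine ⟨(memLp_congr_ae hYY).2 hYm, fun u => ?_⟩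
  have hg2 : ∀ k, MemLp (g k) 2 (π.prod volume) := fun k => (hg k).memLp (by norm_num) (by norm_num)
  have hmom := fun k => hΛ.sInt_moments h2 ((hg k).rowSimple MeasurableSet.univ u)
  have hrow : ∀ k q, rowSimple (g k) Set.univ u q = app (g k q)ᵀ u := fun k q => by
    rw [rowSimple_apply _ MeasurableSet.univ, Set.indicator_univ]
  have hin := fun k => hΛ.inner_simpleIntegral (hg k) MeasurableSet.univ u
  simp_rw [hrow] at hmom
  have hmean : Tendsto (fun k => ∫ q, (inner ℝ (app (g k q)ᵀ u) T.mean : ℝ) ∂(π.prod volume)) atTop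
      (𝓝 (inner ℝ u (∫ q, app (F q) T.mean ∂(π.prod volume)))) := by
    simp_rw [inner_app_transpose]
    have hi : ∀ k, Integrable (fun q => app (g k q) T.mean) (π.prod volume) := fun k =>
      (hg k).integrable_map (g := fun M => app M T.mean) (app_zero_left _)
    have h1 := tendsto_integral_of_tendsto_eLpNorm_one hi hw (by
      refine hgw.congr fun k => ?_
      congr 1
      ext1 q
      rw [app_sub_left, Pi.sub_apply])
    have h3 := (tendsto_const_nhds (x := u)).inner h1 (𝕜 := ℝ)
    refine h3.congr fun k => ?_
    rw [integral_inner (hi k)]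
  have hsec : Tendsto (fun k => ∫ q, (inner ℝ (app (g k q)ᵀ u) (app T.sigL (app (g k q)ᵀ u)) : ℝ)
      ∂(π.prod volume)) atTop
      (𝓝 (∫ q, (inner ℝ (app (F q)ᵀ u) (app T.sigL (app (F q)ᵀ u)) : ℝ) ∂(π.prod volume))) := by
    refine tendsto_integral_inner (fun k => memLp_app_transpose (hg2 k) u)
      (memLp_app_transpose hF u) (fun k => memLp_app (memLp_app_transpose (hg2 k) u) _)
      (memLp_app (memLp_app_transpose hF u) _) ?_ ?_
    · refine tendsto_eLpNorm_of_norm_le (C := ‖u‖) (fun k q => ?_) hgF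
      rw [Pi.sub_apply, ← app_sub_left, ← Matrix.transpose_sub, mul_comm]
      exact norm_app_transpose_le _ _
    · refine tendsto_eLpNorm_of_norm_le (C := ‖T.sigL‖ * ‖u‖) (fun k q => ?_) hgF
      rw [Pi.sub_apply, ← app_sub_right, ← app_sub_left, ← Matrix.transpose_sub, mul_assoc]
      refine (norm_app_le _ _).trans ?_
      gcongr
      rw [mul_comm]
      exact norm_app_transpose_le _ _
  have hconst : MemLp (fun _ : Ω => u) 2 P := memLp_const u
  have hinY : MemLp (fun ω => (inner ℝ u (Y' ω) : ℝ)) 2 P := hYm.const_inner u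
  have hins : ∀ k, MemLp (fun ω => (inner ℝ u (simpleIntegral Λ (g k) Set.univ ω) : ℝ)) 2 P :=
    fun k => (hsm k).const_inner u
  have hlin : Tendsto (fun k => eLpNorm ((fun ω => (inner ℝ u (simpleIntegral Λ (g k) Set.univ ω)
      : ℝ)) - fun ω => (inner ℝ u (Y' ω) : ℝ)) 2 P) atTop (𝓝 0) := by
    refine tendsto_eLpNorm_of_norm_le (C := ‖u‖) (fun k ω => ?_) hlim
    rw [Pi.sub_apply, Pi.sub_apply, ← inner_sub_right]
    exact norm_inner_le_norm _ _
  constructor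
  · have h1 := tendsto_integral_inner (fun _ => hconst) hconst hsm hYm (by simp) hlim
    rw [integral_congr_ae (g := fun ω => (inner ℝ u (Y' ω) : ℝ))
      (by filter_upwards [hYY] with ω hω; rw [hω])]
    refine tendsto_nhds_unique h1 (hmean.congr fun k => ?_)
    rw [integral_congr_ae (hin k), (hmom k).2.1]
  · have h1 := tendsto_integral_inner hins hinY hins hinY hlin hlin
    rw [integral_congr_ae (g := fun ω => (inner ℝ u (Y' ω) : ℝ) ^ 2)
      (by filter_upwards [hYY] with ω hω; rw [hω])]
    simp_rw [real_inner_eq_re_inner, RCLike.inner_apply, conj_trivial, ← sq] at h1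
    simp only [RCLike.re_to_real] at h1
    refine tendsto_nhds_unique h1 ((hsec.add (hmean.pow 2)).congr fun k => ?_)
    rw [← (hmom k).2.2]
    refine integral_congr_ae ?_
    filter_upwards [hin k] with ω hω
    rw [hω]

theorem norm_sq_eq_sum_inner_single (x : E n) :
    ‖x‖ ^ 2 = ∑ i, (inner ℝ (EuclideanSpace.single i (1 : ℝ)) x : ℝ) ^ 2 := by
  rw [EuclideanSpace.norm_sq_eq]
  simp [EuclideanSpace.inner_single_left]

theorem trace_eq_sum_inner (M : Matrix (Fin n) (Fin d) ℝ) (C : Matrix (Fin d) (Fin d) ℝ) :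
    (M * C * Mᵀ).trace = ∑ i, (inner ℝ (app Mᵀ (EuclideanSpace.single i (1 : ℝ)))
      (app C (app Mᵀ (EuclideanSpace.single i (1 : ℝ)))) : ℝ) := by
  rw [Matrix.trace]
  refine Finset.sum_congr rfl fun i _ => ?_
  rw [inner_eq_sum]
  have h1 : ∀ j, app Mᵀ (EuclideanSpace.single i (1 : ℝ)) j = M i j := fun j => by
    rw [app_apply]
    simp
  simp_rw [app_apply C, h1, Matrix.diag_apply, Matrix.mul_apply, Matrix.transpose_apply,
    Finset.mul_sum, Finset.sum_mul]
  rw [Finset.sum_comm]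
  refine Finset.sum_congr rfl fun j _ => Finset.sum_congr rfl fun k _ => by ring

theorem IsLevyIntegral.integral_norm_sq (hΛ : IsLevyBasis P π T Λ)
    (h2 : ∫⁻ x in {x : E d | 1 < ‖x‖}, ‖x‖ₑ ^ 2 ∂T.nu < ⊤)
    (hF : MemLp F 2 (π.prod volume)) (hw : Integrable (fun q => app (F q) T.mean) (π.prod volume))
    (h : IsLevyIntegral P π Λ F Y) :
    ∫ ω, ‖Y ω‖ ^ 2 ∂P = ∫ q, (F q * T.sigL * (F q)ᵀ).trace ∂(π.prod volume)
      + ‖∫ q, app (F q) T.mean ∂(π.prod volume)‖ ^ 2 := by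
  obtain ⟨hm, hu⟩ := h.moments hΛ h2 hF hw
  simp_rw [norm_sq_eq_sum_inner_single, trace_eq_sum_inner]
  rw [integral_finsetSum _ fun i _ => (hm.const_inner _).integrable_sq,
    integral_finsetSum _ fun i _ => integrable_inner_sigL hF _ _, ← Finset.sum_add_distrib]
  exact Finset.sum_congr rfl fun i _ => (hu _).2

/-! ### First absolute moments of integrals in the finite variation case. -/

theorem absIntensity_add_le (a b : E d) :
    absIntensity T (a + b) ≤ absIntensity T a + absIntensity T b := by
  unfold absIntensity
  have h1 : ∀ x, ‖(inner ℝ (a + b) x : ℝ)‖ₑ ≤ ‖(inner ℝ a x : ℝ)‖ₑ + ‖(inner ℝ b x : ℝ)‖ₑ :=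
    fun x => by
      rw [inner_add_left]
      exact enorm_add_le _ _
  have h3 : ∫⁻ x, ‖(inner ℝ (a + b) x : ℝ)‖ₑ ∂T.nu
      ≤ ∫⁻ x, ‖(inner ℝ a x : ℝ)‖ₑ ∂T.nu + ∫⁻ x, ‖(inner ℝ b x : ℝ)‖ₑ ∂T.nu := by
    rw [← lintegral_add_left (by fun_prop)]
    exact lintegral_mono h1
  refine (add_le_add h3 (h1 T.gam0)).trans (le_of_eq ?_)
  ring

theorem IsLevyIntegral.lintegral_inner_le (hΛ : IsLevyBasis P π T Λ) (hs : T.sig = 0)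
    (h1 : ∫⁻ x, ‖x‖ₑ ∂T.nu < ⊤) (hF : MemLp F 1 (π.prod volume))
    (h : IsLevyIntegral P π Λ F Y) (u : E n) :
    ∫⁻ ω, ‖(inner ℝ u (Y ω) : ℝ)‖ₑ ∂P
      ≤ absConst * ∫⁻ q, absIntensity T (app (F q)ᵀ u) ∂(π.prod volume) := by
  have hw : Integrable (fun q => app (F q) (0 : E d)) (π.prod volume) := by
    simp_rw [app_zero_right]
    exact integrable_zero _ _ _
  obtain ⟨Y', g, hY', hYm, hg, hsm, hlim, hgF, -⟩ := exists_isLevyIntegral hΛ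
    (p := 1) le_rfl (by norm_num) (hΛ.isLpBounded_one hs h1) hF hw
  have hYY := h.ae_unique hΛ hY'
  rw [lintegral_congr_ae (g := fun ω => ‖(inner ℝ u (Y' ω) : ℝ)‖ₑ)
    (by filter_upwards [hYY] with ω hω; rw [hω])]
  set K : ℝ≥0∞ := ‖u‖ₑ * (∫⁻ x, ‖x‖ₑ ∂T.nu + ‖T.gam0‖ₑ) with hK
  have hKt : K ≠ ⊤ := ENNReal.mul_ne_top enorm_ne_top
    (ENNReal.add_ne_top.2 ⟨h1.ne, enorm_ne_top⟩)
  set I := ∫⁻ q, absIntensity T (app (F q)ᵀ u) ∂(π.prod volume) with hI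
  have hrow : ∀ k q, rowSimple (g k) Set.univ u q = app (g k q)ᵀ u := fun k q => by
    rw [rowSimple_apply _ MeasurableSet.univ, Set.indicator_univ]
  -- The bound for simple integrands with two error terms: one from replacing `Y'` by the simple
  -- integral, one from replacing `g k` by `F` inside the intensity, which is subadditive.
  have hle : ∀ k, ∫⁻ ω, ‖(inner ℝ u (Y' ω) : ℝ)‖ₑ ∂P
      ≤ ‖u‖ₑ * eLpNorm (simpleIntegral Λ (g k) Set.univ - Y') 1 P
        + absConst * (I + K * eLpNorm (⇑(g k) - F) 1 (π.prod volume)) := by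
    intro k
    have hms := hΛ.measurable_simpleIntegral (hg k) MeasurableSet.univ
    calc ∫⁻ ω, ‖(inner ℝ u (Y' ω) : ℝ)‖ₑ ∂P
        ≤ ∫⁻ ω, (‖u‖ₑ * ‖(simpleIntegral Λ (g k) Set.univ - Y') ω‖ₑ
          + ‖(inner ℝ u (simpleIntegral Λ (g k) Set.univ ω) : ℝ)‖ₑ) ∂P := by
          refine lintegral_mono fun ω => ?_
          have e : (inner ℝ u (Y' ω) : ℝ) = -inner ℝ u ((simpleIntegral Λ (g k) Set.univ - Y') ω)
              + inner ℝ u (simpleIntegral Λ (g k) Set.univ ω) := by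
            rw [Pi.sub_apply, inner_sub_right]
            ring
          rw [e]
          refine (enorm_add_le _ _).trans ?_
          gcongr
          rw [enorm_neg]
          exact enorm_inner_le _ _
      _ = ‖u‖ₑ * eLpNorm (simpleIntegral Λ (g k) Set.univ - Y') 1 P
          + ∫⁻ ω, ‖sInt Λ (rowSimple (g k) Set.univ u) ω‖ₑ ∂P := by
          rw [lintegral_add_right _ (by fun_prop), lintegral_const_mul' _ _ enorm_ne_top,
            eLpNorm_one_eq_lintegral_enorm]
          congr 1
          refine lintegral_congr_ae ?_
          filter_upwards [hΛ.inner_simpleIntegral (hg k) MeasurableSet.univ u] with ω hω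
          rw [hω]
      _ ≤ _ := by
          gcongr
          refine (hΛ.lintegral_sInt_le hs h1 ((hg k).rowSimple MeasurableSet.univ u)).trans ?_
          gcongr
          simp_rw [hrow]
          calc ∫⁻ q, absIntensity T (app (g k q)ᵀ u) ∂(π.prod volume)
              ≤ ∫⁻ q, (absIntensity T (app (F q)ᵀ u) + K * ‖(⇑(g k) - F) q‖ₑ) ∂(π.prod volume) := by
                refine lintegral_mono fun q => ?_
                have e : app (g k q)ᵀ u = app (F q)ᵀ u + app ((⇑(g k) - F) q)ᵀ u := by
                  rw [← app_add_left, ← Matrix.transpose_add, Pi.sub_apply, add_sub_cancel]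
                rw [e]
                refine (absIntensity_add_le _ _).trans ?_
                gcongr
                refine (absIntensity_le _).trans ?_
                rw [hK, mul_comm ‖u‖ₑ, mul_assoc, mul_comm]
                gcongr
                have := norm_app_transpose_le ((⇑(g k) - F) q) u
                rw [mul_comm] at this
                rw [← ofReal_norm, ← ofReal_norm, ← ofReal_norm,
                  ← ENNReal.ofReal_mul (norm_nonneg _)]
                exact ENNReal.ofReal_le_ofReal this
            _ = _ := by
                rw [lintegral_add_right' _ ((((hg k).memLp one_ne_zero ENNReal.one_ne_top).1.sub
                  hF.1).enorm.const_mul K), lintegral_const_mul' _ _ hKt,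
                  eLpNorm_one_eq_lintegral_enorm]
  have hl : Tendsto (fun k => ‖u‖ₑ * eLpNorm (simpleIntegral Λ (g k) Set.univ - Y') 1 P
        + absConst * (I + K * eLpNorm (⇑(g k) - F) 1 (π.prod volume))) atTop
      (𝓝 (‖u‖ₑ * 0 + absConst * (I + K * 0))) := by
    refine (ENNReal.Tendsto.const_mul hlim (Or.inr enorm_ne_top)).add
      (ENNReal.Tendsto.const_mul (tendsto_const_nhds.add
        (ENNReal.Tendsto.const_mul hgF (Or.inr hKt))) (Or.inr absConst_ne_top))
  rw [mul_zero, zero_add, mul_zero, add_zero] at hl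
  exact ge_of_tendsto' hl hle

theorem IsLevyIntegral.lintegral_norm_le (hΛ : IsLevyBasis P π T Λ) (hs : T.sig = 0)
    (h1 : ∫⁻ x, ‖x‖ₑ ∂T.nu < ⊤) (hF : MemLp F 1 (π.prod volume))
    (h : IsLevyIntegral P π Λ F Y) :
    ∫⁻ ω, ‖Y ω‖ₑ ∂P ≤ n * absConst *
      ∫⁻ q, (∫⁻ x, ‖app (F q) x‖ₑ ∂T.nu + ‖app (F q) T.gam0‖ₑ) ∂(π.prod volume) := by
  let e : Fin n → E n := fun i => EuclideanSpace.single i 1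
  have he : ∀ i, ‖e i‖ₑ = 1 := fun i => by rw [← ofReal_norm]; simp [e]
  have hY := h.aemeasurable hΛ
  calc ∫⁻ ω, ‖Y ω‖ₑ ∂P ≤ ∫⁻ ω, ∑ i, ‖(inner ℝ (e i) (Y ω) : ℝ)‖ₑ ∂P := by
        refine lintegral_mono fun ω => ?_
        have hx : Y ω = ∑ i, (inner ℝ (e i) (Y ω) : ℝ) • e i := by
          ext j
          simp [e, EuclideanSpace.inner_single_left, Pi.single_apply]
        calc ‖Y ω‖ₑ = ‖∑ i, (inner ℝ (e i) (Y ω) : ℝ) • e i‖ₑ := by rw [← hx]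
          _ ≤ ∑ i, ‖(inner ℝ (e i) (Y ω) : ℝ) • e i‖ₑ := enorm_sum_le _ _
          _ = _ := by simp_rw [enorm_smul, he, mul_one]
    _ = ∑ i, ∫⁻ ω, ‖(inner ℝ (e i) (Y ω) : ℝ)‖ₑ ∂P :=
        lintegral_finsetSum' _ fun i _ => (hY.const_inner (c := e i)).enorm
    _ ≤ ∑ _i : Fin n, absConst * ∫⁻ q, (∫⁻ x, ‖app (F q) x‖ₑ ∂T.nu + ‖app (F q) T.gam0‖ₑ)
          ∂(π.prod volume) := by
        refine Finset.sum_le_sum fun i _ => (h.lintegral_inner_le hΛ hs h1 hF (e i)).trans ?_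
        gcongr with q
        have hb : ∀ x, ‖(inner ℝ (app (F q)ᵀ (e i)) x : ℝ)‖ₑ ≤ ‖app (F q) x‖ₑ := fun x => by
          rw [inner_app_transpose]
          refine (enorm_inner_le _ _).trans (le_of_eq ?_)
          rw [he, one_mul]
        exact add_le_add (lintegral_mono hb) (hb _)
    _ = _ := by
        rw [Finset.sum_const, Finset.card_univ, Fintype.card_fin, nsmul_eq_mul, mul_assoc]

end Moments

/-! ### Causal kernels -/

section Kernels

variable {S : Type*} [MeasurableSpace S] {π : Measure S} [IsProbabilityMeasure π] {n d : ℕ}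
  {f : S × ℝ → Matrix (Fin n) (Fin d) ℝ}

theorem measurePreserving_reflect (t : ℝ) :
    MeasurePreserving (fun p : S × ℝ => (p.1, t - p.2)) (π.prod volume) (π.prod volume) :=
  (MeasurePreserving.id π).prod (Measure.measurePreserving_sub_left volume t)

/-- The reflection `(A, s) ↦ (A, t - s)`. -/
noncomputable def reflect (t : ℝ) : S × ℝ ≃ᵐ S × ℝ :=
  (MeasurableEquiv.refl S).prodCongr (MeasurableEquiv.subLeft t)

theorem reflect_apply (t : ℝ) (p : S × ℝ) : reflect t p = (p.1, t - p.2) := rfl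

theorem measurableSet_snd_ge (r : ℝ) : MeasurableSet {q : S × ℝ | r ≤ q.2} :=
  measurableSet_le measurable_const measurable_snd

theorem measurableSet_snd_le (r : ℝ) : MeasurableSet {q : S × ℝ | q.2 ≤ r} :=
  measurableSet_le measurable_snd measurable_const

theorem snd_ge_subset {r : ℝ} (hr : 0 ≤ r) : {q : S × ℝ | r ≤ q.2} ⊆ {q | 0 ≤ q.2} :=
  fun q (hq : r ≤ q.2) => show 0 ≤ q.2 from hr.trans hq

theorem restrict_snd_ge (r : ℝ) : (π.prod (volume : Measure ℝ)).restrict {q | r ≤ q.2}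
    = π.prod (volume.restrict (Set.Ici r)) := by
  have h := Measure.prod_restrict (μ := π) (ν := (volume : Measure ℝ)) Set.univ (Set.Ici r)
  rw [Measure.restrict_univ] at h
  rw [h]
  congr 1
  ext q
  simp

theorem restrict_snd_le (r : ℝ) : (π.prod (volume : Measure ℝ)).restrict {q | q.2 ≤ r}
    = π.prod (volume.restrict (Set.Iic r)) := by
  have h := Measure.prod_restrict (μ := π) (ν := (volume : Measure ℝ)) Set.univ (Set.Iic r)
  rw [Measure.restrict_univ] at h
  rw [h]
  congr 1
  ext q
  simp

theorem halfMeasure_eq : halfMeasure π = (π.prod (volume : Measure ℝ)).restrict {q | 0 ≤ q.2} :=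
  (restrict_snd_ge 0).symm

/-- The part of the causal kernel at time `t` before time `t - r`. -/
noncomputable def tailKernel (f : S × ℝ → Matrix (Fin n) (Fin d) ℝ) (t r : ℝ) :
    S × ℝ → Matrix (Fin n) (Fin d) ℝ :=
  {p : S × ℝ | p.2 ≤ t - r}.indicator (causalKernel f t)

/-- Since `p.2 ≤ t - r` means `r ≤ t - p.2`, the tail is the reflection of `f` cut to `{r ≤ s}`; for
`0 ≤ r` the causal cut-off `p.2 ≤ t` holds automatically. The reflection preserves the measure, so
tail integrals do not depend on `t`. -/
theorem tailKernel_eq (t : ℝ) {r : ℝ} (hr : 0 ≤ r) :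
    tailKernel f t r = fun p => {q : S × ℝ | r ≤ q.2}.indicator f (reflect t p) := by
  ext1 p
  unfold tailKernel causalKernel
  rw [reflect_apply]
  simp only [Set.indicator_apply, Set.mem_ofPred_eq]
  by_cases h : p.2 ≤ t - r
  · rw [if_pos h, if_pos (by linarith), if_pos (by linarith)]
  · rw [if_neg h, if_neg (by linarith)]

theorem tailKernel_zero (t : ℝ) : tailKernel f t 0 = causalKernel f t := by
  ext1 p
  unfold tailKernel causalKernel
  simp only [Set.indicator_apply, Set.mem_ofPred_eq, sub_zero]
  split_ifs <;> rfl

theorem measurePreserving_reflect_equiv (t : ℝ) :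
    MeasurePreserving (reflect t) (π.prod (volume : Measure ℝ)) (π.prod volume) :=
  measurePreserving_reflect t

theorem comp_tailKernel {V : Type*} [Zero V] {ψ : Matrix (Fin n) (Fin d) ℝ → V} (hψ : ψ 0 = 0)
    (t : ℝ) {r : ℝ} (hr : 0 ≤ r) : (fun p => ψ (tailKernel f t r p))
      = fun p => {q : S × ℝ | r ≤ q.2}.indicator (fun q => ψ (f q)) (reflect t p) := by
  ext1 p
  rw [tailKernel_eq t hr]
  by_cases h : reflect t p ∈ {q : S × ℝ | r ≤ q.2}
  · simp only [Set.indicator_of_mem h]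
  · simp only [Set.indicator_of_notMem h, hψ]

theorem memLp_comp_tailKernel {V : Type*} [NormedAddCommGroup V]
    {ψ : Matrix (Fin n) (Fin d) ℝ → V} (hψ : ψ 0 = 0) {p : ℝ≥0∞}
    (hf : MemLp (fun q => ψ (f q)) p (halfMeasure π)) (t : ℝ) {r : ℝ} (hr : 0 ≤ r) :
    MemLp (fun q => ψ (tailKernel f t r q)) p (π.prod volume) := by
  rw [comp_tailKernel hψ t hr]
  have h : MemLp ({q : S × ℝ | r ≤ q.2}.indicator fun q => ψ (f q)) p (π.prod volume) := by
    rw [memLp_indicator_iff_restrict (measurableSet_snd_ge r)]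
    rw [halfMeasure_eq] at hf
    exact hf.mono_measure (Measure.restrict_mono (snd_ge_subset hr) le_rfl)
  exact h.comp_measurePreserving (measurePreserving_reflect_equiv t)

theorem memLp_tailKernel {p : ℝ≥0∞} (hf : MemLp f p (halfMeasure π)) (t : ℝ) {r : ℝ}
    (hr : 0 ≤ r) : MemLp (tailKernel f t r) p (π.prod volume) :=
  memLp_comp_tailKernel (ψ := fun M => M) rfl hf t hr

theorem integral_comp_tailKernel {V : Type*} [NormedAddCommGroup V] [NormedSpace ℝ V]
    {ψ : Matrix (Fin n) (Fin d) ℝ → V} (hψ : ψ 0 = 0) (t : ℝ) {r : ℝ} (hr : 0 ≤ r) :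
    ∫ p, ψ (tailKernel f t r p) ∂(π.prod volume)
      = ∫ q in {q | r ≤ q.2}, ψ (f q) ∂(π.prod volume) := by
  rw [comp_tailKernel hψ t hr, (measurePreserving_reflect_equiv t).integral_comp'
    (g := {q : S × ℝ | r ≤ q.2}.indicator fun q => ψ (f q)),
    integral_indicator (measurableSet_snd_ge r)]

theorem lintegral_comp_tailKernel {ψ : Matrix (Fin n) (Fin d) ℝ → ℝ≥0∞} (hψ : ψ 0 = 0) (t : ℝ)
    {r : ℝ} (hr : 0 ≤ r) : ∫⁻ p, ψ (tailKernel f t r p) ∂(π.prod volume)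
      = ∫⁻ q in {q | r ≤ q.2}, ψ (f q) ∂(π.prod volume) := by
  rw [comp_tailKernel hψ t hr, (measurePreserving_reflect_equiv t).lintegral_comp_emb
    (reflect t).measurableEmbedding, lintegral_indicator (measurableSet_snd_ge r)]

theorem integrableOn_snd_ge {V : Type*} [NormedAddCommGroup V] {h : S × ℝ → V}
    (hh : Integrable h (halfMeasure π)) {r : ℝ} (hr : 0 ≤ r) :
    IntegrableOn h {q | r ≤ q.2} (π.prod volume) := by
  rw [halfMeasure_eq] at hh
  exact IntegrableOn.mono_set hh (snd_ge_subset hr)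

/-- The coefficients are iterated integrals over `s ≤ -r`. Reflection and Fubini turn them into
integrals over `{r ≤ s}`, the form in which moments of tails appear. -/
theorem integral_integral_Iic_neg {V : Type*} [NormedAddCommGroup V] [NormedSpace ℝ V]
    {h : S × ℝ → V} (hh : Integrable h (halfMeasure π)) {r : ℝ} (hr : 0 ≤ r) :
    ∫ A, (∫ s in Set.Iic (-r), h (A, -s)) ∂π = ∫ q in {q | r ≤ q.2}, h q ∂(π.prod volume) := by
  have e : ∀ p : S × ℝ, {q : S × ℝ | q.2 ≤ -r}.indicator (fun p => h (p.1, -p.2)) p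
      = {q : S × ℝ | r ≤ q.2}.indicator h (reflect 0 p) := fun p => by
    rw [reflect_apply, zero_sub]
    simp only [Set.indicator_apply, Set.mem_ofPred_eq]
    by_cases hp : p.2 ≤ -r
    · rw [if_pos hp, if_pos (by linarith)]
    · rw [if_neg hp, if_neg (by linarith)]
  have hi : Integrable ({q : S × ℝ | r ≤ q.2}.indicator h) (π.prod volume) :=
    (integrable_indicator_iff (measurableSet_snd_ge r)).2 (integrableOn_snd_ge hh hr)
  have hi' : IntegrableOn (fun p : S × ℝ => h (p.1, -p.2)) {q | q.2 ≤ -r} (π.prod volume) := by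
    rw [← integrable_indicator_iff (measurableSet_snd_le _), funext e]
    exact (measurePreserving_reflect_equiv 0).integrable_comp_of_integrable hi
  rw [IntegrableOn, restrict_snd_le] at hi'
  rw [← integral_indicator (measurableSet_snd_ge r),
    ← (measurePreserving_reflect_equiv 0).integral_comp', ← funext e,
    integral_indicator (measurableSet_snd_le _), restrict_snd_le, integral_prod _ hi']

theorem tendsto_setIntegral_snd_ge {V : Type*} [NormedAddCommGroup V] [NormedSpace ℝ V]
    {h : S × ℝ → V} (hh : Integrable h (halfMeasure π)) :
    Tendsto (fun r : ℝ => ∫ q in {q | r ≤ q.2}, h q ∂(π.prod volume)) atTop (𝓝 0) := by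
  have hh' : Integrable ({q : S × ℝ | 0 ≤ q.2}.indicator h) (π.prod volume) := by
    rw [halfMeasure_eq] at hh
    exact (integrable_indicator_iff (measurableSet_snd_ge 0)).2 hh
  have h1 : Tendsto (fun r : ℝ => ∫ q, {q : S × ℝ | r ≤ q.2}.indicator
      ({q : S × ℝ | 0 ≤ q.2}.indicator h) q ∂(π.prod volume)) atTop
      (𝓝 (∫ _ : S × ℝ, (0 : V) ∂(π.prod volume))) := by
    refine tendsto_integral_filter_of_dominated_convergence
      (fun q => ‖{q : S × ℝ | 0 ≤ q.2}.indicator h q‖)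
      (Eventually.of_forall fun r => hh'.1.indicator (measurableSet_snd_ge r))
      (Eventually.of_forall fun r => Eventually.of_forall fun q => norm_indicator_le_norm_self _ _)
      hh'.norm (Eventually.of_forall fun q => ?_)
    refine tendsto_const_nhds.congr' ?_
    filter_upwards [eventually_gt_atTop q.2] with r hr
    rw [Set.indicator_of_notMem]
    exact not_le.2 hr
  rw [integral_zero] at h1
  refine h1.congr' ?_
  filter_upwards [eventually_ge_atTop 0] with r hr
  rw [integral_indicator (measurableSet_snd_ge r)]
  refine setIntegral_congr_fun (measurableSet_snd_ge r) fun q (hq : r ≤ q.2) => ?_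
  exact Set.indicator_of_mem (show q ∈ {q : S × ℝ | 0 ≤ q.2} from hr.trans hq) _

end Kernels

/-! ### Weak dependence of causal moving averages -/

section WeakDependence

theorem lipConst_nonneg {n v : ℕ} (G : (Fin v → E n) → ℝ) : 0 ≤ lipConst G :=
  Real.iSup_nonneg fun _ => by positivity

theorem supNorm_nonneg {ι : Type*} (F : ι → ℝ) : 0 ≤ supNorm F :=
  Real.iSup_nonneg fun _ => abs_nonneg _

theorem abs_le_supNorm {ι : Type*} {F : ι → ℝ} {K : ℝ} (h : ∀ x, |F x| ≤ K) (x : ι) :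
    |F x| ≤ supNorm F :=
  le_ciSup (f := fun x => |F x|) ⟨K, by rintro _ ⟨y, rfl⟩; exact h y⟩ x

/-- The existence of some Lipschitz constant bounds the family of quotients above; for an unbounded
family the real supremum defaults to `0` and the inequality could fail. -/
theorem abs_sub_le_lipConst_mul {n v : ℕ} {G : (Fin v → E n) → ℝ}
    (hG : ∃ K : ℝ, ∀ y z, |G y - G z| ≤ K * ∑ k, ‖y k - z k‖) (y z : Fin v → E n) :
    |G y - G z| ≤ lipConst G * ∑ k, ‖y k - z k‖ := by
  obtain ⟨K, hK⟩ := hG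
  have hpos : ∀ {a b : Fin v → E n}, a ≠ b → 0 < ∑ k, ‖a k - b k‖ := fun {a b} hab => by
    obtain ⟨k, hk⟩ := Function.ne_iff.1 hab
    exact Finset.sum_pos' (fun i _ => norm_nonneg _)
      ⟨k, Finset.mem_univ k, norm_pos_iff.2 (sub_ne_zero.2 hk)⟩
  by_cases h : y = z
  · simp [h]
  · rw [← div_le_iff₀ (hpos h)]
    refine le_ciSup (f := fun q : {q : (Fin v → E n) × (Fin v → E n) // q.1 ≠ q.2} =>
      |G q.1.1 - G q.1.2| / ∑ i, ‖q.1.1 i - q.1.2 i‖) ⟨K, ?_⟩ ⟨(y, z), h⟩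
    rintro _ ⟨⟨⟨a, b⟩, hab⟩, rfl⟩
    exact (div_le_iff₀ (hpos hab)).2 (hK a b)

theorem continuous_of_lipConst {n v : ℕ} {G : (Fin v → E n) → ℝ}
    (hG : ∃ K : ℝ, ∀ y z, |G y - G z| ≤ K * ∑ k, ‖y k - z k‖) : Continuous G := by
  refine continuous_iff_continuousAt.2 fun z => ?_
  rw [ContinuousAt, tendsto_iff_dist_tendsto_zero]
  have h : Tendsto (fun y : Fin v → E n => lipConst G * ∑ k, ‖y k - z k‖) (𝓝 z) (𝓝 0) := by
    have : Continuous fun y : Fin v → E n => lipConst G * ∑ k, ‖y k - z k‖ := by fun_prop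
    have h1 := this.tendsto z
    simpa using h1
  refine squeeze_zero (fun _ => dist_nonneg) (fun y => ?_) h
  rw [Real.dist_eq]
  exact abs_sub_le_lipConst_mul hG y z

variable {Ω : Type*} [MeasurableSpace Ω] {P : Measure Ω} [IsProbabilityMeasure P]

/-- Bound `|E UV|` and `|E U| |E V|` separately by `s E|V|`. -/
theorem abs_covariance_le {U V : Ω → ℝ} {s : ℝ} (hU : AEStronglyMeasurable U P)
    (hs : ∀ ω, |U ω| ≤ s) (hV : MemLp V 2 P) : |cov[U, V; P]| ≤ 2 * s * ∫ ω, |V ω| ∂P := by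
  have hU2 : MemLp U 2 P := MemLp.of_bound hU s (Eventually.of_forall hs)
  have hVi : Integrable V P := hV.integrable (by norm_num)
  have h1 : |∫ ω, (U * V) ω ∂P| ≤ s * ∫ ω, |V ω| ∂P := by
    rw [← integral_const_mul]
    refine abs_integral_le_integral_abs.trans ?_
    refine integral_mono (hU2.integrable_mul hV).abs (hVi.abs.const_mul s) fun ω => ?_
    simp only [Pi.mul_apply, abs_mul]
    exact mul_le_mul_of_nonneg_right (hs ω) (abs_nonneg _)
  have h2 : |∫ ω, U ω ∂P| ≤ s := by
    refine abs_integral_le_integral_abs.trans ?_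
    calc _ ≤ ∫ _, s ∂P := integral_mono (hU2.integrable (by norm_num)).abs (integrable_const _) hs
      _ = s := by simp
  have h3 : |∫ ω, V ω ∂P| ≤ ∫ ω, |V ω| ∂P := abs_integral_le_integral_abs
  rw [covariance_eq_sub hU2 hV]
  refine (abs_sub _ _).trans ?_
  rw [abs_mul]
  have := mul_le_mul h2 h3 (abs_nonneg _) ((abs_nonneg _).trans h2)
  linarith

variable {S : Type*} [MeasurableSpace S] {π : Measure S} [IsProbabilityMeasure π]
  {n d : ℕ} {T : LevyTriplet d} {Λ : Set (S × ℝ) → Ω → E d}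
  {f : S × ℝ → Matrix (Fin n) (Fin d) ℝ} {X : ℝ → Ω → E n}

/-- The near part `N` depends on the basis after time `t - r` only, the tail part `Z` on the basis
up to that time. The sum is an integral of the full causal kernel, hence equals `X t` by uniqueness.
-/
theorem exists_near_add_tail (hΛ : IsLevyBasis P π T Λ)
    (hX : ∀ t, IsLevyIntegral P π Λ (causalKernel f t) (X t)) (t r : ℝ) :
    ∃ N Z : Ω → E n, IsLevyIntegral P π Λ
        ({p : S × ℝ | p.2 ≤ t - r}ᶜ.indicator (causalKernel f t)) N ∧
      IsLevyIntegral P π Λ (tailKernel f t r) Z ∧ X t =ᵐ[P] fun ω => N ω + Z ω := by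
  obtain ⟨N, -, hN, -⟩ := (hX t).exists_restrict hΛ (measurableSet_snd_le (t - r)).compl
  obtain ⟨Z, -, hZ, -⟩ := (hX t).exists_restrict hΛ (measurableSet_snd_le (t - r))
  refine ⟨N, Z, hN, hZ, (hX t).ae_unique hΛ ?_⟩
  have h := hN.add hΛ hZ
  have e : (fun p => {p : S × ℝ | p.2 ≤ t - r}ᶜ.indicator (causalKernel f t) p
      + {p : S × ℝ | p.2 ≤ t - r}.indicator (causalKernel f t) p) = causalKernel f t := by
    ext1 p
    exact Set.indicator_compl_add_self_apply _ _ _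
  rwa [e] at h

/-- A causal moving average whose tails have first absolute moments of order `θ(r)` is
`θ`-weakly dependent. -/
theorem isThetaWeaklyDependent_of_tail (hΛ : IsLevyBasis P π T Λ)
    (hX : ∀ t, IsLevyIntegral P π Λ (causalKernel f t) (X t)) {θ : ℝ → ℝ}
    (hθ : Tendsto θ atTop (𝓝 0)) {c : ℝ}
    (hb : ∀ t r : ℝ, 0 ≤ r → ∀ Z : Ω → E n, IsLevyIntegral P π Λ (tailKernel f t r) Z →
      Integrable Z P ∧ ∫ ω, ‖Z ω‖ ∂P ≤ c * θ r) : IsThetaWeaklyDependent P X θ := by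
  refine ⟨hθ, 2 * c, fun u v hu hv r hr i j hi hj hij F G hF hF1 hG1 hGK => ?_⟩
  let last : Fin u := ⟨u - 1, by omega⟩
  have hlast : ∀ k, i k ≤ i last := fun k => hi (Fin.le_def.2 (by simp only [last]; omega))
  choose N Z hN hZ hXNZ using fun l => exists_near_add_tail hΛ hX (j l) r
  have hXm : ∀ t, AEMeasurable (X t) P := fun t => (hX t).aemeasurable hΛ
  have hNm : ∀ l, AEMeasurable (N l) P := fun l => (hN l).aemeasurable hΛ
  -- The dividing time is the latest past time `i last`: the past uses the basis up to it, while
  -- each `N l` uses only times after `j l - r`, which is at least `i last`.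
  have hind := indepFun_of_disjoint_support hΛ (measurableSet_snd_le (i last))
    (fun k => hX (i k)) (fun k p (hp : ¬ p.2 ≤ i last) => by
      rw [causalKernel, if_neg fun h => hp (h.trans (hlast k))])
    hN (fun l p (hp : p.2 ≤ i last) => by
      rw [Set.indicator_of_notMem]
      simp only [Set.mem_compl_iff, Set.mem_ofPred_eq, not_not]
      linarith [hij last l])
  have hGc := continuous_of_lipConst hGK
  set U : Ω → ℝ := fun ω => F fun k => X (i k) ω with hU
  set V : Ω → ℝ := fun ω => G fun k => X (j k) ω with hV
  set W : Ω → ℝ := fun ω => G fun k => N k ω with hW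
  have hUm : AEStronglyMeasurable U P :=
    (hF.comp_aemeasurable (aemeasurable_pi_lambda _ fun k => hXm (i k))).aestronglyMeasurable
  have hVm : AEStronglyMeasurable V P :=
    (hGc.measurable.comp_aemeasurable
      (aemeasurable_pi_lambda _ fun k => hXm (j k))).aestronglyMeasurable
  have hWm : AEStronglyMeasurable W P :=
    (hGc.measurable.comp_aemeasurable (aemeasurable_pi_lambda _ hNm)).aestronglyMeasurable
  have hU2 : MemLp U 2 P := MemLp.of_bound hUm 1 (Eventually.of_forall fun _ => hF1 _)
  have hV2 : MemLp V 2 P := MemLp.of_bound hVm 1 (Eventually.of_forall fun _ => hG1 _)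
  have hW2 : MemLp W 2 P := MemLp.of_bound hWm 1 (Eventually.of_forall fun _ => hG1 _)
  have hUW : cov[U, W; P] = 0 :=
    (hind.comp hF hGc.measurable).covariance_eq_zero hU2 hW2
  -- By independence the covariance with `W` vanishes, so only the effect of the tails on `G`
  -- remains.
  have hcov : cov[U, V; P] = cov[U, V - W; P] := by
    rw [covariance_sub_right hU2 hV2 hW2, hUW, sub_zero]
  have hVW : ∫ ω, |(V - W) ω| ∂P ≤ lipConst G * (v * (c * θ r)) := by
    have hZi : ∀ l, Integrable (Z l) P := fun l => (hb (j l) r hr (Z l) (hZ l)).1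
    calc ∫ ω, |(V - W) ω| ∂P ≤ ∫ ω, lipConst G * ∑ l, ‖Z l ω‖ ∂P := by
          refine integral_mono_ae ((hV2.sub hW2).integrable (by norm_num)).abs
            ((integrable_finsetSum _ fun l _ => (hZi l).norm).const_mul _) ?_
          filter_upwards [ae_all_iff.2 hXNZ] with ω hω
          refine (abs_sub_le_lipConst_mul hGK _ _).trans (le_of_eq ?_)
          simp only [hω, add_sub_cancel_left]
      _ = lipConst G * ∑ l, ∫ ω, ‖Z l ω‖ ∂P := by
          rw [integral_const_mul, integral_finsetSum _ fun l _ => (hZi l).norm]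
      _ ≤ lipConst G * ∑ _l : Fin v, c * θ r := by
          refine mul_le_mul_of_nonneg_left (Finset.sum_le_sum fun l _ => ?_) (lipConst_nonneg G)
          exact (hb (j l) r hr (Z l) (hZ l)).2
      _ = _ := by rw [Finset.sum_const, Finset.card_univ, Fintype.card_fin, nsmul_eq_mul]
  rw [hcov]
  refine (abs_covariance_le hUm (fun ω => abs_le_supNorm hF1 _) (hV2.sub hW2)).trans ?_
  calc _ ≤ 2 * supNorm F * (lipConst G * (v * (c * θ r))) :=
        mul_le_mul_of_nonneg_left hVW (by have := supNorm_nonneg F; positivity)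
    _ = _ := by ring

theorem IsThetaWeaklyDependent.congr {X : ℝ → Ω → E n} {θ θ' : ℝ → ℝ}
    (h : IsThetaWeaklyDependent P X θ) (he : ∀ r, 0 ≤ r → θ r = θ' r) :
    IsThetaWeaklyDependent P X θ' := by
  obtain ⟨h0, c, hc⟩ := h
  refine ⟨h0.congr' ?_, c, fun u v hu hv r hr i j hi hj hij F G hF hF1 hG1 hGK => ?_⟩
  · filter_upwards [eventually_ge_atTop 0] with r hr
    exact he r hr
  · rw [← he r hr]
    exact hc u v hu hv r hr i j hi hj hij F G hF hF1 hG1 hGK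

end WeakDependence

/-! ### Integrability conditions -/

section Conditions

variable {n d : ℕ} {T : LevyTriplet d}

theorem enorm_app_le (M : Matrix (Fin n) (Fin d) ℝ) (x : E d) :
    ‖app M x‖ₑ ≤ ‖M‖ₑ * ‖x‖ₑ := by
  rw [← ofReal_norm, ← ofReal_norm, ← ofReal_norm, ← ENNReal.ofReal_mul (norm_nonneg _)]
  exact ENNReal.ofReal_le_ofReal (norm_app_le _ _)

theorem app_add_right (M : Matrix (Fin n) (Fin d) ℝ) (x y : E d) :
    app M (x + y) = app M x + app M y := by
  ext i
  simp [app_apply, mul_add, Finset.sum_add_distrib]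

theorem app_integral (M : Matrix (Fin n) (Fin d) ℝ) {μ : Measure (E d)} {g : E d → E d}
    (hg : Integrable g μ) : app M (∫ x, g x ∂μ) = ∫ x, app M (g x) ∂μ := by
  let L : E d →L[ℝ] E n := LinearMap.toContinuousLinearMap
    { toFun := app M
      map_add' := app_add_right M
      map_smul' := fun c x => app_smul M c x }
  exact (L.integral_comp_comm hg).symm

theorem LevyTriplet.lintegral_enorm_sq_lt_top
    (h2 : ∫⁻ x in {x : E d | 1 < ‖x‖}, ‖x‖ₑ ^ 2 ∂T.nu < ⊤) : ∫⁻ x, ‖x‖ₑ ^ 2 ∂T.nu < ⊤ := by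
  have h := (T.integrable_sq h2).2
  rw [HasFiniteIntegral] at h
  simpa using h

/-- The drift function in the first integrability condition. -/
noncomputable def drift (T : LevyTriplet d) (M : Matrix (Fin n) (Fin d) ℝ) : E n :=
  app M T.gam + ∫ x, ((if ‖app M x‖ ≤ 1 then (1 : ℝ) else 0)
      - (if ‖x‖ ≤ 1 then (1 : ℝ) else 0)) • app M x ∂T.nu

/-- The mean of the jumps that are large after an application of the matrix. -/
noncomputable def largeMean (T : LevyTriplet d) (M : Matrix (Fin n) (Fin d) ℝ) : E n :=
  ∫ x, (if ‖app M x‖ ≤ 1 then (0 : ℝ) else 1) • app M x ∂T.nu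

/-- Where `‖Mx‖ > 1`, `‖Mx‖ ≤ ‖Mx‖²`; this trades a first power for a square integrable quantity. -/
theorem enorm_large_le (M : Matrix (Fin n) (Fin d) ℝ) (x : E d) :
    ‖(if ‖app M x‖ ≤ 1 then (0 : ℝ) else 1) • app M x‖ₑ ≤ ‖M‖ₑ ^ 2 * ‖x‖ₑ ^ 2 := by
  split_ifs with h
  · simp
  · rw [one_smul, ← mul_pow]
    have h1 : 1 ≤ ‖app M x‖ₑ := by
      rw [← ofReal_norm, ENNReal.one_le_ofReal]
      exact (not_le.1 h).le
    calc ‖app M x‖ₑ = ‖app M x‖ₑ ^ 1 := (pow_one _).symm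
      _ ≤ ‖app M x‖ₑ ^ 2 := pow_le_pow_right₀ h1 (by norm_num)
      _ ≤ _ := by
        gcongr
        exact enorm_app_le _ _

theorem measurableSet_app_le (M : Matrix (Fin n) (Fin d) ℝ) :
    MeasurableSet {x : E d | ‖app M x‖ ≤ 1} :=
  measurableSet_le (LevyTriplet.continuous_app M).norm.measurable measurable_const

theorem measurable_app (M : Matrix (Fin n) (Fin d) ℝ) : Measurable (app M) :=
  (LevyTriplet.continuous_app M).measurable

theorem measurable_ite_smul_app (M : Matrix (Fin n) (Fin d) ℝ) (a b : ℝ) :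
    Measurable fun x : E d => (if ‖app M x‖ ≤ 1 then a else b) • app M x :=
  (Measurable.ite (measurableSet_app_le M) measurable_const measurable_const :
    Measurable fun x : E d => if ‖app M x‖ ≤ 1 then a else b).smul (measurable_app M)

theorem enorm_largeMean_le (M : Matrix (Fin n) (Fin d) ℝ) :
    ‖largeMean T M‖ₑ ≤ ‖M‖ₑ ^ 2 * ∫⁻ x, ‖x‖ₑ ^ 2 ∂T.nu := by
  refine (enorm_integral_le_lintegral_enorm _).trans ?_
  rw [← lintegral_const_mul' _ _ (ENNReal.pow_ne_top enorm_ne_top)]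
  exact lintegral_mono (enorm_large_le M)

/-- The two truncations combine: jumps with `‖x‖ > 1` turn `γ` into the mean, and only jumps with
`‖Mx‖ > 1` remain to be subtracted. -/
theorem drift_eq_sub (h2 : ∫⁻ x in {x : E d | 1 < ‖x‖}, ‖x‖ₑ ^ 2 ∂T.nu < ⊤)
    (M : Matrix (Fin n) (Fin d) ℝ) : drift T M = app M T.mean - largeMean T M := by
  have hi1 : Integrable (fun x => (if ‖app M x‖ ≤ 1 then (0 : ℝ) else 1) • app M x) T.nu := by
    refine ⟨(measurable_ite_smul_app M 0 1).aestronglyMeasurable, ?_⟩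
    refine (lintegral_mono (enorm_large_le M)).trans_lt ?_
    rw [lintegral_const_mul' _ _ (ENNReal.pow_ne_top enorm_ne_top)]
    exact ENNReal.mul_lt_top (ENNReal.pow_lt_top enorm_lt_top)
      (LevyTriplet.lintegral_enorm_sq_lt_top h2)
  have hL := T.integrableOn_norm_of_sq h2
  have hi2 : Integrable ({x : E d | 1 < ‖x‖}.indicator fun x => x) T.nu :=
    (integrable_indicator_iff LevyTriplet.measurableSet_large).2 hL
  have e : ∀ x, ((if ‖app M x‖ ≤ 1 then (1 : ℝ) else 0) - (if ‖x‖ ≤ 1 then (1 : ℝ) else 0))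
      • app M x = app M ({x : E d | 1 < ‖x‖}.indicator (fun x => x) x)
        - (if ‖app M x‖ ≤ 1 then (0 : ℝ) else 1) • app M x := fun x => by
    simp only [Set.indicator_apply, Set.mem_ofPred_eq]
    by_cases hx : ‖x‖ ≤ 1
    · rw [if_pos hx, if_neg (not_lt.2 hx), app_zero_right]
      split_ifs <;> simp
    · rw [if_neg hx, if_pos (not_le.1 hx)]
      split_ifs <;> simp
  have hi3 : Integrable (fun x => app M ({x : E d | 1 < ‖x‖}.indicator (fun x => x) x)) T.nu :=
    Integrable.mono' (hi2.norm.const_mul ‖M‖)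
      ((LevyTriplet.continuous_app M).comp_aestronglyMeasurable hi2.1)
      (Eventually.of_forall fun x => norm_app_le _ _)
  rw [drift, integral_congr_ae (Eventually.of_forall e), integral_sub hi3 hi1, ← app_integral M hi2,
    integral_indicator LevyTriplet.measurableSet_large, LevyTriplet.mean, app_add_right, largeMean,
    add_sub_assoc]

theorem enorm_drift_le (h1 : ∫⁻ x, ‖x‖ₑ ∂T.nu < ⊤) (M : Matrix (Fin n) (Fin d) ℝ) :
    ‖drift T M‖ₑ ≤ ‖M‖ₑ * (‖T.gam0‖ₑ + ∫⁻ x, ‖x‖ₑ ∂T.nu) := by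
  have hi := T.integrable_id h1
  have hS : MeasurableSet {x : E d | ‖x‖ ≤ 1} := measurableSet_le measurable_norm measurable_const
  have hi2 : Integrable ({x : E d | ‖x‖ ≤ 1}.indicator fun x => x) T.nu := hi.indicator hS
  have hb : ∀ x : E d, ‖(if ‖app M x‖ ≤ 1 then (1 : ℝ) else 0) • app M x‖ ≤ ‖M‖ * ‖x‖ := fun x => by
    refine le_trans ?_ (norm_app_le M x)
    split_ifs <;> simp
  have hi1 : Integrable (fun x => (if ‖app M x‖ ≤ 1 then (1 : ℝ) else 0) • app M x) T.nu :=
    Integrable.mono' (hi.norm.const_mul ‖M‖)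
      (measurable_ite_smul_app M 1 0).aestronglyMeasurable (Eventually.of_forall hb)
  have hi3 : Integrable (fun x => app M ({x : E d | ‖x‖ ≤ 1}.indicator (fun x => x) x)) T.nu :=
    Integrable.mono' (hi2.norm.const_mul ‖M‖)
      ((LevyTriplet.continuous_app M).comp_aestronglyMeasurable hi2.1)
      (Eventually.of_forall fun x => norm_app_le _ _)
  have e : ∀ x, ((if ‖app M x‖ ≤ 1 then (1 : ℝ) else 0) - (if ‖x‖ ≤ 1 then (1 : ℝ) else 0))
      • app M x = (if ‖app M x‖ ≤ 1 then (1 : ℝ) else 0) • app M x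
        - app M ({x : E d | ‖x‖ ≤ 1}.indicator (fun x => x) x) := fun x => by
    simp only [Set.indicator_apply, Set.mem_ofPred_eq]
    rw [sub_smul]
    split_ifs <;> simp [app_zero_right]
  have hd : drift T M = app M T.gam0
      + ∫ x, (if ‖app M x‖ ≤ 1 then (1 : ℝ) else 0) • app M x ∂T.nu := by
    rw [drift, integral_congr_ae (Eventually.of_forall e), integral_sub hi1 hi3,
      ← app_integral M hi2, integral_indicator hS, LevyTriplet.gam0, app_sub_right]
    abel
  rw [hd, mul_add]
  refine (enorm_add_le _ _).trans (add_le_add (enorm_app_le _ _) ?_)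
  refine (enorm_integral_le_lintegral_enorm _).trans ?_
  rw [← lintegral_const_mul' _ _ enorm_ne_top]
  refine lintegral_mono fun x => ?_
  rw [← ofReal_norm, ← ofReal_norm, ← ofReal_norm, ← ENNReal.ofReal_mul (norm_nonneg _)]
  exact ENNReal.ofReal_le_ofReal (hb x)

variable {S : Type*} [MeasurableSpace S] {π : Measure S}
  {f : S × ℝ → Matrix (Fin n) (Fin d) ℝ}

theorem lintegral_enorm_sq_lt_top_of_memLp {α V : Type*} [MeasurableSpace α]
    [NormedAddCommGroup V] {μ : Measure α} {g : α → V} (hg : MemLp g 2 μ) :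
    ∫⁻ x, ‖g x‖ₑ ^ 2 ∂μ < ⊤ := by
  have h := lintegral_rpow_enorm_lt_top_of_eLpNorm_lt_top two_ne_zero ENNReal.ofNat_ne_top hg.2
  simpa using h

theorem lintegral_enorm_lt_top_of_memLp {α V : Type*} [MeasurableSpace α]
    [NormedAddCommGroup V] {μ : Measure α} {g : α → V} (hg : MemLp g 1 μ) :
    ∫⁻ x, ‖g x‖ₑ ∂μ < ⊤ := by
  rw [← eLpNorm_one_eq_lintegral_enorm]
  exact hg.2

/-- The drift function and `app (f q) T.mean` differ by at most a multiple of `‖f q‖²`, which is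
integrable for a square integrable kernel. -/
theorem driftCond_iff (h2 : ∫⁻ x in {x : E d | 1 < ‖x‖}, ‖x‖ₑ ^ 2 ∂T.nu < ⊤)
    (hf : MemLp f 2 (halfMeasure π)) :
    DriftCond π T f ↔ Integrable (fun q => app (f q) T.mean) (halfMeasure π) := by
  have hm : AEStronglyMeasurable (fun q => app (f q) T.mean) (halfMeasure π) :=
    (continuous_app_left T.mean).comp_aestronglyMeasurable hf.1
  have hR : ∫⁻ q, ‖f q‖ₑ ^ 2 * ∫⁻ x, ‖x‖ₑ ^ 2 ∂T.nu ∂(halfMeasure π) < ⊤ := by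
    rw [lintegral_mul_const' _ _ (LevyTriplet.lintegral_enorm_sq_lt_top h2).ne]
    exact ENNReal.mul_lt_top (lintegral_enorm_sq_lt_top_of_memLp hf)
      (LevyTriplet.lintegral_enorm_sq_lt_top h2)
  have hRm : AEMeasurable (fun q => ‖f q‖ₑ ^ 2 * ∫⁻ x, ‖x‖ₑ ^ 2 ∂T.nu) (halfMeasure π) :=
    (hf.1.enorm.pow_const 2).mul_const _
  have hdef : DriftCond π T f ↔ ∫⁻ q, ‖drift T (f q)‖ₑ ∂(halfMeasure π) < ⊤ := Iff.rfl
  rw [hdef]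
  constructor
  · intro h
    refine ⟨hm, ?_⟩
    calc ∫⁻ q, ‖app (f q) T.mean‖ₑ ∂(halfMeasure π)
        ≤ ∫⁻ q, (‖drift T (f q)‖ₑ + ‖f q‖ₑ ^ 2 * ∫⁻ x, ‖x‖ₑ ^ 2 ∂T.nu) ∂(halfMeasure π) := by
          refine lintegral_mono fun q => ?_
          have e : app (f q) T.mean = drift T (f q) + largeMean T (f q) := by
            rw [drift_eq_sub h2, sub_add_cancel]
          rw [e]
          exact (enorm_add_le _ _).trans (add_le_add le_rfl (enorm_largeMean_le _))
      _ < ⊤ := by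
          rw [lintegral_add_right' _ hRm]
          exact ENNReal.add_lt_top.2 ⟨h, hR⟩
  · intro h
    calc ∫⁻ q, ‖drift T (f q)‖ₑ ∂(halfMeasure π)
        ≤ ∫⁻ q, (‖app (f q) T.mean‖ₑ + ‖f q‖ₑ ^ 2 * ∫⁻ x, ‖x‖ₑ ^ 2 ∂T.nu) ∂(halfMeasure π) := by
          refine lintegral_mono fun q => ?_
          rw [drift_eq_sub h2]
          exact enorm_sub_le.trans (add_le_add le_rfl (enorm_largeMean_le _))
      _ < ⊤ := by
          rw [lintegral_add_right' _ hRm]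
          exact ENNReal.add_lt_top.2 ⟨h.2, hR⟩

theorem driftCond_of_memLp_one (h1 : ∫⁻ x, ‖x‖ₑ ∂T.nu < ⊤) (hf : MemLp f 1 (halfMeasure π)) :
    DriftCond π T f := by
  have hK : ‖T.gam0‖ₑ + ∫⁻ x, ‖x‖ₑ ∂T.nu < ⊤ := ENNReal.add_lt_top.2 ⟨enorm_lt_top, h1⟩
  refine (lintegral_mono fun q => enorm_drift_le h1 (f q)).trans_lt ?_
  rw [lintegral_mul_const' _ _ hK.ne]
  exact ENNReal.mul_lt_top (lintegral_enorm_lt_top_of_memLp hf) hK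

theorem gaussCond_of_memLp_two (hf : MemLp f 2 (halfMeasure π)) : GaussCond π T f := by
  have hb : ∀ q, ‖f q * T.sig * (f q)ᵀ‖ₑ ≤ ‖f q‖ₑ ^ 2 * ‖T.sig‖ₑ := fun q => by
    have h : ‖(f q)ᵀ‖ = ‖f q‖ := by
      rw [← Matrix.conjTranspose_eq_transpose_of_trivial, Matrix.l2_opNorm_conjTranspose]
    rw [← ofReal_norm, ← ofReal_norm, ← ofReal_norm, ← ENNReal.ofReal_pow (norm_nonneg _),
      ← ENNReal.ofReal_mul (by positivity)]
    refine ENNReal.ofReal_le_ofReal ?_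
    calc _ ≤ ‖f q * T.sig‖ * ‖(f q)ᵀ‖ := Matrix.l2_opNorm_mul _ _
      _ ≤ ‖f q‖ * ‖T.sig‖ * ‖f q‖ := by
        rw [h]
        gcongr
        exact Matrix.l2_opNorm_mul _ _
      _ = _ := by ring
  refine (lintegral_mono hb).trans_lt ?_
  rw [lintegral_mul_const' _ _ enorm_ne_top]
  exact ENNReal.mul_lt_top (lintegral_enorm_sq_lt_top_of_memLp hf) enorm_lt_top

theorem gaussCond_of_sig_eq_zero (hs : T.sig = 0) : GaussCond π T f := by
  simp [GaussCond, hs]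

theorem jumpCond_of_memLp_two (h2 : ∫⁻ x in {x : E d | 1 < ‖x‖}, ‖x‖ₑ ^ 2 ∂T.nu < ⊤)
    (hf : MemLp f 2 (halfMeasure π)) : JumpCond π T f := by
  have hK := LevyTriplet.lintegral_enorm_sq_lt_top h2
  have hb : ∀ q, ∫⁻ x, min 1 (‖app (f q) x‖ₑ ^ 2) ∂T.nu ≤ ‖f q‖ₑ ^ 2 * ∫⁻ x, ‖x‖ₑ ^ 2 ∂T.nu :=
    fun q => by
      rw [← lintegral_const_mul' _ _ (ENNReal.pow_ne_top enorm_ne_top)]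
      refine lintegral_mono fun x => (min_le_right _ _).trans ?_
      rw [← mul_pow]
      gcongr
      exact enorm_app_le _ _
  refine (lintegral_mono hb).trans_lt ?_
  rw [lintegral_mul_const' _ _ hK.ne]
  exact ENNReal.mul_lt_top (lintegral_enorm_sq_lt_top_of_memLp hf) hK

theorem jumpCond_of_memLp_one (h1 : ∫⁻ x, ‖x‖ₑ ∂T.nu < ⊤) (hf : MemLp f 1 (halfMeasure π)) :
    JumpCond π T f := by
  -- This lets an `L¹` kernel and a first moment of the jumps suffice.
  have hmin : ∀ y : ℝ≥0∞, min 1 (y ^ 2) ≤ y := fun y => by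
    rcases le_total y 1 with hy | hy
    · exact (min_le_right _ _).trans (pow_le_of_le_one zero_le hy two_ne_zero)
    · exact (min_le_left _ _).trans hy
  have hb : ∀ q, ∫⁻ x, min 1 (‖app (f q) x‖ₑ ^ 2) ∂T.nu ≤ ‖f q‖ₑ * ∫⁻ x, ‖x‖ₑ ∂T.nu :=
    fun q => by
      rw [← lintegral_const_mul' _ _ enorm_ne_top]
      exact lintegral_mono fun x => (hmin _).trans (enorm_app_le _ _)
  refine (lintegral_mono hb).trans_lt ?_
  rw [lintegral_mul_const' _ _ h1.ne]
  exact ENNReal.mul_lt_top (lintegral_enorm_lt_top_of_memLp hf) h1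

end Conditions

/-! ### Moments of the underlying Lévy process -/

section LevyOne

variable {Ω S : Type*} [MeasurableSpace Ω] [MeasurableSpace S]
  {P : Measure Ω} {π : Measure S} [IsProbabilityMeasure P] [IsProbabilityMeasure π]
  {d : ℕ} {T : LevyTriplet d} {Λ : Set (S × ℝ) → Ω → E d}

theorem measurableSet_unitStrip : MeasurableSet ((Set.univ : Set S) ×ˢ Set.Ioc (0 : ℝ) 1) :=
  MeasurableSet.univ.prod measurableSet_Ioc

theorem isBddBorel_unitStrip : IsBddBorel ((Set.univ : Set S) ×ˢ Set.Ioc (0 : ℝ) 1) :=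
  ⟨measurableSet_unitStrip, 1, fun p hp => abs_le.2 ⟨by linarith [hp.2.1], hp.2.2⟩⟩

theorem measure_unitStrip :
    (π.prod volume) ((Set.univ : Set S) ×ˢ Set.Ioc (0 : ℝ) 1) = 1 := by
  rw [Measure.prod_prod, measure_univ, Real.volume_Ioc]
  simp

/-- The variable `⟨a, L₁⟩` is the scalar integral of `a` times the indicator of the unit strip, a
set of measure one. -/
theorem IsLevyBasis.inner_levyOne_moments (hΛ : IsLevyBasis P π T Λ)
    (h2 : ∫⁻ x in {x : E d | 1 < ‖x‖}, ‖x‖ₑ ^ 2 ∂T.nu < ⊤) (a : E d) :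
    MemLp (fun ω => (inner ℝ a (levyOne Λ ω) : ℝ)) 2 P ∧
      ∫ ω, (inner ℝ a (levyOne Λ ω) : ℝ) ∂P = inner ℝ a T.mean ∧
      ∫ ω, (inner ℝ a (levyOne Λ ω) : ℝ) ^ 2 ∂P
        = inner ℝ a (app T.sigL a) + (inner ℝ a T.mean) ^ 2 := by
  set B : Set (S × ℝ) := Set.univ ×ˢ Set.Ioc (0 : ℝ) 1 with hB
  have hBm : MeasurableSet B := measurableSet_unitStrip
  let φ : SimpleFunc (S × ℝ) (E d) := (SimpleFunc.const (S × ℝ) a).restrict B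
  have hφp : ∀ p, φ p = B.indicator (fun _ => a) p := fun p => by
    rw [SimpleFunc.restrict_apply _ hBm]
    rfl
  have hφ : HasBddSupport φ := by
    obtain ⟨-, N, hN⟩ := isBddBorel_unitStrip (S := S)
    refine ⟨N, fun p hp => ?_⟩
    rw [hφp, Set.indicator_of_notMem]
    exact fun h => not_lt.2 (hN p h) hp
  have hs : sInt Λ φ =ᵐ[P] fun ω => inner ℝ a (levyOne Λ ω) := by
    have h := hΛ.sInt_eq_sum (φ := φ) ({()} : Finset Unit) (fun _ => B) (fun _ => a)
      (fun _ _ _ => isBddBorel_unitStrip) (by simp [Set.PairwiseDisjoint])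
      (fun _ _ p hp => by rw [hφp, Set.indicator_of_mem hp]) (fun p hp => ⟨(), by simp, by
        by_contra h
        exact hp (by rw [hφp, Set.indicator_of_notMem h])⟩)
    filter_upwards [h] with ω hω
    rw [hω, Finset.sum_singleton]
    rfl
  have hintg : ∀ g : E d → ℝ, g 0 = 0 → ∫ p, g (φ p) ∂(π.prod volume) = g a := fun g hg => by
    have e : (fun p => g (φ p)) = B.indicator fun _ => g a := by
      ext1 p
      rw [hφp]
      by_cases hp : p ∈ B
      · rw [Set.indicator_of_mem hp, Set.indicator_of_mem hp]
      · rw [Set.indicator_of_notMem hp, Set.indicator_of_notMem hp, hg]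
    rw [e, integral_indicator hBm, setIntegral_const, measureReal_def, measure_unitStrip]
    simp
  obtain ⟨hm, h1, hsq⟩ := hΛ.sInt_moments h2 hφ
  rw [hintg (fun x => inner ℝ x T.mean) (inner_zero_left _)] at h1 hsq
  rw [hintg (fun x => inner ℝ x (app T.sigL x)) (inner_zero_left _)] at hsq
  refine ⟨(memLp_congr_ae hs).1 hm, ?_, ?_⟩
  · rw [← integral_congr_ae hs, h1]
  · rw [← hsq]
    refine integral_congr_ae ?_
    filter_upwards [hs] with ω hω
    rw [hω]

theorem inner_single_eq {k : ℕ} (x : E k) (i : Fin k) :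
    (inner ℝ (EuclideanSpace.single i (1 : ℝ)) x : ℝ) = x i := by
  simp [EuclideanSpace.inner_single_left]

theorem memLp_of_apply {α : Type*} [MeasurableSpace α] {μ : Measure α} {k : ℕ} {p : ℝ≥0∞}
    {Z : α → E k} (h : ∀ i, MemLp (fun ω => Z ω i) p μ) : MemLp Z p μ := by
  have hx : Z = fun ω => ∑ i, Z ω i • (EuclideanSpace.single i (1 : ℝ) : E k) := by
    ext ω j
    simp [Pi.single_apply]
  rw [hx]
  exact memLp_finsetSum _ fun i _ => (ContinuousLinearMap.toSpanSingleton ℝ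
    (EuclideanSpace.single i (1 : ℝ) : E k)).comp_memLp' (h i)

theorem LevyTriplet.sigL_symm (T : LevyTriplet d) (i j : Fin d) : T.sigL i j = T.sigL j i := by
  have h : T.sig i j = T.sig j i := by
    have := T.sig_posSemidef.isHermitian.apply i j
    simpa using this.symm
  rw [LevyTriplet.sigL, Matrix.add_apply, Matrix.add_apply, h, Matrix.of_apply, Matrix.of_apply]
  simp_rw [mul_comm]

theorem inner_single_app (M : Matrix (Fin d) (Fin d) ℝ) (i j : Fin d) :
    (inner ℝ (EuclideanSpace.single i (1 : ℝ)) (app M (EuclideanSpace.single j (1 : ℝ))) : ℝ)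
      = M i j := by
  rw [inner_single_eq, app_apply]
  simp

theorem integral_add_sq {α : Type*} [MeasurableSpace α] {μ : Measure α} {U V : α → ℝ}
    (hU : MemLp U 2 μ) (hV : MemLp V 2 μ) : ∫ x, (U x + V x) ^ 2 ∂μ
      = ∫ x, U x ^ 2 ∂μ + 2 * ∫ x, U x * V x ∂μ + ∫ x, V x ^ 2 ∂μ := by
  have hUV : Integrable (fun x => 2 * (U x * V x)) μ := (hU.integrable_mul hV).const_mul 2
  have hs : Integrable (fun x => U x ^ 2 + 2 * (U x * V x)) μ := hU.integrable_sq.add hUV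
  rw [← integral_const_mul, ← integral_add hU.integrable_sq hUV, ← integral_add hs hV.integrable_sq]
  refine integral_congr_ae (Eventually.of_forall fun x => ?_)
  simp only
  ring

theorem IsLevyBasis.memLp_levyOne (hΛ : IsLevyBasis P π T Λ)
    (h2 : ∫⁻ x in {x : E d | 1 < ‖x‖}, ‖x‖ₑ ^ 2 ∂T.nu < ⊤) : MemLp (levyOne Λ) 2 P :=
  memLp_of_apply fun i => by
    have := (hΛ.inner_levyOne_moments h2 (EuclideanSpace.single i 1)).1
    simpa only [inner_single_eq] using this

theorem IsLevyBasis.integral_levyOne (hΛ : IsLevyBasis P π T Λ)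
    (h2 : ∫⁻ x in {x : E d | 1 < ‖x‖}, ‖x‖ₑ ^ 2 ∂T.nu < ⊤) : ∫ ω, levyOne Λ ω ∂P = T.mean := by
  refine ext_inner_left ℝ fun a => ?_
  rw [← integral_inner ((hΛ.memLp_levyOne h2).integrable (by norm_num))]
  exact (hΛ.inner_levyOne_moments h2 a).2.1

theorem IsLevyBasis.integral_levyOne_mul (hΛ : IsLevyBasis P π T Λ)
    (h2 : ∫⁻ x in {x : E d | 1 < ‖x‖}, ‖x‖ₑ ^ 2 ∂T.nu < ⊤) (i j : Fin d) :
    ∫ ω, levyOne Λ ω i * levyOne Λ ω j ∂P = T.sigL i j + T.mean i * T.mean j := by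
  let e : Fin d → E d := fun i => EuclideanSpace.single i 1
  have he : ∀ i (x : E d), (inner ℝ (e i) x : ℝ) = x i := fun i x => inner_single_eq x i
  have hm : ∀ i, MemLp (fun ω => levyOne Λ ω i) 2 P := fun i => by
    have := (hΛ.inner_levyOne_moments h2 (e i)).1
    simpa only [he] using this
  -- Polarisation: mixed moments are recovered from the second moments in the directions `e i`, `e
  -- j` and `e i + e j`, by symmetry of `Σ_L`.
  have h3 := (hΛ.inner_levyOne_moments h2 (e i + e j)).2.2
  have hi := (hΛ.inner_levyOne_moments h2 (e i)).2.2
  have hj := (hΛ.inner_levyOne_moments h2 (e j)).2.2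
  simp_rw [inner_add_left, app_add_right, inner_add_right] at h3
  simp only [he] at h3 hi hj
  have hs : ∀ k l, app T.sigL (e l) k = T.sigL k l := fun k l => by
    rw [← he k]
    exact inner_single_app _ _ _
  simp only [hs] at h3 hi hj
  have hexp := integral_add_sq (hm i) (hm j)
  have hsym := T.sigL_symm i j
  linarith

theorem IsLevyBasis.covariance_levyOne (hΛ : IsLevyBasis P π T Λ)
    (h2 : ∫⁻ x in {x : E d | 1 < ‖x‖}, ‖x‖ₑ ^ 2 ∂T.nu < ⊤) (i j : Fin d) :
    cov[fun ω => levyOne Λ ω i, fun ω => levyOne Λ ω j; P] = T.sigL i j := by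
  have hm : ∀ i, MemLp (fun ω => levyOne Λ ω i) 2 P := fun i => by
    have := (hΛ.inner_levyOne_moments h2 (EuclideanSpace.single i 1)).1
    simpa only [inner_single_eq] using this
  have h1 : ∀ i, ∫ ω, levyOne Λ ω i ∂P = T.mean i := fun i => by
    have := (hΛ.inner_levyOne_moments h2 (EuclideanSpace.single i 1)).2.1
    simpa only [inner_single_eq] using this
  rw [covariance_eq_sub (hm i) (hm j), h1, h1]
  have := hΛ.integral_levyOne_mul h2 i j
  simp only [Pi.mul_apply]
  linarith

/-- A second moment may be absent here, so integrability comes from the absolute moment bound and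
the mean from the first derivative of the characteristic function. -/
theorem IsLevyBasis.integral_levyOne_of_integrable (hΛ : IsLevyBasis P π T Λ) (hs : T.sig = 0)
    (h1 : ∫⁻ x, ‖x‖ₑ ∂T.nu < ⊤) (a : E d) :
    ∫ ω, (inner ℝ a (levyOne Λ ω) : ℝ) ∂P = inner ℝ a T.mean := by
  have hm := hΛ.measurable _ (isBddBorel_unitStrip (S := S))
  have hintg : Integrable (fun ω => (inner ℝ a (levyOne Λ ω) : ℝ)) P := by
    refine ⟨(hm.const_inner (c := a)).aestronglyMeasurable, ?_⟩
    refine (hΛ.lintegral_inner_le hs h1 isBddBorel_unitStrip a).trans_lt ?_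
    rw [measure_unitStrip, one_mul]
    refine ENNReal.mul_lt_top absConst_ne_top.lt_top ((absIntensity_le a).trans_lt ?_)
    exact ENNReal.mul_lt_top enorm_lt_top (ENNReal.add_lt_top.2 ⟨h1, enorm_lt_top⟩)
  refine integral_eq_of_charFun hintg (z := fun h => T.cumulant (h • a)) (fun h => ?_)
    (T.tendsto_cumulant_re a) (T.tendsto_cumulant_im_div (T.integrable_id h1).integrableOn a)
  have h3 := hΛ.charFun_eq _ isBddBorel_unitStrip (h • a)
  rw [charFun_apply, integral_map hm.aemeasurable (by fun_prop), measure_unitStrip] at h3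
  rw [ENNReal.toReal_one, Complex.ofReal_one, mul_one] at h3
  rw [← h3]
  refine integral_congr_ae (Eventually.of_forall fun ω => ?_)
  simp only
  rw [real_inner_smul_right, real_inner_comm]
  rfl

end LevyOne

/-! ### Existence and weak dependence of mixed moving averages -/

section MovingAverage

variable {Ω S : Type*} [MeasurableSpace Ω] [MeasurableSpace S]
  {P : Measure Ω} {π : Measure S} [IsProbabilityMeasure P] [IsProbabilityMeasure π]
  {n d : ℕ} {T : LevyTriplet d} {Λ : Set (S × ℝ) → Ω → E d}
  {f : S × ℝ → Matrix (Fin n) (Fin d) ℝ}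

theorem exists_isCausalMMA_of_memLp_two (hΛ : IsLevyBasis P π T Λ)
    (h2 : ∫⁻ x in {x : E d | 1 < ‖x‖}, ‖x‖ₑ ^ 2 ∂T.nu < ⊤)
    (hfm : ∀ a b, Measurable fun p => f p a b) (hf : MemLp f 2 (halfMeasure π))
    (hw : Integrable (fun q => app (f q) T.mean) (halfMeasure π)) :
    ∃ X, IsCausalMMA P π T Λ f X := by
  have h : ∀ t, ∃ Y, IsLevyIntegral P π Λ (causalKernel f t) Y := fun t => by
    rw [← tailKernel_zero]
    have hw' := memLp_comp_tailKernel (ψ := fun M => app M T.mean) (app_zero_left _)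
      (memLp_one_iff_integrable.2 hw) t le_rfl
    obtain ⟨Y, -, hY, -⟩ := exists_isLevyIntegral hΛ (p := 2) (by norm_num) (by norm_num)
      (hΛ.isLpBounded_two h2) (memLp_tailKernel hf t le_rfl) (memLp_one_iff_integrable.1 hw')
    exact ⟨Y, hY⟩
  choose X hX using h
  exact ⟨X, hfm, (driftCond_iff h2 hf).2 hw, gaussCond_of_memLp_two hf,
    jumpCond_of_memLp_two h2 hf, hX⟩

theorem exists_isCausalMMA_of_memLp_one (hΛ : IsLevyBasis P π T Λ) (hs : T.sig = 0)
    (h1 : ∫⁻ x, ‖x‖ₑ ∂T.nu < ⊤)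
    (hfm : ∀ a b, Measurable fun p => f p a b) (hf : MemLp f 1 (halfMeasure π)) :
    ∃ X, IsCausalMMA P π T Λ f X := by
  have h : ∀ t, ∃ Y, IsLevyIntegral P π Λ (causalKernel f t) Y := fun t => by
    rw [← tailKernel_zero]
    obtain ⟨Y, -, hY, -⟩ := exists_isLevyIntegral hΛ (p := 1) le_rfl (by norm_num)
      (hΛ.isLpBounded_one hs h1) (memLp_tailKernel hf t le_rfl)
      (by simp_rw [app_zero_right]; exact integrable_zero _ _ _)
    exact ⟨Y, hY⟩
  choose X hX using h
  exact ⟨X, hfm, driftCond_of_memLp_one h1 hf, gaussCond_of_sig_eq_zero hs,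
    jumpCond_of_memLp_one h1 hf, hX⟩

theorem integrable_trace (C : Matrix (Fin d) (Fin d) ℝ) {α : Type*} [MeasurableSpace α]
    {μ : Measure α} {g : α → Matrix (Fin n) (Fin d) ℝ} (hg : MemLp g 2 μ) :
    Integrable (fun q => (g q * C * (g q)ᵀ).trace) μ := by
  simp_rw [trace_eq_sum_inner]
  exact integrable_finsetSum _ fun i _ => integrable_inner_sigL hg _ _

theorem tailVar_eq (hf : MemLp f 2 (halfMeasure π)) {r : ℝ} (hr : 0 ≤ r) : tailVar π T f r
    = ∫ q in {q | r ≤ q.2}, (f q * T.sigL * (f q)ᵀ).trace ∂(π.prod volume) :=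
  integral_integral_Iic_neg (h := fun q => (f q * T.sigL * (f q)ᵀ).trace)
    (integrable_trace _ hf) hr

theorem tailMean_eq (hw : Integrable (fun q => app (f q) T.mean) (halfMeasure π)) {r : ℝ}
    (hr : 0 ≤ r) : tailMean π T f r = ∫ q in {q | r ≤ q.2}, app (f q) T.mean ∂(π.prod volume) :=
  integral_integral_Iic_neg hw hr

theorem tendsto_of_eq_setIntegral {V : Type*} [NormedAddCommGroup V] [NormedSpace ℝ V]
    {h : S × ℝ → V} (hh : Integrable h (halfMeasure π)) {θ : ℝ → V}
    (hθ : ∀ r, 0 ≤ r → θ r = ∫ q in {q | r ≤ q.2}, h q ∂(π.prod volume)) :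
    Tendsto θ atTop (𝓝 0) := by
  refine (tendsto_setIntegral_snd_ge hh).congr' ?_
  filter_upwards [eventually_ge_atTop 0] with r hr
  exact (hθ r hr).symm

/-- The variance of `‖Z‖` is nonnegative. -/
theorem integral_norm_le_sqrt {V : Type*} [NormedAddCommGroup V] {Z : Ω → V}
    (hZ : MemLp Z 2 P) : ∫ ω, ‖Z ω‖ ∂P ≤ Real.sqrt (∫ ω, ‖Z ω‖ ^ 2 ∂P) := by
  refine Real.le_sqrt_of_sq_le ?_
  have h := variance_nonneg (fun ω => ‖Z ω‖) P
  rw [variance_eq_sub hZ.norm] at h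
  simp only [Pi.pow_apply] at h
  linarith

theorem IsCausalMMA.isThetaWeaklyDependent_of_memLp_two (hΛ : IsLevyBasis P π T Λ)
    (h2 : ∫⁻ x in {x : E d | 1 < ‖x‖}, ‖x‖ₑ ^ 2 ∂T.nu < ⊤) (hf : MemLp f 2 (halfMeasure π))
    {X : ℝ → Ω → E n} (hX : IsCausalMMA P π T Λ f X) :
    IsThetaWeaklyDependent P X fun r =>
      Real.sqrt (tailVar π T f r + ‖tailMean π T f r‖ ^ 2) := by
  have hw := (driftCond_iff h2 hf).1 hX.drift
  refine isThetaWeaklyDependent_of_tail hΛ hX.integral ?_ (c := 1) fun t r hr Z hZ => ?_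
  · have h1 := tendsto_of_eq_setIntegral (integrable_trace T.sigL hf) fun r hr =>
      tailVar_eq (T := T) hf hr
    have h3 := tendsto_of_eq_setIntegral hw fun r hr => tailMean_eq hw hr
    have h4 := (h1.add (h3.norm.pow 2)).sqrt
    simpa using h4
  · have hw' := memLp_one_iff_integrable.1 (memLp_comp_tailKernel (ψ := fun M => app M T.mean)
      (app_zero_left _) (memLp_one_iff_integrable.2 hw) t hr)
    have hf' := memLp_tailKernel hf t hr
    have hm := (hZ.moments hΛ h2 hf' hw').1
    refine ⟨hm.integrable (by norm_num), ?_⟩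
    have h3 := integral_comp_tailKernel (π := π) (f := f)
      (ψ := fun M => (M * T.sigL * Mᵀ).trace) (by simp) t hr
    have h4 := integral_comp_tailKernel (π := π) (f := f) (ψ := fun M => app M T.mean)
      (app_zero_left _) t hr
    rw [one_mul, tailVar_eq hf hr, tailMean_eq hw hr, ← h3, ← h4, ← hZ.integral_norm_sq hΛ h2 hf' hw']
    exact integral_norm_le_sqrt hm

/-- Lipschitz in the matrix, with constant `∫ ‖x‖ dν`; this gives measurability of the intensity
along a measurable kernel. -/
theorem continuous_integral_norm_app (h1 : ∫⁻ x, ‖x‖ₑ ∂T.nu < ⊤) :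
    Continuous fun M : Matrix (Fin n) (Fin d) ℝ => ∫ x, ‖app M x‖ ∂T.nu := by
  have hi := T.integrable_id h1
  have hintg : ∀ M : Matrix (Fin n) (Fin d) ℝ, Integrable (fun x => ‖app M x‖) T.nu := fun M =>
    Integrable.mono' (hi.norm.const_mul ‖M‖) (measurable_app M).norm.aestronglyMeasurable
      (Eventually.of_forall fun x => by rw [norm_norm]; exact norm_app_le _ _)
  have hl : LipschitzWith (Real.toNNReal (∫ x, ‖x‖ ∂T.nu))
      fun M : Matrix (Fin n) (Fin d) ℝ => ∫ x, ‖app M x‖ ∂T.nu := by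
    refine LipschitzWith.of_dist_le_mul fun M N => ?_
    rw [Real.coe_toNNReal _ (integral_nonneg fun _ => norm_nonneg _), Real.dist_eq,
      ← integral_sub (hintg M) (hintg N), dist_eq_norm, mul_comm, ← integral_const_mul]
    refine abs_integral_le_integral_abs.trans (integral_mono ((hintg M).sub (hintg N)).abs
      (hi.norm.const_mul _) fun x => ?_)
    refine (abs_norm_sub_norm_le _ _).trans ?_
    rw [← app_sub_left]
    exact norm_app_le _ _
  exact hl.continuous

theorem integrable_integral_norm_app (h1 : ∫⁻ x, ‖x‖ₑ ∂T.nu < ⊤) {α : Type*} [MeasurableSpace α]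
    {μ : Measure α} {g : α → Matrix (Fin n) (Fin d) ℝ} (hg : Integrable g μ) :
    Integrable (fun q => ∫ x, ‖app (g q) x‖ ∂T.nu) μ := by
  have hi := T.integrable_id h1
  refine Integrable.mono' (hg.norm.mul_const (∫ x, ‖x‖ ∂T.nu))
    ((continuous_integral_norm_app h1).comp_aestronglyMeasurable hg.1)
    (Eventually.of_forall fun q => ?_)
  rw [Real.norm_of_nonneg (integral_nonneg fun _ => norm_nonneg _), ← integral_const_mul]
  exact integral_mono_of_nonneg (Eventually.of_forall fun _ => norm_nonneg _)
    (hi.norm.const_mul _) (Eventually.of_forall fun x => norm_app_le _ _)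

theorem integrable_norm_app {α : Type*} [MeasurableSpace α]
    {μ : Measure α} {g : α → Matrix (Fin n) (Fin d) ℝ} (hg : Integrable g μ) (w : E d) :
    Integrable (fun q => ‖app (g q) w‖) μ :=
  (Integrable.mono' (hg.norm.mul_const ‖w‖) ((continuous_app_left w).comp_aestronglyMeasurable hg.1)
    (Eventually.of_forall fun _ => norm_app_le _ _)).norm

theorem tailAbs_eq (h1 : ∫⁻ x, ‖x‖ₑ ∂T.nu < ⊤) (hf : MemLp f 1 (halfMeasure π)) {r : ℝ}
    (hr : 0 ≤ r) : tailAbs π T f r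
      = ∫ q in {q | r ≤ q.2}, (∫ x, ‖app (f q) x‖ ∂T.nu + ‖app (f q) T.gam0‖)
        ∂(π.prod volume) := by
  have hf' := memLp_one_iff_integrable.1 hf
  have ha := integrable_integral_norm_app h1 hf'
  have hb := integrable_norm_app hf' T.gam0
  rw [integral_add (integrableOn_snd_ge ha hr) (integrableOn_snd_ge hb hr),
    ← integral_integral_Iic_neg ha hr, ← integral_integral_Iic_neg hb hr]
  rfl

theorem IsCausalMMA.isThetaWeaklyDependent_of_memLp_one (hΛ : IsLevyBasis P π T Λ)
    (hs : T.sig = 0) (h1 : ∫⁻ x, ‖x‖ₑ ∂T.nu < ⊤) (hf : MemLp f 1 (halfMeasure π))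
    {X : ℝ → Ω → E n} (hX : IsCausalMMA P π T Λ f X) :
    IsThetaWeaklyDependent P X (tailAbs π T f) := by
  have hf' := memLp_one_iff_integrable.1 hf
  have hsum : Integrable (fun q => ∫ x, ‖app (f q) x‖ ∂T.nu + ‖app (f q) T.gam0‖)
      (halfMeasure π) := (integrable_integral_norm_app h1 hf').add (integrable_norm_app hf' T.gam0)
  refine isThetaWeaklyDependent_of_tail hΛ hX.integral
    (tendsto_of_eq_setIntegral hsum fun r hr => tailAbs_eq h1 hf hr)
    -- The factor `n` comes from estimating coordinate by coordinate, `absConst` from the absolute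
    -- moment bound.
    (c := n * absConst.toReal) fun t r hr Z hZ => ?_
  have hle := hZ.lintegral_norm_le hΛ hs h1 (memLp_tailKernel hf t hr)
  rw [lintegral_comp_tailKernel (ψ := fun M => ∫⁻ x, ‖app M x‖ₑ ∂T.nu + ‖app M T.gam0‖ₑ)
    (by simp [app_zero_left]) t hr] at hle
  have hintg : ∀ M : Matrix (Fin n) (Fin d) ℝ, Integrable (app M) T.nu := fun M =>
    Integrable.mono' ((T.integrable_id h1).norm.const_mul ‖M‖)
      (measurable_app M).aestronglyMeasurable (Eventually.of_forall fun x => norm_app_le _ _)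
  have e : ∀ q, ∫⁻ x, ‖app (f q) x‖ₑ ∂T.nu + ‖app (f q) T.gam0‖ₑ
      = ENNReal.ofReal (∫ x, ‖app (f q) x‖ ∂T.nu + ‖app (f q) T.gam0‖) := fun q => by
    rw [ENNReal.ofReal_add (integral_nonneg fun _ => norm_nonneg _) (norm_nonneg _),
      ofReal_integral_norm_eq_lintegral_enorm (hintg _), ofReal_norm]
  have hnn : ∀ q, 0 ≤ ∫ x, ‖app (f q) x‖ ∂T.nu + ‖app (f q) T.gam0‖ := fun q =>
    add_nonneg (integral_nonneg fun _ => norm_nonneg _) (norm_nonneg _)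
  simp_rw [e] at hle
  rw [← ofReal_integral_eq_lintegral_ofReal (integrableOn_snd_ge hsum hr)
    (Eventually.of_forall hnn), ← tailAbs_eq h1 hf hr] at hle
  have hfin : (n : ℝ≥0∞) * absConst * ENNReal.ofReal (tailAbs π T f r) ≠ ⊤ :=
    ENNReal.mul_ne_top (ENNReal.mul_ne_top (ENNReal.natCast_ne_top n) absConst_ne_top)
      ENNReal.ofReal_ne_top
  have hZi : Integrable Z P :=
    ⟨(hZ.aemeasurable hΛ).aestronglyMeasurable, hle.trans_lt hfin.lt_top⟩
  refine ⟨hZi, ?_⟩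
  have hθ : 0 ≤ tailAbs π T f r := by
    rw [tailAbs_eq h1 hf hr]
    exact integral_nonneg hnn
  rw [integral_norm_eq_lintegral_enorm hZi.1]
  refine (ENNReal.toReal_mono hfin hle).trans (le_of_eq ?_)
  rw [ENNReal.toReal_mul, ENNReal.toReal_mul, ENNReal.toReal_natCast, ENNReal.toReal_ofReal hθ]

end MovingAverage

/-! ### Covariances -/

section Covariance

variable {Ω S : Type*} [MeasurableSpace Ω] [MeasurableSpace S]
  {P : Measure Ω} {π : Measure S} [IsProbabilityMeasure P] [IsProbabilityMeasure π]
  {n d : ℕ} {T : LevyTriplet d} {Λ : Set (S × ℝ) → Ω → E d}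

theorem LevyTriplet.inner_sigL_comm (T : LevyTriplet d) (a b : E d) :
    (inner ℝ a (app T.sigL b) : ℝ) = inner ℝ b (app T.sigL a) := by
  have h : T.sigLᵀ = T.sigL := by
    ext i j
    exact T.sigL_symm j i
  rw [← inner_app_transpose, h, real_inner_comm]

/-- Polarisation: `Y + Y'` is an integral of `F + F'`, so its second moment is known, and
subtracting those of `Y` and `Y'` isolates the cross term. -/
theorem IsLevyIntegral.covariance_inner (hΛ : IsLevyBasis P π T Λ)
    (h2 : ∫⁻ x in {x : E d | 1 < ‖x‖}, ‖x‖ₑ ^ 2 ∂T.nu < ⊤)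
    {F F' : S × ℝ → Matrix (Fin n) (Fin d) ℝ} {Y Y' : Ω → E n}
    (hF : MemLp F 2 (π.prod volume)) (hw : Integrable (fun q => app (F q) T.mean) (π.prod volume))
    (hF' : MemLp F' 2 (π.prod volume))
    (hw' : Integrable (fun q => app (F' q) T.mean) (π.prod volume))
    (h : IsLevyIntegral P π Λ F Y) (h' : IsLevyIntegral P π Λ F' Y') (u : E n) :
    cov[fun ω => (inner ℝ u (Y ω) : ℝ), fun ω => (inner ℝ u (Y' ω) : ℝ); P]
      = ∫ q, (inner ℝ (app (F q)ᵀ u) (app T.sigL (app (F' q)ᵀ u)) : ℝ) ∂(π.prod volume) := by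
  obtain ⟨hY, hYu⟩ := h.moments hΛ h2 hF hw
  obtain ⟨hY', hYu'⟩ := h'.moments hΛ h2 hF' hw'
  have hsw : Integrable (fun q => app (F q + F' q) T.mean) (π.prod volume) := by
    simp_rw [app_add_left]
    exact hw.add hw'
  obtain ⟨-, hs⟩ := IsLevyIntegral.moments (F := fun q => F q + F' q) hΛ h2
    (hF.add hF') hsw (h.add hΛ h')
  have hA : MemLp (fun ω => (inner ℝ u (Y ω) : ℝ)) 2 P := hY.const_inner u
  have hA' : MemLp (fun ω => (inner ℝ u (Y' ω) : ℝ)) 2 P := hY'.const_inner u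
  have hsq := (hs u).2
  have hexp := integral_add_sq hA hA'
  have hmean : (inner ℝ u (∫ q, app (F q + F' q) T.mean ∂(π.prod volume)) : ℝ)
      = inner ℝ u (∫ q, app (F q) T.mean ∂(π.prod volume))
        + inner ℝ u (∫ q, app (F' q) T.mean ∂(π.prod volume)) := by
    simp_rw [app_add_left]
    rw [integral_add hw hw', inner_add_right]
  have hi := integrable_inner_sigL hF T.sigL u
  have hi' := integrable_inner_sigL hF' T.sigL u
  have hc : Integrable (fun q => (inner ℝ (app (F q)ᵀ u) (app T.sigL (app (F' q)ᵀ u)) : ℝ))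
      (π.prod volume) :=
    integrable_inner_of_memLp_two (memLp_app_transpose hF u)
      (memLp_app (memLp_app_transpose hF' u) _)
  have hquad : ∫ q, (inner ℝ (app (F q + F' q)ᵀ u) (app T.sigL (app (F q + F' q)ᵀ u)) : ℝ)
      ∂(π.prod volume)
      = ∫ q, (inner ℝ (app (F q)ᵀ u) (app T.sigL (app (F q)ᵀ u)) : ℝ) ∂(π.prod volume)
        + 2 * ∫ q, (inner ℝ (app (F q)ᵀ u) (app T.sigL (app (F' q)ᵀ u)) : ℝ) ∂(π.prod volume)
        + ∫ q, (inner ℝ (app (F' q)ᵀ u) (app T.sigL (app (F' q)ᵀ u)) : ℝ) ∂(π.prod volume) := by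
    have hs2 : Integrable (fun q => (inner ℝ (app (F q)ᵀ u) (app T.sigL (app (F q)ᵀ u)) : ℝ)
        + 2 * inner ℝ (app (F q)ᵀ u) (app T.sigL (app (F' q)ᵀ u))) (π.prod volume) :=
      hi.add (hc.const_mul 2)
    rw [← integral_const_mul, ← integral_add hi (hc.const_mul 2), ← integral_add hs2 hi']
    refine integral_congr_ae (Eventually.of_forall fun q => ?_)
    simp only [Matrix.transpose_add, app_add_left, app_add_right, inner_add_left, inner_add_right]
    rw [T.inner_sigL_comm (app (F' q)ᵀ u) (app (F q)ᵀ u)]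
    ring
  rw [hmean] at hsq
  simp_rw [inner_add_right] at hsq
  rw [covariance_eq_sub hA hA', (hYu u).1, (hYu' u).1]
  simp only [Pi.mul_apply]
  have h3 := (hYu u).2
  have h4 := (hYu' u).2
  nlinarith

end Covariance

/-! ### The supOU kernel -/

section SupOU

theorem norm_eq_abs_apply_zero (y : E 1) : ‖y‖ = |y 0| := by
  rw [EuclideanSpace.norm_eq]
  simp [Real.sqrt_sq_eq_abs]

theorem app_fin_one (M : Matrix (Fin 1) (Fin 1) ℝ) (x : E 1) : app M x 0 = M 0 0 * x 0 := by
  rw [app_apply]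
  simp

theorem inner_fin_one (x y : E 1) : (inner ℝ x y : ℝ) = x 0 * y 0 := by
  rw [inner_eq_sum]
  simp

/-- The entry of the supOU kernel. -/
noncomputable def supOUEntry (p : Set.Iio (0 : ℝ) × ℝ) : ℝ :=
  if 0 ≤ p.2 then Real.exp ((p.1 : ℝ) * p.2) else 0

theorem supOUKernel_apply (p : Set.Iio (0 : ℝ) × ℝ) (i j : Fin 1) :
    supOUKernel p i j = supOUEntry p := rfl

theorem supOUEntry_nonneg (p : Set.Iio (0 : ℝ) × ℝ) : 0 ≤ supOUEntry p := by
  unfold supOUEntry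
  split_ifs
  · exact (Real.exp_pos _).le
  · exact le_rfl

theorem supOUEntry_le_one (p : Set.Iio (0 : ℝ) × ℝ) : supOUEntry p ≤ 1 := by
  unfold supOUEntry
  split_ifs with h
  · exact Real.exp_le_one_iff.2 (mul_nonpos_of_nonpos_of_nonneg (le_of_lt p.1.2) h)
  · exact zero_le_one

theorem measurable_supOUEntry : Measurable supOUEntry :=
  Measurable.ite (measurableSet_le measurable_const measurable_snd) (by fun_prop) measurable_const

variable {π : Measure (Set.Iio (0 : ℝ))} [IsProbabilityMeasure π]

theorem integrable_supOUEntry (hπ : Integrable (fun A : Set.Iio (0 : ℝ) => -1 / (A : ℝ)) π) :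
    Integrable supOUEntry (halfMeasure π) := by
  have hs : ∀ A : Set.Iio (0 : ℝ), ∀ s ∈ Set.Ici (0 : ℝ), supOUEntry (A, s)
      = Real.exp ((A : ℝ) * s) := fun A s hs => if_pos hs
  have hi : ∀ A : Set.Iio (0 : ℝ), IntegrableOn (fun s : ℝ => Real.exp ((A : ℝ) * s))
      (Set.Ici 0) := fun A => (integrableOn_Ici_iff_integrableOn_Ioi (by simp)).2
        (integrableOn_exp_mul_Ioi A.2 0)
  rw [halfMeasure, integrable_prod_iff measurable_supOUEntry.aestronglyMeasurable]
  refine ⟨Eventually.of_forall fun A => ?_, ?_⟩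
  · exact (hi A).congr_fun (fun s h => (hs A s h).symm) measurableSet_Ici
  · refine hπ.congr (Eventually.of_forall fun A => ?_)
    simp only
    rw [setIntegral_congr_fun (g := fun s => Real.exp ((A : ℝ) * s)) measurableSet_Ici
      (fun s h => by
        simp only
        rw [Real.norm_of_nonneg (supOUEntry_nonneg _), hs A s h]),
      integral_Ici_eq_integral_Ioi, integral_exp_mul_Ioi A.2]
    simp

/-- The entry takes values in `[0, 1]`, so it dominates its square, and the single condition on
`-1/A` covers both the `L¹` and the `L²` cases. -/
theorem integrable_supOUEntry_sq (hπ : Integrable (fun A : Set.Iio (0 : ℝ) => -1 / (A : ℝ)) π) :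
    Integrable (fun p => supOUEntry p ^ 2) (halfMeasure π) := by
  refine (integrable_supOUEntry hπ).mono' (measurable_supOUEntry.pow_const 2).aestronglyMeasurable
    (Eventually.of_forall fun p => ?_)
  rw [Real.norm_of_nonneg (by positivity)]
  exact pow_le_of_le_one (supOUEntry_nonneg p) (supOUEntry_le_one p) two_ne_zero

theorem memLp_supOUKernel {p : ℝ≥0∞} (h : MemLp supOUEntry p (halfMeasure π)) :
    MemLp supOUKernel p (halfMeasure π) := by
  have e : supOUKernel = fun q => supOUEntry q • (Matrix.of fun _ _ => 1 :
      Matrix (Fin 1) (Fin 1) ℝ) := by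
    ext q i j
    simp [supOUKernel_apply]
  rw [e]
  exact (ContinuousLinearMap.toSpanSingleton ℝ (Matrix.of fun _ _ => 1 :
    Matrix (Fin 1) (Fin 1) ℝ)).comp_memLp' h

theorem memLp_one_supOUKernel (hπ : Integrable (fun A : Set.Iio (0 : ℝ) => -1 / (A : ℝ)) π) :
    MemLp supOUKernel 1 (halfMeasure π) :=
  memLp_supOUKernel (memLp_one_iff_integrable.2 (integrable_supOUEntry hπ))

theorem memLp_two_supOUKernel (hπ : Integrable (fun A : Set.Iio (0 : ℝ) => -1 / (A : ℝ)) π) :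
    MemLp supOUKernel 2 (halfMeasure π) :=
  memLp_supOUKernel ((memLp_two_iff_integrable_sq measurable_supOUEntry.aestronglyMeasurable).2
    (integrable_supOUEntry_sq hπ))

theorem measurable_supOUKernel (a b : Fin 1) : Measurable fun p => supOUKernel p a b :=
  measurable_supOUEntry

theorem integral_Ici_exp {a : ℝ} (ha : a < 0) (r : ℝ) :
    ∫ s in Set.Ici r, Real.exp (a * s) = -(Real.exp (a * r) / a) := by
  rw [integral_Ici_eq_integral_Ioi, integral_exp_mul_Ioi ha, neg_div]

theorem setIntegral_supOUEntry (hπ : Integrable (fun A : Set.Iio (0 : ℝ) => -1 / (A : ℝ)) π)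
    {r : ℝ} (hr : 0 ≤ r) : ∫ q in {q | r ≤ q.2}, supOUEntry q ∂(π.prod volume)
      = -∫ A : Set.Iio (0 : ℝ), Real.exp ((A : ℝ) * r) / (A : ℝ) ∂π := by
  have hi := integrableOn_snd_ge (integrable_supOUEntry hπ) hr
  rw [IntegrableOn, restrict_snd_ge] at hi
  rw [restrict_snd_ge, integral_prod _ hi, ← integral_neg]
  refine integral_congr_ae (Eventually.of_forall fun A => ?_)
  simp only
  rw [← integral_Ici_exp A.2]
  exact setIntegral_congr_fun measurableSet_Ici fun s hs => if_pos (hr.trans hs)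

/-- The case `t = 0` gives the tail variance at `r`, the case `r = 0` the covariance at lag `t`.
Only `2r + t` enters, which is why the tail variance at `r` is the covariance at lag `2r`. -/
theorem setIntegral_supOUEntry_mul (hπ : Integrable (fun A : Set.Iio (0 : ℝ) => -1 / (A : ℝ)) π)
    {r t : ℝ} (hr : 0 ≤ r) (ht : 0 ≤ t) :
    ∫ q in {q | r ≤ q.2}, supOUEntry q * supOUEntry (q.1, t + q.2) ∂(π.prod volume)
      = -(∫ A : Set.Iio (0 : ℝ), Real.exp ((A : ℝ) * (2 * r + t)) / (A : ℝ) ∂π) / 2 := by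
  have hm : Measurable fun q : Set.Iio (0 : ℝ) × ℝ => supOUEntry (q.1, t + q.2) :=
    measurable_supOUEntry.comp (by fun_prop)
  have hintg : Integrable (fun q : Set.Iio (0 : ℝ) × ℝ => supOUEntry q * supOUEntry (q.1, t + q.2))
      (halfMeasure π) := by
    refine (integrable_supOUEntry hπ).mono' (measurable_supOUEntry.mul hm).aestronglyMeasurable
      (Eventually.of_forall fun q => ?_)
    rw [Real.norm_of_nonneg (mul_nonneg (supOUEntry_nonneg _) (supOUEntry_nonneg _))]
    exact mul_le_of_le_one_right (supOUEntry_nonneg _) (supOUEntry_le_one _)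
  have hi := integrableOn_snd_ge hintg hr
  rw [IntegrableOn, restrict_snd_ge] at hi
  rw [restrict_snd_ge, integral_prod _ hi, ← integral_neg, ← integral_div]
  refine integral_congr_ae (Eventually.of_forall fun A => ?_)
  simp only
  have h2 : 2 * (A : ℝ) < 0 := by
    have : (A : ℝ) < 0 := A.2
    linarith
  have e : ∀ s ∈ Set.Ici r, supOUEntry (A, s) * supOUEntry (A, t + s)
      = Real.exp ((A : ℝ) * t) * Real.exp (2 * (A : ℝ) * s) := fun s hs => by
    have hs0 : 0 ≤ s := hr.trans hs
    rw [supOUEntry, supOUEntry, if_pos hs0, if_pos (add_nonneg ht hs0), ← Real.exp_add,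
      ← Real.exp_add]
    congr 1
    ring
  rw [setIntegral_congr_fun measurableSet_Ici e, integral_const_mul, integral_Ici_exp h2,
    mul_add, Real.exp_add, show 2 * (A : ℝ) * r = (A : ℝ) * (2 * r) by ring]
  have : (A : ℝ) ≠ 0 := ne_of_lt A.2
  field_simp

variable {T : LevyTriplet 1}

theorem trace_supOUKernel (C : Matrix (Fin 1) (Fin 1) ℝ) (q : Set.Iio (0 : ℝ) × ℝ) :
    (supOUKernel q * C * (supOUKernel q)ᵀ).trace = C 0 0 * (supOUEntry q * supOUEntry q) := by
  simp [Matrix.trace, Matrix.mul_apply, supOUKernel_apply]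
  ring

theorem tailVar_supOU (hπ : Integrable (fun A : Set.Iio (0 : ℝ) => -1 / (A : ℝ)) π)
    {r : ℝ} (hr : 0 ≤ r) : tailVar π T supOUKernel r = -(T.sigL 0 0)
      * (∫ A : Set.Iio (0 : ℝ), Real.exp ((A : ℝ) * (2 * r)) / (A : ℝ) ∂π) / 2 := by
  rw [tailVar_eq (memLp_two_supOUKernel hπ) hr]
  simp_rw [trace_supOUKernel]
  rw [integral_const_mul]
  have h := setIntegral_supOUEntry_mul hπ hr le_rfl
  simp only [zero_add, Prod.mk.eta, add_zero] at h
  rw [h]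
  ring

theorem integrable_app_supOUKernel (hπ : Integrable (fun A : Set.Iio (0 : ℝ) => -1 / (A : ℝ)) π)
    (w : E 1) : Integrable (fun q => app (supOUKernel q) w) (halfMeasure π) := by
  have h := memLp_one_iff_integrable.1 (memLp_one_supOUKernel hπ)
  exact Integrable.mono' (h.norm.mul_const ‖w‖)
    ((continuous_app_left w).comp_aestronglyMeasurable h.1)
    (Eventually.of_forall fun _ => norm_app_le _ _)

theorem integral_apply_zero {α : Type*} [MeasurableSpace α] {μ : Measure α} {g : α → E 1}
    (hg : Integrable g μ) : (∫ x, g x ∂μ) 0 = ∫ x, g x 0 ∂μ := by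
  have h := integral_inner (𝕜 := ℝ) hg (EuclideanSpace.single 0 1)
  simpa only [inner_single_eq] using h.symm

theorem tailMean_supOU (hπ : Integrable (fun A : Set.Iio (0 : ℝ) => -1 / (A : ℝ)) π)
    {r : ℝ} (hr : 0 ≤ r) : ‖tailMean π T supOUKernel r‖ ^ 2 = (T.mean 0) ^ 2
      * (∫ A : Set.Iio (0 : ℝ), Real.exp ((A : ℝ) * r) / (A : ℝ) ∂π) ^ 2 := by
  have hw := integrable_app_supOUKernel hπ T.mean
  rw [norm_eq_abs_apply_zero, sq_abs, tailMean_eq hw hr,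
    integral_apply_zero (integrableOn_snd_ge hw hr)]
  simp_rw [app_fin_one, supOUKernel_apply]
  rw [integral_mul_const, setIntegral_supOUEntry hπ hr]
  ring

theorem tailAbs_supOU (hπ : Integrable (fun A : Set.Iio (0 : ℝ) => -1 / (A : ℝ)) π)
    (h1 : ∫⁻ x, ‖x‖ₑ ∂T.nu < ⊤) (hg : 0 ≤ T.gam0 0) (hn : T.nu {x | x 0 < 0} = 0)
    {r : ℝ} (hr : 0 ≤ r) : tailAbs π T supOUKernel r
      = -(T.mean 0) * ∫ A : Set.Iio (0 : ℝ), Real.exp ((A : ℝ) * r) / (A : ℝ) ∂π := by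
  have hae : ∀ᵐ x ∂T.nu, 0 ≤ x 0 := by
    rw [ae_iff]
    simpa only [not_le] using hn
  have hx : ∀ q, ∫ x, ‖app (supOUKernel q) x‖ ∂T.nu = supOUEntry q * ∫ x : E 1, x 0 ∂T.nu :=
    fun q => by
      rw [← integral_const_mul]
      refine integral_congr_ae ?_
      filter_upwards [hae] with x hx
      rw [norm_eq_abs_apply_zero, app_fin_one, supOUKernel_apply,
        abs_of_nonneg (mul_nonneg (supOUEntry_nonneg _) hx)]
  have hγ : ∀ q, ‖app (supOUKernel q) T.gam0‖ = supOUEntry q * T.gam0 0 := fun q => by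
    rw [norm_eq_abs_apply_zero, app_fin_one, supOUKernel_apply,
      abs_of_nonneg (mul_nonneg (supOUEntry_nonneg _) hg)]
  have hm : T.mean 0 = T.gam0 0 + ∫ x : E 1, x 0 ∂T.nu := by
    rw [T.mean_eq_gam0_add h1, PiLp.add_apply, integral_apply_zero (T.integrable_id h1)]
  rw [tailAbs_eq h1 (memLp_one_supOUKernel hπ) hr]
  simp_rw [hx, hγ, ← mul_add]
  rw [integral_mul_const, setIntegral_supOUEntry hπ hr, hm]
  ring

/-- Both summands of `σ²` are nonnegative. If they vanish then `Σ = 0` and `ν` is concentrated at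
the origin, which it does not charge. -/
theorem sigL_ne_zero (h2 : ∫⁻ x in {x : E 1 | 1 < ‖x‖}, ‖x‖ₑ ^ 2 ∂T.nu < ⊤)
    (h : T.sig ≠ 0 ∨ T.nu ≠ 0) : T.sigL 0 0 ≠ 0 := by
  intro h0
  have hsq : T.sigL 0 0 = T.sig 0 0 + ∫ x : E 1, x 0 * x 0 ∂T.nu := rfl
  have hs : 0 ≤ T.sig 0 0 := T.sig_posSemidef.diag_nonneg
  have hi : 0 ≤ ∫ x : E 1, x 0 * x 0 ∂T.nu := integral_nonneg fun x => mul_self_nonneg _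
  have hs0 : T.sig 0 0 = 0 := by linarith
  have hi0 : ∫ x : E 1, x 0 * x 0 ∂T.nu = 0 := by linarith
  rcases h with h | h
  · refine h ?_
    ext i j
    rw [Subsingleton.elim i 0, Subsingleton.elim j 0, hs0]
    rfl
  · refine h ?_
    rw [integral_eq_zero_iff_of_nonneg (fun x => mul_self_nonneg _)
      (T.integrable_mul_apply h2 0 0)] at hi0
    have hz : ∀ᵐ x ∂T.nu, x ∈ ({0} : Set (E 1)) := by
      filter_upwards [hi0] with x hx
      have hx0 : x 0 = 0 := mul_self_eq_zero.1 hx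
      rw [Set.mem_singleton_iff, ← norm_eq_zero, norm_eq_abs_apply_zero, hx0, abs_zero]
    rw [← Measure.measure_univ_eq_zero, ← Set.union_compl_self ({0} : Set (E 1))]
    exact measure_union_null T.nu_zero hz

variable {Ω : Type*} [MeasurableSpace Ω] {P : Measure Ω} [IsProbabilityMeasure P]
  {Λ : Set (Set.Iio (0 : ℝ) × ℝ) → Ω → E 1}

theorem IsCausalMMA.covariance_supOU (hΛ : IsLevyBasis P π T Λ)
    (hπ : Integrable (fun A : Set.Iio (0 : ℝ) => -1 / (A : ℝ)) π)
    (h2 : ∫⁻ x in {x : E 1 | 1 < ‖x‖}, ‖x‖ₑ ^ 2 ∂T.nu < ⊤) {X : ℝ → Ω → E 1}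
    (hX : IsCausalMMA P π T Λ supOUKernel X) {t : ℝ} (ht : 0 ≤ t) :
    cov[fun ω => X 0 ω 0, fun ω => X t ω 0; P] = -(T.sigL 0 0)
      * (∫ A : Set.Iio (0 : ℝ), Real.exp ((A : ℝ) * t) / (A : ℝ) ∂π) / 2 := by
  have hF : ∀ t, MemLp (causalKernel supOUKernel t) 2 (π.prod volume) := fun t => by
    rw [← tailKernel_zero]
    exact memLp_tailKernel (memLp_two_supOUKernel hπ) t le_rfl
  have hw : ∀ t, Integrable (fun q => app (causalKernel supOUKernel t q) T.mean)
      (π.prod volume) := fun t => by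
    rw [← tailKernel_zero]
    exact memLp_one_iff_integrable.1 (memLp_comp_tailKernel (ψ := fun M => app M T.mean)
      (app_zero_left _) (memLp_one_iff_integrable.2 (integrable_app_supOUKernel hπ T.mean)) t le_rfl)
  have h := (hX.integral 0).covariance_inner hΛ h2 (hF 0) (hw 0) (hF t) (hw t) (hX.integral t)
    (EuclideanSpace.single 0 1)
  simp only [inner_single_eq] at h
  rw [h]
  -- For `t ≥ 0` only times `s ≤ 0` contribute to both kernels; after reflection these are the
  -- points with nonnegative second coordinate.
  have e : ∀ q : Set.Iio (0 : ℝ) × ℝ,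
      (inner ℝ (app (causalKernel supOUKernel 0 q)ᵀ (EuclideanSpace.single 0 (1 : ℝ)))
        (app T.sigL (app (causalKernel supOUKernel t q)ᵀ (EuclideanSpace.single 0 (1 : ℝ)))) : ℝ)
      = T.sigL 0 0 * {q : Set.Iio (0 : ℝ) × ℝ | 0 ≤ q.2}.indicator
        (fun q => supOUEntry q * supOUEntry (q.1, t + q.2)) (reflect 0 q) := fun q => by
    rw [inner_fin_one, app_fin_one, app_fin_one, app_fin_one, reflect_apply]
    simp only [Matrix.transpose_apply, causalKernel, Set.indicator_apply, Set.mem_ofPred_eq]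
    by_cases hq : q.2 ≤ 0
    · rw [if_pos hq, if_pos (hq.trans ht), if_pos (by linarith)]
      simp only [supOUKernel_apply, zero_sub, ← sub_eq_add_neg]
      simp
      ring
    · rw [if_neg hq, if_neg (show ¬ 0 ≤ 0 - q.2 by linarith)]
      simp
  simp_rw [e]
  have h3 := setIntegral_supOUEntry_mul hπ (r := 0) le_rfl ht
  rw [integral_const_mul, (measurePreserving_reflect_equiv 0).integral_comp'
    (g := {q : Set.Iio (0 : ℝ) × ℝ | 0 ≤ q.2}.indicator
      fun q => supOUEntry q * supOUEntry (q.1, t + q.2)),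
    integral_indicator (measurableSet_snd_ge 0), h3, mul_zero, zero_add]
  ring

end SupOU

end MMA

/-! ### The main theorem. -/

theorem mainTheorem2
    {Ω : Type*} [MeasurableSpace Ω] (P : Measure Ω) [IsProbabilityMeasure P] :
    -- causal mixed moving averages
    (∀ (S : Type*) [TopologicalSpace S] [MeasurableSpace S] [BorelSpace S]
        (π : Measure S) [IsProbabilityMeasure π] (n d : ℕ) (T : MMA.LevyTriplet d)
        (Λ : Set (S × ℝ) → Ω → MMA.E d), MMA.IsLevyBasis P π T Λ →
      ∀ f : S × ℝ → Matrix (Fin n) (Fin d) ℝ, (∀ a b, Measurable fun p => f p a b) →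
        -- zero mean, square integrable
        (∫ ω, MMA.levyOne Λ ω ∂P = 0 →
          ∫⁻ x in {x : MMA.E d | 1 < ‖x‖}, ‖x‖ₑ ^ 2 ∂T.nu < ⊤ →
          MemLp f 2 (MMA.halfMeasure π) →
            (MemLp (MMA.levyOne Λ) 2 P ∧
              ∀ a b, ∫ ω, MMA.levyOne Λ ω a * MMA.levyOne Λ ω b ∂P = T.sigL a b) ∧
            (∃ X, MMA.IsCausalMMA P π T Λ f X) ∧
            ∀ X, MMA.IsCausalMMA P π T Λ f X →
              MMA.IsThetaWeaklyDependent P X fun r => Real.sqrt (MMA.tailVar π T f r)) ∧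
        -- square integrable, arbitrary mean
        (∫⁻ x in {x : MMA.E d | 1 < ‖x‖}, ‖x‖ₑ ^ 2 ∂T.nu < ⊤ →
          MMA.DriftCond π T f →
          MemLp f 2 (MMA.halfMeasure π) →
            (MemLp (MMA.levyOne Λ) 2 P ∧ ∫ ω, MMA.levyOne Λ ω ∂P = T.mean ∧
              ∀ a b, cov[fun ω => MMA.levyOne Λ ω a, fun ω => MMA.levyOne Λ ω b; P]
                = T.sigL a b) ∧
            (∃ X, MMA.IsCausalMMA P π T Λ f X) ∧
            ∀ X, MMA.IsCausalMMA P π T Λ f X →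
              MMA.IsThetaWeaklyDependent P X fun r =>
                Real.sqrt (MMA.tailVar π T f r + ‖MMA.tailMean π T f r‖ ^ 2)) ∧
        -- finite variation, finite mean
        (T.sig = 0 →
          ∫⁻ x, ‖x‖ₑ ∂T.nu < ⊤ →
          MemLp f 1 (MMA.halfMeasure π) →
            (∃ X, MMA.IsCausalMMA P π T Λ f X) ∧
            ∀ X, MMA.IsCausalMMA P π T Λ f X →
              MMA.IsThetaWeaklyDependent P X (MMA.tailAbs π T f))) ∧
    -- supOU processes
    (∀ (π : Measure (Set.Iio (0 : ℝ))) [IsProbabilityMeasure π] (T : MMA.LevyTriplet 1)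
        (Λ : Set (Set.Iio (0 : ℝ) × ℝ) → Ω → MMA.E 1), MMA.IsLevyBasis P π T Λ →
      Integrable (fun A : Set.Iio (0 : ℝ) => -1 / (A : ℝ)) π →
        -- zero mean, finite second moment
        (∫ ω, MMA.levyOne Λ ω ∂P = 0 →
          ∫⁻ x in {x : MMA.E 1 | 1 < ‖x‖}, ‖x‖ₑ ^ 2 ∂T.nu < ⊤ →
            (∃ X, MMA.IsCausalMMA P π T Λ MMA.supOUKernel X) ∧
            ∀ X, MMA.IsCausalMMA P π T Λ MMA.supOUKernel X →
              MMA.IsThetaWeaklyDependent P X (fun r =>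
                Real.sqrt (cov[fun ω => X 0 ω 0, fun ω => X (2 * r) ω 0; P])) ∧
              ∀ r : ℝ, 0 ≤ r →
                Real.sqrt (MMA.tailVar π T MMA.supOUKernel r)
                    = Real.sqrt (∫ A : Set.Iio (0 : ℝ), (∫ s in Set.Iic (-r),
                        Real.exp (-2 * (A : ℝ) * s) * T.sigL 0 0) ∂π) ∧
                Real.sqrt (MMA.tailVar π T MMA.supOUKernel r)
                    = Real.sqrt (-(T.sigL 0 0) * ∫ A : Set.Iio (0 : ℝ),
                        Real.exp (2 * (A : ℝ) * r) / (2 * (A : ℝ)) ∂π) ∧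
                Real.sqrt (MMA.tailVar π T MMA.supOUKernel r)
                    = Real.sqrt (cov[fun ω => X 0 ω 0, fun ω => X (2 * r) ω 0; P])) ∧
        -- arbitrary mean, finite second moment, non-deterministic
        (∫⁻ x in {x : MMA.E 1 | 1 < ‖x‖}, ‖x‖ₑ ^ 2 ∂T.nu < ⊤ →
          (T.sig ≠ 0 ∨ T.nu ≠ 0) →
          ∀ μ : ℝ, μ = ∫ ω, MMA.levyOne Λ ω 0 ∂P →
            (∃ X, MMA.IsCausalMMA P π T Λ MMA.supOUKernel X) ∧
            ∀ X, MMA.IsCausalMMA P π T Λ MMA.supOUKernel X →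
              MMA.IsThetaWeaklyDependent P X (fun r =>
                Real.sqrt (cov[fun ω => X 0 ω 0, fun ω => X (2 * r) ω 0; P]
                  + 4 * μ ^ 2 / (T.sigL 0 0) ^ 2
                    * (cov[fun ω => X 0 ω 0, fun ω => X r ω 0; P]) ^ 2)) ∧
              ∀ r : ℝ, 0 ≤ r →
                Real.sqrt (MMA.tailVar π T MMA.supOUKernel r
                    + ‖MMA.tailMean π T MMA.supOUKernel r‖ ^ 2)
                  = Real.sqrt (cov[fun ω => X 0 ω 0, fun ω => X (2 * r) ω 0; P]
                    + 4 * μ ^ 2 / (T.sigL 0 0) ^ 2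
                      * (cov[fun ω => X 0 ω 0, fun ω => X r ω 0; P]) ^ 2)) ∧
        -- subordinator with finite mean
        (T.sig = 0 →
          ∫⁻ x, ‖x‖ₑ ∂T.nu < ⊤ →
          0 ≤ T.gam0 0 →
          T.nu {x | x 0 < 0} = 0 →
          ∀ μ : ℝ, μ = ∫ ω, MMA.levyOne Λ ω 0 ∂P →
            (∃ X, MMA.IsCausalMMA P π T Λ MMA.supOUKernel X) ∧
            ∀ X, MMA.IsCausalMMA P π T Λ MMA.supOUKernel X →
              (MMA.IsThetaWeaklyDependent P X (fun r =>
                -μ * ∫ A : Set.Iio (0 : ℝ), Real.exp ((A : ℝ) * r) / (A : ℝ) ∂π) ∧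
              ∀ r : ℝ, 0 ≤ r →
                MMA.tailAbs π T MMA.supOUKernel r
                  = -μ * ∫ A : Set.Iio (0 : ℝ), Real.exp ((A : ℝ) * r) / (A : ℝ) ∂π) ∧
              -- in addition: finite second moment, non-deterministic
              (∫⁻ x in {x : MMA.E 1 | 1 < ‖x‖}, ‖x‖ₑ ^ 2 ∂T.nu < ⊤ →
                T.nu ≠ 0 →
                  MMA.IsThetaWeaklyDependent P X (fun r =>
                    2 * μ / T.sigL 0 0 * cov[fun ω => X 0 ω 0, fun ω => X r ω 0; P]) ∧
                  ∀ r : ℝ, 0 ≤ r →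
                    MMA.tailAbs π T MMA.supOUKernel r
                      = 2 * μ / T.sigL 0 0
                        * cov[fun ω => X 0 ω 0, fun ω => X r ω 0; P]))) := by
  refine ⟨?_, ?_⟩
  · intro S _ _ _ π _ n d T Λ hΛ f hfm
    refine ⟨fun h0 h2 hf => ?_, fun h2 hD hf => ?_, fun hs h1 hf => ?_⟩
    · have hmean : T.mean = 0 := by rw [← hΛ.integral_levyOne h2, h0]
      -- With zero mean this integrand vanishes, so by `driftCond_iff` the drift condition is
      -- automatic.
      have hw : Integrable (fun q => MMA.app (f q) T.mean) (MMA.halfMeasure π) := by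
        simp_rw [hmean, MMA.app_zero_right]
        exact integrable_zero _ _ _
      refine ⟨⟨hΛ.memLp_levyOne h2, fun a b => ?_⟩,
        MMA.exists_isCausalMMA_of_memLp_two hΛ h2 hfm hf hw, fun X hX => ?_⟩
      · rw [hΛ.integral_levyOne_mul h2, hmean]
        simp
      · refine (hX.isThetaWeaklyDependent_of_memLp_two hΛ h2 hf).congr fun r _ => ?_
        have ht : MMA.tailMean π T f r = 0 := by
          simp [MMA.tailMean, hmean, MMA.app_zero_right]
        rw [ht]
        simp
    · exact ⟨⟨hΛ.memLp_levyOne h2, hΛ.integral_levyOne h2, hΛ.covariance_levyOne h2⟩,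
        MMA.exists_isCausalMMA_of_memLp_two hΛ h2 hfm hf ((MMA.driftCond_iff h2 hf).1 hD),
        fun X hX => hX.isThetaWeaklyDependent_of_memLp_two hΛ h2 hf⟩
    · exact ⟨MMA.exists_isCausalMMA_of_memLp_one hΛ hs h1 hfm hf,
        fun X hX => hX.isThetaWeaklyDependent_of_memLp_one hΛ hs h1 hf⟩
  · intro π _ T Λ hΛ hπ
    have hexist : ∫⁻ x in {x : MMA.E 1 | 1 < ‖x‖}, ‖x‖ₑ ^ 2 ∂T.nu < ⊤ →
        ∃ X, MMA.IsCausalMMA P π T Λ MMA.supOUKernel X := fun h2 =>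
      MMA.exists_isCausalMMA_of_memLp_two hΛ h2 MMA.measurable_supOUKernel
        (MMA.memLp_two_supOUKernel hπ) (MMA.integrable_app_supOUKernel hπ T.mean)
    refine ⟨fun h0 h2 => ⟨hexist h2, fun X hX => ?_⟩,
      fun h2 hne μ hμ => ⟨hexist h2, fun X hX => ?_⟩, fun hs h1 hg hn μ hμ =>
        ⟨MMA.exists_isCausalMMA_of_memLp_one hΛ hs h1 MMA.measurable_supOUKernel
          (MMA.memLp_one_supOUKernel hπ), fun X hX => ?_⟩⟩
    · have hmean : T.mean = 0 := by rw [← hΛ.integral_levyOne h2, h0]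
      have hcov : ∀ r : ℝ, 0 ≤ r → MMA.tailVar π T MMA.supOUKernel r
          = cov[fun ω => X 0 ω 0, fun ω => X (2 * r) ω 0; P] := fun r hr => by
        rw [MMA.tailVar_supOU hπ hr, hX.covariance_supOU hΛ hπ h2 (by positivity)]
      refine ⟨?_, fun r hr => ⟨?_, ?_, by rw [hcov r hr]⟩⟩
      · refine (hX.isThetaWeaklyDependent_of_memLp_two hΛ h2 (MMA.memLp_two_supOUKernel hπ)).congr
          fun r hr => ?_
        rw [hcov r hr, MMA.tailMean_supOU hπ hr, hmean]
        simp
      · congr 1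
        refine integral_congr_ae (Eventually.of_forall fun A => ?_)
        refine setIntegral_congr_fun measurableSet_Iic fun s (hs : s ≤ -r) => ?_
        -- On `s ≤ -r` with `0 ≤ r` the time `-s` is nonnegative, so the cut-off in the kernel is
        -- inactive.
        rw [MMA.trace_supOUKernel, MMA.supOUEntry, if_pos (by simp only; linarith),
          ← Real.exp_add, mul_comm]
        congr 2
        ring
      · rw [MMA.tailVar_supOU hπ hr, mul_div_assoc, ← integral_div]
        congr 2
        refine integral_congr_ae (Eventually.of_forall fun A => ?_)
        simp only
        rw [div_div, mul_comm (A : ℝ) 2]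
        congr 2
        ring
    · have hμm : μ = T.mean 0 := by
        have h := (hΛ.inner_levyOne_moments h2 (EuclideanSpace.single 0 1)).2.1
        simp only [MMA.inner_single_eq] at h
        rw [hμ, h]
      have hσ := MMA.sigL_ne_zero h2 hne
      have heq : ∀ r : ℝ, 0 ≤ r → MMA.tailVar π T MMA.supOUKernel r
          + ‖MMA.tailMean π T MMA.supOUKernel r‖ ^ 2
          = cov[fun ω => X 0 ω 0, fun ω => X (2 * r) ω 0; P]
            + 4 * μ ^ 2 / (T.sigL 0 0) ^ 2
              * (cov[fun ω => X 0 ω 0, fun ω => X r ω 0; P]) ^ 2 := fun r hr => by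
        rw [MMA.tailVar_supOU hπ hr, MMA.tailMean_supOU hπ hr,
          hX.covariance_supOU hΛ hπ h2 (by positivity), hX.covariance_supOU hΛ hπ h2 hr, hμm]
        -- With `I` the integral at `r`, the lag `r` covariance is `-σ² I / 2` and the squared tail
        -- mean is `μ² I²`, that is `4 μ² / σ⁴` times the squared covariance.
        generalize ∫ A : Set.Iio (0 : ℝ), Real.exp ((A : ℝ) * (2 * r)) / (A : ℝ) ∂π = J
        generalize ∫ A : Set.Iio (0 : ℝ), Real.exp ((A : ℝ) * r) / (A : ℝ) ∂π = I
        field_simp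
        ring
      exact ⟨(hX.isThetaWeaklyDependent_of_memLp_two hΛ h2 (MMA.memLp_two_supOUKernel hπ)).congr
        fun r hr => by rw [heq r hr], fun r hr => by rw [heq r hr]⟩
    · have hμm : μ = T.mean 0 := by
        have h := hΛ.integral_levyOne_of_integrable hs h1 (EuclideanSpace.single 0 1)
        simp only [MMA.inner_single_eq] at h
        rw [hμ, h]
      have hθ := hX.isThetaWeaklyDependent_of_memLp_one hΛ hs h1 (MMA.memLp_one_supOUKernel hπ)
      have heq : ∀ r : ℝ, 0 ≤ r → MMA.tailAbs π T MMA.supOUKernel r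
          = -μ * ∫ A : Set.Iio (0 : ℝ), Real.exp ((A : ℝ) * r) / (A : ℝ) ∂π := fun r hr => by
        rw [MMA.tailAbs_supOU hπ h1 hg hn hr, hμm]
      refine ⟨⟨hθ.congr heq, heq⟩, fun h2 hne => ?_⟩
      have hσ := MMA.sigL_ne_zero h2 (Or.inr hne)
      have heq' : ∀ r : ℝ, 0 ≤ r → MMA.tailAbs π T MMA.supOUKernel r
          = 2 * μ / T.sigL 0 0 * cov[fun ω => X 0 ω 0, fun ω => X r ω 0; P] := fun r hr => by
        -- The coefficient is `-μ I` and the covariance is `-σ² I / 2`, so their ratio is `2 μ / σ²`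
        -- wherever `I` is nonzero.
        rw [heq r hr, hX.covariance_supOU hΛ hπ h2 hr]
        generalize ∫ A : Set.Iio (0 : ℝ), Real.exp ((A : ℝ) * r) / (A : ℝ) ∂π = I
        field_simp
      exact ⟨hθ.congr heq', heq'⟩
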